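/- For $N\ge 0$ let $\mathcal H_N=L^2(\mathbb R^N)$, let $\mathbf R=(Q_1,P_1,\dots,Q_N,P_N)^T$ be the canonical operators, $\mathbf\Omega=\bigoplus_{j=1}^N\begin{pmatrix}0&1\\-1&0\end{pmatrix}$ (on the phase space $\mathbb R^{2N}$; its size is clear from the context) and $W(\mathbf x)=e^{-i\mathbf x^T\mathbf\Omega\mathbf R}$, $\mathbf x\in\mathbb R^{2N}$, the Weyl operators. Matrix inequalities are meant in the sense of complex Hermitian positive semidefiniteness. *Definitions.* - A *Gaussian channel* is a completely positive, unital, normal linear map $\Lambda:\mathcal L(\mathcal H_{N'})\to\mathcal L(\mathcal H_N)$ (Heisenberg picture) with $\Lambda(W(\mathbf x))=W(\mathbf A\mathbf x)\,e^{-\frac14\mathbf x^T\mathbf B\mathbf x-i\mathbf c^T\mathbf x}$ for all $\mathbf x\in\mathbb R^{2N'}$, for some real matrices $\mathbf A$ ($2N\times 2N'$), $\mathbf B$ ($2N'\times 2N'$) with $\mathbf B+i\mathbf\Omega-i\mathbf A^T\mathbf\Omega\mathbf A\ge 0$ and some $\mathbf c\in\mathbb R^{2N'}$. - A *Gaussian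 observable* is a POVM $\mathsf E:\mathcal B(\mathbb R^M)\to\mathcal L(\mathcal H_N)$ with $\int e^{i\mathbf p^T\mathbf x}\,d\mathsf E(\mathbf x)=W(\mathbf K\mathbf p)\,e^{-\frac14\mathbf p^T\mathbf L\mathbf p-i\mathbf m^T\mathbf p}$ for some real $\mathbf K,\mathbf L$ with $\mathbf L-i\mathbf K^T\mathbf\Omega\mathbf K\ge 0$ and some $\mathbf m\in\mathbb R^M$. - A *Gaussian postprocessing* is a Markov kernel $f$ from $\mathbb R^{M}$ to $\mathbb R^{M'}$ with $\int e^{i\mathbf p^T\mathbf y}f(d\mathbf y,\mathbf x)=e^{i(\mathbf a\mathbf p)^T\mathbf x}e^{-\frac14\mathbf p^T\mathbf b\mathbf p-i\mathbf d^T\mathbf p}$ for a real matrix $\mathbf a$, a real $\mathbf b\ge0$ and a real vector $\mathbf d$; it takes an observable $\mathsf G$ to $X\mapsto\int f(X,\mathbf x)\,d\mathsf G(\mathbf x)$. - A collection of Gaussian observables (with possibly different $M$) is *Gaussian compatible* if a single Gaussian observable $\mathsf G$ yields each of its members by a Gaussian postprocessing. $\Lambda$ is *Gaussian incompatibility breaking*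 if $\{\Lambda\circ\mathsf E:\mathsf E\text{ a Gaussian observable on }\mathcal H_{N'}\}$ is Gaussian compatible. - A bipartite state $\rho$ on $\mathcal H_N\otimes\mathcal H_M$ is *Gaussian* with covariance matrix $\mathbf V$ (real symmetric) and displacement $\mathbf r$ if $\mathrm{tr}[\rho\, W(\mathbf x_A)\otimes W(\mathbf x_B)]=e^{-\frac14\mathbf x^T\mathbf\Omega^T\mathbf V\mathbf\Omega\mathbf x-i(\mathbf\Omega\mathbf r)^T\mathbf x}$ for all $\mathbf x=(\mathbf x_A,\mathbf x_B)$, where $\mathbf\Omega=\mathbf\Omega_A\oplus\mathbf\Omega_B$. - $\Lambda$ *breaks the steerability* of a bipartite Gaussian state $\rho$ on $\mathcal H_N\otimes\mathcal H_M$ if the state $(\Lambda_*\otimes\mathrm{Id})(\rho)$ on $\mathcal H_{N'}\otimes\mathcal H_M$, given by $\mathrm{tr}[(\Lambda_*\otimes\mathrm{Id})(\rho)\,X\otimes Y]=\mathrm{tr}[\rho\,\Lambda(X)\otimes Y]$, is Gaussian with a covariance matrix $\mathbf V$ satisfying the non-steerability condition $\mathbf V+i(\mathbf 0\oplus\mathbf\Omega)\ge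 0$. - For $r>0$ the *regularised EPR state* $\rho_r$ on $\mathcal H_N\otimes\mathcal H_N$ is the Gaussian state with displacement $0$ and covariance matrix $\begin{pmatrix}\cosh r\,\mathbf I&\sinh r\,\mathbf Z\\ \sinh r\,\mathbf Z&\cosh r\,\mathbf I\end{pmatrix}$, $\mathbf Z=\bigoplus_{j=1}^N\begin{pmatrix}1&0\\0&-1\end{pmatrix}$. **Proposition.** Let $\Lambda:\mathcal L(\mathcal H_{N'})\to\mathcal L(\mathcal H_N)$ be a Gaussian channel. The following conditions are equivalent: (i) $\Lambda$ is Gaussian incompatibility breaking; (ii) $\Lambda$ breaks the steerability of every bipartite Gaussian state on $\mathcal H_N\otimes\mathcal H_M$, for every $M$; (iii) $\Lambda$ breaks the steerability of the regularised EPR state $\rho_r$ for every $r>0$. -/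

import Mathlib

open MeasureTheory ProbabilityTheory Matrix
open scoped ComplexOrder InnerProductSpace TensorProduct Kronecker

noncomputable section

namespace GaussianCV

/-! ### Phase space -/

/-- Index set of the phase space `ℝ^{2N}`: the coordinate `(j, 0)` is the position `q_j` and
`(j, 1)` the momentum `p_j`. -/
abbrev Mode (N : ℕ) : Type := Fin N × Fin 2

/-- The symplectic form `Ω = ⨁_j [[0, 1], [-1, 0]]`. -/
def Omega (N : ℕ) : Matrix (Mode N) (Mode N) ℝ :=
  (1 : Matrix (Fin N) (Fin N) ℝ) ⊗ₖ !![0, 1; -1, 0]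

/-- `Z = ⨁_j σ_z`. -/
def sigmaZ (N : ℕ) : Matrix (Mode N) (Mode N) ℝ :=
  (1 : Matrix (Fin N) (Fin N) ℝ) ⊗ₖ !![1, 0; 0, -1]

/-- The complex matrix `S + i T`, for two real matrices `S`, `T`. -/
def complexComb {n : Type} (S T : Matrix n n ℝ) : Matrix n n ℂ :=
  S.map (fun a : ℝ => (a : ℂ)) + Complex.I • T.map (fun a : ℝ => (a : ℂ))

/-- The Gaussian factor `exp(-¼ xᵀ B x - i cᵀ x)`. -/
def gaussFactor {n : Type} [Fintype n] (B : Matrix n n ℝ) (c x : n → ℝ) : ℂ :=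
  Complex.exp (-(1 / 4 : ℂ) * ((x ⬝ᵥ B *ᵥ x : ℝ) : ℂ) - Complex.I * ((c ⬝ᵥ x : ℝ) : ℂ))

/-! ### The Hilbert space and the Weyl operators -/

/-- Configuration space `ℝ^N`. -/
abbrev Conf (N : ℕ) : Type := Fin N → ℝ

/-- The Hilbert space `L²(ℝ^N)` of `N` canonical degrees of freedom. -/
abbrev Hil (N : ℕ) : Type := Lp ℂ 2 (volume : Measure (Conf N))

/-- Bounded operators. -/
abbrev Op (E : Type*) [NormedAddCommGroup E] [InnerProductSpace ℂ E] : Type _ := E →L[ℂ] E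

/-- Position part of a phase space point. -/
def pos {N : ℕ} (x : Mode N → ℝ) : Conf N := fun j => x (j, 0)

/-- Momentum part of a phase space point. -/
def mom {N : ℕ} (x : Mode N → ℝ) : Conf N := fun j => x (j, 1)

/-- The function `t ↦ e^{-i q·p/2} e^{i p·t} f(t - q)`, for `x = (q, p)`. -/
def weylFun {N : ℕ} (x : Mode N → ℝ) (f : Conf N → ℂ) : Conf N → ℂ := fun t =>
  Complex.exp (Complex.I * ((mom x ⬝ᵥ t - pos x ⬝ᵥ mom x / 2 : ℝ) : ℂ)) * f (t - pos x)

theorem norm_weylFun {N : ℕ} (x : Mode N → ℝ) (f : Conf N → ℂ) (t : Conf N) :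
    ‖weylFun x f t‖ = ‖f (t - pos x)‖ := by
  rw [weylFun, norm_mul, mul_comm Complex.I, Complex.norm_exp_ofReal_mul_I, one_mul]

theorem memLp_weylFun {N : ℕ} (x : Mode N → ℝ) (f : Hil N) :
    MemLp (weylFun x f) 2 (volume : Measure (Conf N)) := by
  have h := (Lp.memLp f).comp_measurePreserving
    (measurePreserving_sub_right (volume : Measure (Conf N)) (pos x))
  refine h.of_le ?_ (Filter.Eventually.of_forall fun t => (norm_weylFun x f t).le)
  refine AEStronglyMeasurable.mul ?_ h.1
  have : Continuous fun t : Conf N =>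
      Complex.exp (Complex.I * ((mom x ⬝ᵥ t - pos x ⬝ᵥ mom x / 2 : ℝ) : ℂ)) := by
    unfold dotProduct
    fun_prop
  exact this.aestronglyMeasurable

theorem weylFun_congr {N : ℕ} (x : Mode N → ℝ) {f g : Conf N → ℂ}
    (h : f =ᵐ[volume] g) : weylFun x f =ᵐ[volume] weylFun x g := by
  have h' := (measurePreserving_sub_right (volume : Measure (Conf N))
    (pos x)).quasiMeasurePreserving.ae_eq_comp h
  filter_upwards [h'] with t ht
  simp only [Function.comp_apply] at ht
  simp only [weylFun, ht]

/-- The Weyl operator `W(x) = exp(-i xᵀ Ω R) = exp(-i ∑_j (q_j P_j - p_j Q_j))` for `x = (q, p)`,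
which acts on `L²(ℝ^N)` by `(W(x) f)(t) = e^{-i q·p/2} e^{i p·t} f(t - q)`. -/
def weyl {N : ℕ} (x : Mode N → ℝ) : Op (Hil N) :=
  LinearMap.mkContinuous
    { toFun := fun f => (memLp_weylFun x f).toLp (weylFun x f)
      map_add' := by
        intro f g
        rw [← MemLp.toLp_add, MemLp.toLp_eq_toLp_iff]
        refine (weylFun_congr x (Lp.coeFn_add f g)).trans (Filter.Eventually.of_forall fun t => ?_)
        simp only [weylFun, Pi.add_apply, mul_add]
      map_smul' := by
        intro c f
        rw [RingHom.id_apply, ← MemLp.toLp_const_smul, MemLp.toLp_eq_toLp_iff]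
        refine (weylFun_congr x (Lp.coeFn_smul c f)).trans (Filter.Eventually.of_forall fun t => ?_)
        simp only [weylFun, Pi.smul_apply, smul_eq_mul]
        ring }
    1 (by
      intro f
      have h := eLpNorm_comp_measurePreserving (p := 2) (Lp.memLp f).1
        (measurePreserving_sub_right (volume : Measure (Conf N)) (pos x))
      have h2 : eLpNorm (weylFun x f) 2 (volume : Measure (Conf N)) = eLpNorm f 2 volume := by
        rw [← h]
        exact eLpNorm_congr_norm_ae (Filter.Eventually.of_forall fun t => norm_weylFun x f t)
      rw [one_mul, LinearMap.coe_mk, AddHom.coe_mk, Lp.norm_toLp, h2, Lp.norm_def])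

theorem weyl_ae {N : ℕ} (x : Mode N → ℝ) (f : Hil N) :
    weyl x f =ᵐ[volume] weylFun x f :=
  (memLp_weylFun x f).coeFn_toLp

/-! ### Hilbert tensor products -/

/-- The Hilbert space tensor product of two inner product spaces. -/
abbrev HilTensor (E F : Type*) [NormedAddCommGroup E] [InnerProductSpace ℂ E]
    [NormedAddCommGroup F] [InnerProductSpace ℂ F] : Type _ :=
  UniformSpace.Completion (E ⊗[ℂ] F)

section Tensor

variable {E F : Type*} [NormedAddCommGroup E] [InnerProductSpace ℂ E]
  [NormedAddCommGroup F] [InnerProductSpace ℂ F]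

theorem norm_sum_tmul_sq {n : ℕ} (a : Fin n → E) (e : Fin n → F) (he : Orthonormal ℂ e) :
    ‖∑ j, a j ⊗ₜ[ℂ] e j‖ ^ 2 = ∑ j, ‖a j‖ ^ 2 := by
  have h : (inner ℂ (∑ j, a j ⊗ₜ[ℂ] e j) (∑ j, a j ⊗ₜ[ℂ] e j)) = ((∑ j, ‖a j‖ ^ 2 : ℝ) : ℂ) := by
    rw [sum_inner]
    push_cast
    refine Finset.sum_congr rfl fun i _ => ?_
    rw [inner_sum, Finset.sum_eq_single i]
    · rw [TensorProduct.inner_tmul, inner_self_eq_norm_sq_to_K, inner_self_eq_norm_sq_to_K, he.1 i]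
      simp
    · intro j _ hj
      rw [TensorProduct.inner_tmul, he.2 (Ne.symm hj), mul_zero]
    · simp
  have h' := (inner_self_eq_norm_sq_to_K (𝕜 := ℂ) (∑ j, a j ⊗ₜ[ℂ] e j)).symm.trans h
  exact Complex.ofReal_injective (by simpa using h')

theorem exists_orthonormal_sum (z : E ⊗[ℂ] F) :
    ∃ (n : ℕ) (a : Fin n → E) (e : Fin n → F), Orthonormal ℂ e ∧ z = ∑ j, a j ⊗ₜ[ℂ] e j := by
  obtain ⟨E', F', _, _, hz⟩ :=
    TensorProduct.exists_finite_submodule_of_setFinite {z} (Set.finite_singleton z)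
  obtain ⟨y, rfl⟩ := Set.singleton_subset_iff.mp hz
  let f := stdOrthonormalBasis ℂ F'
  obtain ⟨b, hb⟩ := TensorProduct.eq_repr_basis_right f.toBasis y
  refine ⟨_, fun j => (b j : E), fun j => (f j : F), ?_, ?_⟩
  · exact f.orthonormal.comp_linearIsometry F'.subtypeₗᵢ
  · rw [← hb, Finsupp.sum_fintype _ _ (by simp), map_sum]
    simp [TensorProduct.mapIncl]

theorem norm_rTensor_le (X : Op E) (z : E ⊗[ℂ] F) :
    ‖LinearMap.rTensor F X.toLinearMap z‖ ≤ ‖X‖ * ‖z‖ := by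
  obtain ⟨n, a, e, he, rfl⟩ := exists_orthonormal_sum z
  refine le_of_sq_le_sq ?_ (by positivity)
  rw [map_sum, mul_pow, norm_sum_tmul_sq a e he]
  simp only [LinearMap.rTensor_tmul]
  rw [norm_sum_tmul_sq _ e he, Finset.mul_sum]
  refine Finset.sum_le_sum fun j _ => ?_
  rw [← mul_pow]
  exact pow_le_pow_left₀ (norm_nonneg _) (X.le_opNorm _) 2

theorem norm_lTensor_le (Y : Op F) (z : E ⊗[ℂ] F) :
    ‖LinearMap.lTensor E Y.toLinearMap z‖ ≤ ‖Y‖ * ‖z‖ := by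
  have h := norm_rTensor_le (F := E) Y (TensorProduct.comm ℂ E F z)
  rw [TensorProduct.norm_comm, ← LinearMap.comm_comp_lTensor_comp_comm_eq] at h
  simpa using h

/-- The bounded operator `X ⊗ Y` on the Hilbert space tensor product. -/
def opTensor (X : Op E) (Y : Op F) : Op (HilTensor E F) :=
  ((LinearMap.rTensor F X.toLinearMap).mkContinuous ‖X‖ (norm_rTensor_le X) ∘L
    (LinearMap.lTensor E Y.toLinearMap).mkContinuous ‖Y‖ (norm_lTensor_le Y)).completion

theorem opTensor_tmul (X : Op E) (Y : Op F) (f : E) (g : F) :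
    opTensor X Y ((f ⊗ₜ[ℂ] g : E ⊗[ℂ] F) : HilTensor E F)
      = ((X f ⊗ₜ[ℂ] Y g : E ⊗[ℂ] F) : HilTensor E F) := by
  simp [opTensor]

end Tensor

/-! ### States -/

/-- A quantum state on `E`, given by its expectation functional `X ↦ tr[ρ X]`. The functionals of
this form, with `ρ` a positive trace class operator of trace one, are exactly those of the form
`X ↦ ∑ₙ ⟪ψₙ, X ψₙ⟫` with `∑ₙ ‖ψₙ‖² = 1` (where `ρ = ∑ₙ |ψₙ⟩⟨ψₙ|`), and they determine `ρ`. -/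
structure QState (E : Type*) [NormedAddCommGroup E] [InnerProductSpace ℂ E] where
  expect : Op E →ₗ[ℂ] ℂ
  normal : ∃ ψ : ℕ → E, HasSum (fun n => ‖ψ n‖ ^ 2) 1 ∧
    ∀ X : Op E, HasSum (fun n => ⟪ψ n, X (ψ n)⟫_ℂ) (expect X)

/-- The symplectic form of a bipartite system of `N + M` modes. -/
def bipOmega (N M : ℕ) : Matrix (Mode N ⊕ Mode M) (Mode N ⊕ Mode M) ℝ :=
  Matrix.fromBlocks (Omega N) 0 0 (Omega M)

/-- `χ` is the Gaussian characteristic function with covariance matrix `V` and displacement `d`: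
`χ(x) = exp(-¼ xᵀ Ωᵀ V Ω x - i (Ω d)ᵀ x)`, with `V` real symmetric and `Ω` the symplectic form `Om`
of the phase space. -/
def IsGaussianChar {n : Type} [Fintype n] (Om : Matrix n n ℝ) (χ : (n → ℝ) → ℂ)
    (V : Matrix n n ℝ) (d : n → ℝ) : Prop :=
  V.IsSymm ∧ ∀ x, χ x = gaussFactor (Omᵀ * V * Om) (Om *ᵥ d) x

/-- The characteristic function `tr[ρ W(x_A) ⊗ W(x_B)]` of a bipartite state. -/
def bipChar {N M : ℕ} (ρ : QState (HilTensor (Hil N) (Hil M))) (x : Mode N ⊕ Mode M → ℝ) : ℂ :=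
  ρ.expect (opTensor (weyl (x ∘ Sum.inl)) (weyl (x ∘ Sum.inr)))

/-- `ρ` is a bipartite Gaussian state with covariance matrix `V` and displacement `d`. -/
def IsBipGaussian {N M : ℕ} (ρ : QState (HilTensor (Hil N) (Hil M)))
    (V : Matrix (Mode N ⊕ Mode M) (Mode N ⊕ Mode M) ℝ) (d : Mode N ⊕ Mode M → ℝ) : Prop :=
  IsGaussianChar (bipOmega N M) (bipChar ρ) V d

/-- The covariance matrix of the regularised EPR state `ρ_r`. -/
def eprCov (N : ℕ) (r : ℝ) : Matrix (Mode N ⊕ Mode N) (Mode N ⊕ Mode N) ℝ :=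
  Matrix.fromBlocks (Real.cosh r • 1) (Real.sinh r • sigmaZ N)
    (Real.sinh r • sigmaZ N) (Real.cosh r • 1)

/-- `ρ` is the regularised EPR state `ρ_r`, i.e. the centred Gaussian state with covariance matrix
`eprCov N r`. -/
def IsEPR {N : ℕ} (r : ℝ) (ρ : QState (HilTensor (Hil N) (Hil N))) : Prop :=
  IsBipGaussian ρ (eprCov N r) 0

/-! ### Channels -/

/-- A quantum channel in the Heisenberg picture from a system of `N` modes (input of the
Schrödinger picture) to a system of `N'` modes: a completely positive, unital, normal linear map
`Λ : L(L²(ℝ^{N'})) → L(L²(ℝ^N))`. Normality is stated as the existence of the Schrödinger picture: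
each state `ρ` has an image state `Λ_*(ρ)` with `tr[Λ_*(ρ) X] = tr[ρ Λ(X)]`. -/
structure QChannel (N N' : ℕ) where
  toCP : CompletelyPositiveMap (Op (Hil N')) (Op (Hil N))
  unital : toCP 1 = 1
  normal : ∀ ρ : QState (Hil N), ∃ ρ' : QState (Hil N'), ∀ X, ρ'.expect X = ρ.expect (toCP X)

/-- `Λ` is a Gaussian channel: `Λ(W(x)) = W(A x) exp(-¼ xᵀ B x - i cᵀ x)` for a triple `(A, B, c)`
with `B + iΩ - i Aᵀ Ω A ≥ 0`. -/
def QChannel.IsGaussian {N N' : ℕ} (Λ : QChannel N N') : Prop :=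
  ∃ (A : Matrix (Mode N) (Mode N') ℝ) (B : Matrix (Mode N') (Mode N') ℝ) (c : Mode N' → ℝ),
    (complexComb B (Omega N' - Aᵀ * Omega N * A)).PosSemidef ∧
    ∀ x : Mode N' → ℝ, Λ.toCP (weyl x) = gaussFactor B c x • weyl (A *ᵥ x)

/-! ### Observables -/

/-- An observable (POVM) of an `N` mode system with outcome space `ℝ^M`; σ-additivity is in the
weak operator topology (the diagonal matrix elements suffice, by polarization). -/
structure QObservable (N M : ℕ) where
  effect : Set (Fin M → ℝ) → Op (Hil N)
  nonneg : ∀ X, MeasurableSet X → (effect X).IsPositive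
  univ : effect Set.univ = 1
  sigmaAdditive : ∀ X : ℕ → Set (Fin M → ℝ), (∀ i, MeasurableSet (X i)) →
    Pairwise (Function.onFun Disjoint X) →
    ∀ ψ : Hil N, HasSum (fun i => ⟪ψ, effect (X i) ψ⟫_ℂ) ⟪ψ, effect (⋃ i, X i) ψ⟫_ℂ

theorem QObservable.hasSum_re {N M : ℕ} (E : QObservable N M) (ψ : Hil N)
    (X : ℕ → Set (Fin M → ℝ)) (hX : ∀ i, MeasurableSet (X i))
    (hd : Pairwise (Function.onFun Disjoint X)) :
    HasSum (fun i => (⟪ψ, E.effect (X i) ψ⟫_ℂ).re) (⟪ψ, E.effect (⋃ i, X i) ψ⟫_ℂ).re :=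
  Complex.hasSum_re (E.sigmaAdditive X hX hd ψ)

theorem QObservable.re_nonneg {N M : ℕ} (E : QObservable N M) (ψ : Hil N)
    {X : Set (Fin M → ℝ)} (hX : MeasurableSet X) : 0 ≤ (⟪ψ, E.effect X ψ⟫_ℂ).re :=
  (E.nonneg X hX).re_inner_nonneg_right ψ

/-- The measure `X ↦ ⟪ψ, E(X) ψ⟫`. -/
def QObservable.outcome {N M : ℕ} (E : QObservable N M) (ψ : Hil N) : Measure (Fin M → ℝ) :=
  Measure.ofMeasurable (fun X _ => ENNReal.ofReal (⟪ψ, E.effect X ψ⟫_ℂ).re)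
    (by
      have h := E.hasSum_re ψ (fun _ => ∅) (fun _ => MeasurableSet.empty)
        (fun _ _ _ => by simp [Function.onFun])
      have h0 := (summable_const_iff (β := ℕ) _).mp h.summable
      rw [h0, ENNReal.ofReal_zero])
    (by
      intro X hX hd
      have h := E.hasSum_re ψ X hX hd
      rw [← h.tsum_eq, ENNReal.ofReal_tsum_of_nonneg (fun i => E.re_nonneg ψ (hX i)) h.summable])

theorem QObservable.outcome_apply {N M : ℕ} (E : QObservable N M) (ψ : Hil N)
    {X : Set (Fin M → ℝ)} (hX : MeasurableSet X) :
    E.outcome ψ X = ENNReal.ofReal (⟪ψ, E.effect X ψ⟫_ℂ).re :=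
  Measure.ofMeasurable_apply X hX

/-- `E` is a Gaussian observable: its Fourier transform is
`∫ e^{i pᵀx} dE(x) = W(K p) exp(-¼ pᵀ L p - i mᵀ p)` for a triple `(K, L, m)` with
`L - i Kᵀ Ω K ≥ 0`. -/
def QObservable.IsGaussian {N M : ℕ} (E : QObservable N M) : Prop :=
  ∃ (K : Matrix (Mode N) (Fin M) ℝ) (L : Matrix (Fin M) (Fin M) ℝ) (m : Fin M → ℝ),
    (complexComb L (-(Kᵀ * Omega N * K))).PosSemidef ∧
    ∀ (p : Fin M → ℝ) (ψ : Hil N),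
      ∫ x, Complex.exp (Complex.I * ((p ⬝ᵥ x : ℝ) : ℂ)) ∂(E.outcome ψ)
        = ⟪ψ, (gaussFactor L m p • weyl (K *ᵥ p)) ψ⟫_ℂ

/-- The vector state of a unit vector. -/
def vectorState {E : Type*} [NormedAddCommGroup E] [InnerProductSpace ℂ E] (ψ : E)
    (hψ : ‖ψ‖ = 1) : QState E where
  expect :=
    { toFun := fun X => ⟪ψ, X ψ⟫_ℂ
      map_add' := fun X Y => inner_add_right _ _ _
      map_smul' := fun c X => inner_smul_right _ _ _ }
  normal := by
    refine ⟨fun n => if n = 0 then ψ else 0, ?_, fun X => ?_⟩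
    · have h := hasSum_single (f := fun n : ℕ => ‖(if n = 0 then ψ else 0 : E)‖ ^ 2) 0
        (fun n hn => by simp [hn])
      simpa [hψ] using h
    · have h := hasSum_single (f := fun n : ℕ =>
        ⟪(if n = 0 then ψ else 0 : E), X (if n = 0 then ψ else 0 : E)⟫_ℂ) 0
        (fun n hn => by simp [hn])
      simpa using h

theorem vectorState_expect {E : Type*} [NormedAddCommGroup E] [InnerProductSpace ℂ E] (ψ : E)
    (hψ : ‖ψ‖ = 1) (X : Op E) : (vectorState ψ hψ).expect X = ⟪ψ, X ψ⟫_ℂ := rfl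

theorem QChannel.isPositive {N N' : ℕ} (Λ : QChannel N N') {X : Op (Hil N')}
    (hX : X.IsPositive) : (Λ.toCP X).IsPositive := by
  rw [← ContinuousLinearMap.nonneg_iff_isPositive] at hX ⊢
  exact map_nonneg Λ.toCP hX

theorem QChannel.exists_hasSum {N N' : ℕ} (Λ : QChannel N N') (ψ : Hil N) :
    ∃ φ : ℕ → Hil N', ∀ X, HasSum (fun n => ⟪φ n, X (φ n)⟫_ℂ) ⟪ψ, Λ.toCP X ψ⟫_ℂ := by
  by_cases h : ψ = 0
  · exact ⟨fun _ => 0, fun X => by simp [h]⟩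
  have hn : ‖ψ‖ ≠ 0 := norm_ne_zero_iff.mpr h
  obtain ⟨ρ', hρ'⟩ := Λ.normal (vectorState (((‖ψ‖⁻¹ : ℝ) : ℂ) • ψ) (by
    rw [norm_smul, Complex.norm_real, norm_inv, norm_norm, inv_mul_cancel₀ hn]))
  obtain ⟨φ, -, hφ⟩ := ρ'.normal
  refine ⟨fun n => (‖ψ‖ : ℂ) • φ n, fun X => ?_⟩
  have h1 := (hφ X).mul_left ((‖ψ‖ : ℂ) * (‖ψ‖ : ℂ))
  have hc : (‖ψ‖ : ℂ) ≠ 0 := by exact_mod_cast hn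
  have hl : (fun n => ⟪(‖ψ‖ : ℂ) • φ n, X ((‖ψ‖ : ℂ) • φ n)⟫_ℂ)
      = fun n => (‖ψ‖ : ℂ) * (‖ψ‖ : ℂ) * ⟪φ n, X (φ n)⟫_ℂ := by
    funext n
    rw [map_smul, inner_smul_left, inner_smul_right, Complex.conj_ofReal, mul_assoc]
  have hr : ⟪ψ, Λ.toCP X ψ⟫_ℂ = (‖ψ‖ : ℂ) * (‖ψ‖ : ℂ) * ρ'.expect X := by
    rw [hρ' X, vectorState_expect, map_smul, inner_smul_left, inner_smul_right,
      Complex.conj_ofReal, Complex.ofReal_inv]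
    field_simp
  rw [hl, hr]
  exact h1

theorem inner_eq_re {N : ℕ} {T : Op (Hil N)} (hT : T.IsPositive) (ψ : Hil N) :
    ⟪ψ, T ψ⟫_ℂ = (((⟪ψ, T ψ⟫_ℂ).re : ℝ) : ℂ) :=
  Complex.ext rfl ((Complex.nonneg_iff.mp (hT.inner_nonneg_right ψ)).2.symm)

theorem QChannel.hasSum_inner {N N' M : ℕ} (Λ : QChannel N N') (E : QObservable N' M)
    (X : ℕ → Set (Fin M → ℝ)) (hX : ∀ i, MeasurableSet (X i))
    (hd : Pairwise (Function.onFun Disjoint X)) (ψ : Hil N) :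
    HasSum (fun i => ⟪ψ, Λ.toCP (E.effect (X i)) ψ⟫_ℂ)
      ⟪ψ, Λ.toCP (E.effect (⋃ i, X i)) ψ⟫_ℂ := by
  obtain ⟨φ, hφ⟩ := Λ.exists_hasSum ψ
  have hU := MeasurableSet.iUnion hX
  have hrow := fun n => E.hasSum_re (φ n) X hX hd
  have hcol := fun i => Complex.hasSum_re (hφ (E.effect (X i)))
  have htot := Complex.hasSum_re (hφ (E.effect (⋃ i, X i)))
  have hsum : Summable fun q : ℕ × ℕ => (⟪φ q.1, E.effect (X q.2) (φ q.1)⟫_ℂ).re := by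
    rw [summable_prod_of_nonneg fun q => E.re_nonneg (φ q.1) (hX q.2)]
    refine ⟨fun n => (hrow n).summable, ?_⟩
    simpa only [(hrow _).tsum_eq] using htot.summable
  have h1 := hsum.hasSum.prod_fiberwise hrow
  have h2 := ((Equiv.prodComm ℕ ℕ).hasSum_iff.mpr hsum.hasSum).prod_fiberwise hcol
  rw [h1.unique htot] at h2
  have h3 := Complex.hasSum_ofReal.mpr h2
  rw [← inner_eq_re (Λ.isPositive (E.nonneg _ hU))] at h3
  have hi : (fun i => ⟪ψ, Λ.toCP (E.effect (X i)) ψ⟫_ℂ)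
      = fun i => (((⟪ψ, Λ.toCP (E.effect (X i)) ψ⟫_ℂ).re : ℝ) : ℂ) :=
    funext fun i => inner_eq_re (Λ.isPositive (E.nonneg _ (hX i))) ψ
  rw [hi]
  exact h3

/-- The transformed observable `Λ(E) : X ↦ Λ(E(X))`. -/
def QChannel.mapObservable {N N' M : ℕ} (Λ : QChannel N N') (E : QObservable N' M) :
    QObservable N M where
  effect X := Λ.toCP (E.effect X)
  nonneg X hX := Λ.isPositive (E.nonneg X hX)
  univ := by rw [E.univ, Λ.unital]
  sigmaAdditive X hX hd ψ := Λ.hasSum_inner E X hX hd ψ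

/-! ### Gaussian postprocessing and compatibility -/

/-- A Gaussian postprocessing: a Markov kernel `f` with
`∫ e^{i pᵀy} f(dy, x) = e^{i (A p)ᵀ x} exp(-¼ pᵀ B p - i cᵀ p)` for a triple `(A, B, c)` with
`B ≥ 0`. -/
def IsGaussianKernel {M M' : ℕ} (f : Kernel (Fin M → ℝ) (Fin M' → ℝ)) : Prop :=
  IsMarkovKernel f ∧
  ∃ (A : Matrix (Fin M) (Fin M') ℝ) (B : Matrix (Fin M') (Fin M') ℝ) (c : Fin M' → ℝ),
    B.PosSemidef ∧
    ∀ (x : Fin M → ℝ) (p : Fin M' → ℝ),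
      ∫ y, Complex.exp (Complex.I * ((p ⬝ᵥ y : ℝ) : ℂ)) ∂(f x)
        = Complex.exp (Complex.I * (((A *ᵥ p) ⬝ᵥ x : ℝ) : ℂ)) * gaussFactor B c p

/-- `E` is the postprocessing `E(X) = ∫ f(X, x) dG(x)` of `G` by the kernel `f`. -/
def IsPostprocessing {N M M' : ℕ} (f : Kernel (Fin M → ℝ) (Fin M' → ℝ))
    (G : QObservable N M) (E : QObservable N M') : Prop :=
  ∀ X, MeasurableSet X → ∀ ψ : Hil N, E.outcome ψ X = ∫⁻ x, f x X ∂(G.outcome ψ)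

/-- A collection of observables (with outcome spaces `ℝ^M`, `M` arbitrary) is Gaussian compatible
if there is one Gaussian observable `G` from which each member is obtained by a Gaussian
postprocessing. -/
def GaussianCompatible {N : ℕ} (S : Set (Σ M : ℕ, QObservable N M)) : Prop :=
  ∃ (M₀ : ℕ) (G : QObservable N M₀), G.IsGaussian ∧
    ∀ E ∈ S, ∃ f : Kernel (Fin M₀ → ℝ) (Fin E.1 → ℝ),
      IsGaussianKernel f ∧ IsPostprocessing f G E.2

/-- `Λ` breaks the Gaussian incompatibility of `S` if `Λ(S)` is Gaussian compatible. -/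
def QChannel.BreaksGaussianIncompatibility {N N' : ℕ} (Λ : QChannel N N')
    (S : Set (Σ M : ℕ, QObservable N' M)) : Prop :=
  GaussianCompatible ((fun E : Σ M : ℕ, QObservable N' M =>
    (⟨E.1, Λ.mapObservable E.2⟩ : Σ M : ℕ, QObservable N M)) '' S)

/-- `Λ` is Gaussian incompatibility breaking: it breaks the Gaussian incompatibility of the set of
all Gaussian observables. -/
def QChannel.IsGaussianIncompatibilityBreaking {N N' : ℕ} (Λ : QChannel N N') : Prop :=
  Λ.BreaksGaussianIncompatibility {E | E.2.IsGaussian}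

/-! ### Steerability breaking -/

/-- The expectation value `tr[(Λ_* ⊗ Id)(ρ) X ⊗ Y] = tr[ρ Λ(X) ⊗ Y]` of a product operator in the
state obtained from `ρ` by applying the channel `Λ` on Alice's side. By normality these values
determine the state `(Λ_* ⊗ Id)(ρ)`. -/
def QChannel.aliceExpect {N N' M : ℕ} (Λ : QChannel N N') (ρ : QState (HilTensor (Hil N) (Hil M)))
    (X : Op (Hil N')) (Y : Op (Hil M)) : ℂ :=
  ρ.expect (opTensor (Λ.toCP X) Y)

/-- The characteristic function of `(Λ_* ⊗ Id)(ρ)`. -/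
def QChannel.aliceChar {N N' M : ℕ} (Λ : QChannel N N') (ρ : QState (HilTensor (Hil N) (Hil M)))
    (x : Mode N' ⊕ Mode M → ℝ) : ℂ :=
  Λ.aliceExpect ρ (weyl (x ∘ Sum.inl)) (weyl (x ∘ Sum.inr))

/-- The non-steerability condition `V + i (0 ⊕ Ω) ≥ 0` on a bipartite covariance matrix. -/
def NonSteerable {N M : ℕ} (V : Matrix (Mode N ⊕ Mode M) (Mode N ⊕ Mode M) ℝ) : Prop :=
  (complexComb V (Matrix.fromBlocks 0 0 0 (Omega M))).PosSemidef

/-- `Λ` breaks the steerability of `ρ`: the state `(Λ_* ⊗ Id)(ρ)` is Gaussian and its covariance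
matrix satisfies the non-steerability condition. -/
def QChannel.BreaksSteerability {N N' M : ℕ} (Λ : QChannel N N')
    (ρ : QState (HilTensor (Hil N) (Hil M))) : Prop :=
  ∃ (V : Matrix (Mode N' ⊕ Mode M) (Mode N' ⊕ Mode M) ℝ) (d : Mode N' ⊕ Mode M → ℝ),
    IsGaussianChar (bipOmega N' M) (Λ.aliceChar ρ) V d ∧ NonSteerable V

/-- `Λ` is Gaussian steerability breaking: it breaks the steerability of every bipartite Gaussian
state, for any number of modes on Bob's side. -/
def QChannel.IsGaussianSteerabilityBreaking {N N' : ℕ} (Λ : QChannel N N') : Prop :=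
  ∀ (M : ℕ) (ρ : QState (HilTensor (Hil N) (Hil M)))
    (V : Matrix (Mode N ⊕ Mode M) (Mode N ⊕ Mode M) ℝ) (d : Mode N ⊕ Mode M → ℝ),
    IsBipGaussian ρ V d → Λ.BreaksSteerability ρ

end GaussianCV

end

/-!
All three conditions are equivalent to the noise condition `B - i Aᵀ Ω A ≥ 0` on the parameters
`(A, B, c)` of the channel `Λ(W(x)) = exp(-¼ xᵀ B x - i cᵀ x) W(A x)`. In real terms it says that
`B` is symmetric and `uᵀ B u + vᵀ B v + 2 (A u)ᵀ Ω (A v) ≥ 0` for all `u`, `v`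
(`posSemidef_noise_iff`).

*Steerability.* Up to the symplectic transformation `Ω`, a Gaussian state with covariance matrix
`V` is sent to one with covariance matrix `(A ⊕ 1)ᵀ V (A ⊕ 1) + (B ⊕ 0)`. Every Gaussian state
satisfies the uncertainty relation `V + i Ω ≥ 0` (`uncertainty`), because expectation values of
operators `S* S` with `S` a combination of Weyl operators at points of order `√s` are nonnegative,
and the first order term in `s` is the uncertainty relation. Adding the pullback of the uncertainty
relation to the noise condition gives non-steerability
(`isGaussianSteerabilityBreaking_of_noise`). Conversely, the covariance matrix of `ρ_r`, conjugated
with `Ω`, is of order `e^{-r}` on the vectors `(a, Z a)`. Non-steerability of the image of `ρ_r`,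
tested on the vectors `(w, Z A w)` with `w = u + i v`, is therefore the noise condition up to an
error which vanishes as `r → ∞` (`noise_of_breaksSteerability_epr`). For this
implication the states `ρ_r` have to exist: they are the vector states of superpositions
`∫ w(u) (g_u ⊗ g_u) du` of pairs of equally displaced Gaussian wave packets (`exists_isEPR`).

*Incompatibility.* A positive semidefinite `L - i Kᵀ Ω K` is the parameter of some Gaussian
observable (`exists_gaussianObservable`). Writing the matrix as a Gram matrix provides `C` with
`Cᵀ C = L` and `Cᵀ Ω C = -Kᵀ Ω K`, so the operators `W(K p) ⊗ W(C p)` have no symplectic phase among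
each other. Their matrix elements in vectors `ψ ⊗ φ`, with `φ` the vacuum, are then Gram kernels
depending only on the difference of the arguments; Bochner's theorem
(`exists_charFun_eq_of_gram`) turns them into measures, and polarization turns the measures into
effects (`exists_observable_of_measure`). Under the noise condition there is thus a Gaussian
observable with the parameters `(A, B, c)` of the channel itself, and comparison of Fourier
transforms shows that the image of the Gaussian observable `(K, L, m)` is its postprocessing with
the Gaussian kernel with parameters `(K, L, m)` (`isGaussianIncompatibilityBreaking_of_noise`).
Conversely, a common observable for the images of the quadratures suffices for the noise condition
(`noise_of_isGaussianIncompatibilityBreaking`): Weyl operators at different points are not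
proportional, so the parameters can be read off from the Fourier transforms.
-/

namespace GaussianCV

/-! ### The Weyl operators -/

theorem dotProduct_Omega {N : ℕ} (x y : Mode N → ℝ) :
    x ⬝ᵥ Omega N *ᵥ y = pos x ⬝ᵥ mom y - mom x ⬝ᵥ pos y := by
  simp [Omega, dotProduct, mulVec, Fintype.sum_prod_type, Matrix.one_apply, pos, mom,
    Finset.sum_add_distrib, sub_eq_add_neg]

/-- The canonical commutation relations in Weyl form. -/
theorem weyl_weyl {N : ℕ} (x y : Mode N → ℝ) (f : Hil N) :
    weyl x (weyl y f)
      = Complex.exp (-(Complex.I / 2) * ((x ⬝ᵥ Omega N *ᵥ y : ℝ) : ℂ)) • weyl (x + y) f := by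
  refine Lp.ext ?_
  have h1 := (weyl_ae x (weyl y f)).trans (weylFun_congr x (weyl_ae y f))
  refine h1.trans (Filter.EventuallyEq.trans ?_ (Lp.coeFn_smul _ _).symm)
  filter_upwards [weyl_ae (x + y) f] with t ht
  rw [Pi.smul_apply, ht, smul_eq_mul]
  simp only [weylFun]
  have hp : pos (x + y) = pos x + pos y := rfl
  have hm : mom (x + y) = mom x + mom y := rfl
  rw [← mul_assoc, ← mul_assoc, ← Complex.exp_add, ← Complex.exp_add, dotProduct_Omega, hp, hm,
    sub_sub]
  congr 2
  simp only [dotProduct_sub, add_dotProduct, dotProduct_add]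
  rw [dotProduct_comm (mom y) (pos x), dotProduct_comm (mom x) (pos y)]
  push_cast
  ring

theorem weyl_zero {N : ℕ} (f : Hil N) : weyl (0 : Mode N → ℝ) f = f := by
  refine Lp.ext ((weyl_ae 0 f).trans (Filter.Eventually.of_forall fun t => ?_))
  have hp : pos (0 : Mode N → ℝ) = 0 := rfl
  have hm : mom (0 : Mode N → ℝ) = 0 := rfl
  simp [weylFun, hp, hm]

theorem norm_weyl {N : ℕ} (x : Mode N → ℝ) (f : Hil N) : ‖weyl x f‖ = ‖f‖ := by
  have h := eLpNorm_comp_measurePreserving (p := 2) (Lp.memLp f).1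
    (measurePreserving_sub_right (volume : Measure (Conf N)) (pos x))
  rw [Lp.norm_def, Lp.norm_def, ← h, eLpNorm_congr_ae (weyl_ae x f)]
  congr 1
  exact eLpNorm_congr_norm_ae (Filter.Eventually.of_forall fun t => norm_weylFun x f t)

theorem inner_weyl_same {N : ℕ} (x : Mode N → ℝ) (f g : Hil N) :
    ⟪weyl x f, weyl x g⟫_ℂ = ⟪f, g⟫_ℂ :=
  (LinearMap.norm_map_iff_inner_map_map (weyl x)).mp (norm_weyl x) f g

theorem inner_weyl_weyl {N : ℕ} (x y : Mode N → ℝ) (f g : Hil N) :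
    ⟪weyl x f, weyl y g⟫_ℂ
      = Complex.exp ((Complex.I / 2) * ((x ⬝ᵥ Omega N *ᵥ y : ℝ) : ℂ)) * ⟪f, weyl (y - x) g⟫_ℂ := by
  rw [← inner_weyl_same (-x), weyl_weyl, weyl_weyl, neg_add_cancel, weyl_zero, neg_add_eq_sub]
  have h0 : x ⬝ᵥ Omega N *ᵥ x = 0 := by rw [dotProduct_Omega, dotProduct_comm, sub_self]
  rw [neg_dotProduct, h0, neg_dotProduct, inner_smul_left, inner_smul_right]
  simp [neg_mul, mul_neg]

/-- A family of vectors is continuous as soon as its Gram kernel is. -/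
theorem continuous_of_continuous_inner {X H : Type*} [TopologicalSpace X] [NormedAddCommGroup H]
    [InnerProductSpace ℂ H] (ξ : X → H)
    (h : Continuous fun p : X × X => ⟪ξ p.1, ξ p.2⟫_ℂ) : Continuous ξ := by
  rw [continuous_iff_continuousAt]
  intro a
  rw [ContinuousAt, tendsto_iff_norm_sub_tendsto_zero]
  have h2 : Continuous fun x => ‖ξ x - ξ a‖ ^ 2 := by
    have : (fun x => ‖ξ x - ξ a‖ ^ 2) = fun x =>
        (⟪ξ x, ξ x⟫_ℂ).re - 2 * (⟪ξ x, ξ a⟫_ℂ).re + (⟪ξ a, ξ a⟫_ℂ).re := by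
      funext x
      rw [norm_sub_sq (𝕜 := ℂ), ← inner_self_eq_norm_sq (𝕜 := ℂ), ← inner_self_eq_norm_sq (𝕜 := ℂ)]
      rfl
    rw [this]
    have h3 := h.comp (continuous_id.prodMk continuous_id)
    have h4 := h.comp (continuous_id.prodMk (continuous_const (y := a)))
    simp only [Function.comp_def, id] at h3 h4
    fun_prop
  have h5 := (h2.tendsto a).sqrt
  simpa using h5

/-- Strong continuity of translations, from Mathlib's continuous action on `L²`. -/
theorem continuous_weyl_pos {N : ℕ} (f : Hil N) :
    Continuous fun q : Conf N => weyl (fun k : Mode N => if k.2 = 0 then q k.1 else 0) f := by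
  have : Fact ((2 : ENNReal) ≠ ⊤) := ⟨by norm_num⟩
  have h : Continuous fun q : Conf N => DomAddAct.mk (-q) +ᵥ f :=
    ((DomAddAct.continuous_mk.comp continuous_neg).vadd continuous_const)
  refine h.congr fun q => Lp.ext ?_
  refine (DomAddAct.vadd_Lp_ae_eq _ _).trans ((weyl_ae _ f).trans ?_).symm
  refine Filter.Eventually.of_forall fun t => ?_
  have hp : pos (fun k : Mode N => if k.2 = 0 then q k.1 else 0) = q := by funext j; simp [pos]
  have hm : mom (fun k : Mode N => if k.2 = 0 then q k.1 else 0) = 0 := by funext j; simp [mom]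
  simp [weylFun, hp, hm, sub_eq_neg_add]

/-- Strong continuity of multiplication by characters: the operators `W(0, p)` commute without a
phase, so the Gram kernel depends on `p' - p` only, and it is the Fourier transform of the integrable
function `|f|²`. -/
theorem continuous_weyl_mom {N : ℕ} (f : Hil N) :
    Continuous fun p : Conf N => weyl (fun k : Mode N => if k.2 = 0 then 0 else p k.1) f := by
  have hc : Continuous fun p : Conf N =>
      ⟪f, weyl (fun k : Mode N => if k.2 = 0 then 0 else p k.1) f⟫_ℂ := by
    have h0 : ∀ p : Conf N, ⟪f, weyl (fun k : Mode N => if k.2 = 0 then 0 else p k.1) f⟫_ℂ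
        = ∫ t, Complex.exp (Complex.I * ((p ⬝ᵥ t : ℝ) : ℂ)) * ⟪f t, f t⟫_ℂ := by
      intro p
      rw [L2.inner_def]
      refine integral_congr_ae ?_
      filter_upwards [weyl_ae (fun k : Mode N => if k.2 = 0 then 0 else p k.1) f] with t ht
      have hp : pos (fun k : Mode N => if k.2 = 0 then 0 else p k.1) = 0 := by
        funext j; simp [pos]
      have hm : mom (fun k : Mode N => if k.2 = 0 then 0 else p k.1) = p := by
        funext j; simp [mom]
      rw [ht, weylFun, hp, hm, RCLike.inner_apply, RCLike.inner_apply, ← mul_assoc]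
      simp
    simp_rw [h0]
    have hint : Integrable (fun t => ⟪f t, f t⟫_ℂ) (volume : Measure (Conf N)) :=
      L2.integrable_inner f f
    refine continuous_of_dominated (bound := fun t => ‖⟪f t, f t⟫_ℂ‖) ?_ ?_ hint.norm ?_
    · intro p
      refine AEStronglyMeasurable.mul ?_ hint.1
      have : Continuous fun t : Conf N => Complex.exp (Complex.I * ((p ⬝ᵥ t : ℝ) : ℂ)) := by
        unfold dotProduct
        fun_prop
      exact this.aestronglyMeasurable
    · intro p
      refine Filter.Eventually.of_forall fun t => ?_
      rw [norm_mul, mul_comm Complex.I, Complex.norm_exp_ofReal_mul_I, one_mul]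
    · refine Filter.Eventually.of_forall fun t => ?_
      unfold dotProduct
      fun_prop
  refine continuous_of_continuous_inner _ ?_
  have h1 : ∀ p : Conf N × Conf N,
      ⟪weyl (fun k : Mode N => if k.2 = 0 then 0 else p.1 k.1) f,
        weyl (fun k : Mode N => if k.2 = 0 then 0 else p.2 k.1) f⟫_ℂ
      = ⟪f, weyl (fun k : Mode N => if k.2 = 0 then 0 else (p.2 - p.1) k.1) f⟫_ℂ := by
    intro p
    rw [inner_weyl_weyl, dotProduct_Omega]
    have hp : ∀ r : Conf N, pos (fun k : Mode N => if k.2 = 0 then 0 else r k.1) = 0 := by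
      intro r; funext j; simp [pos]
    rw [hp, hp]
    simp only [zero_dotProduct, dotProduct_zero, sub_zero, Complex.ofReal_zero, mul_zero,
      Complex.exp_zero, one_mul]
    congr 3
    funext k
    by_cases hk : k.2 = 0 <;> simp [hk]
  simp_rw [h1]
  exact hc.comp (continuous_snd.sub continuous_fst)

/-- Weak continuity of `x ↦ W(x)`, from strong continuity in positions and momenta separately. -/
theorem continuous_inner_weyl {N : ℕ} (f g : Hil N) :
    Continuous fun x : Mode N → ℝ => ⟪f, weyl x g⟫_ℂ := by
  have hP : ∀ x : Mode N → ℝ, pos (fun k : Mode N => if k.2 = 0 then 0 else mom x k.1) = 0 := by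
    intro r; funext j; simp [pos]
  have hP' : ∀ x : Mode N → ℝ,
      mom (fun k : Mode N => if k.2 = 0 then 0 else (-mom x) k.1) = -mom x := by
    intro r; funext j; simp [mom]
  have hQ : ∀ x : Mode N → ℝ, pos (fun k : Mode N => if k.2 = 0 then pos x k.1 else 0) = pos x := by
    intro r; funext j; simp [pos]
  have hQ' : ∀ x : Mode N → ℝ, mom (fun k : Mode N => if k.2 = 0 then pos x k.1 else 0) = 0 := by
    intro r; funext j; simp [mom]
  have h : ∀ x : Mode N → ℝ, ⟪f, weyl x g⟫_ℂ
      = Complex.exp (-(Complex.I / 2) * ((pos x ⬝ᵥ mom x : ℝ) : ℂ))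
        * ⟪weyl (fun k : Mode N => if k.2 = 0 then 0 else (-mom x) k.1) f,
          weyl (fun k : Mode N => if k.2 = 0 then pos x k.1 else 0) g⟫_ℂ := by
    intro x
    rw [inner_weyl_weyl, dotProduct_Omega, hP', hQ, hQ', ← mul_assoc, ← Complex.exp_add]
    have he : (fun k : Mode N => if k.2 = 0 then pos x k.1 else 0)
        - (fun k : Mode N => if k.2 = 0 then 0 else (-mom x) k.1) = x := by
      funext k
      obtain ⟨j, i⟩ := k
      fin_cases i <;> simp [pos, mom]
    rw [he, dotProduct_zero, neg_dotProduct, zero_sub, neg_neg, dotProduct_comm (mom x)]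
    simp
  simp_rw [h]
  have c1 : Continuous (pos : (Mode N → ℝ) → Conf N) := by unfold pos; fun_prop
  have c2 : Continuous (mom : (Mode N → ℝ) → Conf N) := by unfold mom; fun_prop
  refine Continuous.mul ?_ ?_
  · unfold dotProduct; fun_prop
  · exact ((continuous_weyl_mom f).comp c2.neg).inner ((continuous_weyl_pos g).comp c1)

/-! ### Gaussian vectors -/

/-- The unnormalised Gaussian wave function `t ↦ exp(-a |t|² / 2)`. -/
noncomputable def gaussFun (N : ℕ) (a : ℝ) (t : Conf N) : ℂ :=
  Complex.exp (-(a / 2 : ℂ) * ∑ i, (t i : ℂ) ^ 2)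

theorem memLp_gaussFun (N : ℕ) {a : ℝ} (ha : 0 < a) :
    MemLp (gaussFun N a) 2 (volume : Measure (Conf N)) := by
  have hc : Continuous (gaussFun N a) := by unfold gaussFun; fun_prop
  rw [memLp_two_iff_integrable_sq_norm hc.aestronglyMeasurable]
  have h := (GaussianFourier.integrable_cexp_neg_mul_sum_add (ι := Fin N) (b := (a : ℂ))
    (by simpa using ha) 0).norm
  refine h.congr (Filter.Eventually.of_forall fun t => ?_)
  simp only [gaussFun]
  rw [← norm_pow, ← Complex.exp_nat_mul]
  congr 2
  simp
  ring

/-- The vector of `L²(ℝ^N)` given by `t ↦ exp(-a |t|² / 2)`. -/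
noncomputable def gaussVec (N : ℕ) {a : ℝ} (ha : 0 < a) : Hil N := (memLp_gaussFun N ha).toLp _

theorem inner_gaussVec_weyl (N : ℕ) {a : ℝ} (ha : 0 < a) (x : Mode N → ℝ) :
    ⟪gaussVec N ha, weyl x (gaussVec N ha)⟫_ℂ
      = (Real.pi / a : ℂ) ^ (N / 2 : ℂ) *
        Complex.exp (-(a / 4 : ℂ) * ∑ i, (pos x i : ℂ) ^ 2
          - (1 / (4 * a) : ℂ) * ∑ i, (mom x i : ℂ) ^ 2) := by
  have ha' : (a : ℂ) ≠ 0 := by exact_mod_cast ha.ne'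
  have hg : (gaussVec N ha : Conf N → ℂ) =ᵐ[volume] gaussFun N a := MemLp.coeFn_toLp _
  have h := GaussianFourier.integral_cexp_neg_mul_sum_add (ι := Fin N) (b := (a : ℂ))
    (by simpa using ha) (fun i => Complex.I * mom x i + a * pos x i)
  rw [Fintype.card_fin] at h
  rw [L2.inner_def]
  calc _ = ∫ t : Conf N, Complex.exp (-(a : ℂ) * ∑ i, (t i : ℂ) ^ 2
          + ∑ i, (Complex.I * mom x i + a * pos x i) * t i)
          * Complex.exp (-(Complex.I / 2) * ∑ i, (pos x i : ℂ) * mom x i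
            - (a / 2 : ℂ) * ∑ i, (pos x i : ℂ) ^ 2) := by
        refine integral_congr_ae ?_
        filter_upwards [hg, (weyl_ae x (gaussVec N ha)).trans (weylFun_congr x hg)] with t h1 h2
        rw [h1, h2, RCLike.inner_apply, weylFun]
        simp only [gaussFun]
        rw [← Complex.exp_conj, ← Complex.exp_add, ← Complex.exp_add, ← Complex.exp_add]
        congr 1
        simp only [dotProduct, map_mul, map_neg, map_sum, map_pow, map_div₀, Complex.conj_ofReal,
          map_ofNat, Complex.ofReal_sub, Complex.ofReal_sum, Complex.ofReal_mul, Pi.sub_apply,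
          Complex.ofReal_div, Complex.ofReal_ofNat, Finset.mul_sum, Finset.sum_div,
          ← Finset.sum_sub_distrib, ← Finset.sum_add_distrib]
        refine Finset.sum_congr rfl fun i _ => ?_
        ring
    _ = _ := by
        rw [integral_mul_const, h, mul_assoc, ← Complex.exp_add]
        congr 2
        simp only [Finset.mul_sum, Finset.sum_div, ← Finset.sum_sub_distrib,
          ← Finset.sum_add_distrib]
        refine Finset.sum_congr rfl fun i _ => ?_
        field_simp
        ring_nf
        simp only [Complex.I_sq]
        ring

/-! ### Weyl operators of bipartite systems -/

section Tensor

variable {E F : Type*} [NormedAddCommGroup E] [InnerProductSpace ℂ E]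
  [NormedAddCommGroup F] [InnerProductSpace ℂ F]

theorem hilTensor_op_ext {S T : Op (HilTensor E F)}
    (h : ∀ (f : E) (g : F), S ((f ⊗ₜ[ℂ] g : E ⊗[ℂ] F) : HilTensor E F)
      = T ((f ⊗ₜ[ℂ] g : E ⊗[ℂ] F) : HilTensor E F)) : S = T := by
  refine ContinuousLinearMap.ext fun z => ?_
  refine UniformSpace.Completion.induction_on z (isClosed_eq S.continuous T.continuous) fun a => ?_
  induction a using TensorProduct.induction_on with
  | zero => rw [UniformSpace.Completion.coe_zero, map_zero, map_zero]
  | tmul f g => exact h f g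
  | add a b ha hb => rw [UniformSpace.Completion.coe_add, map_add, map_add, ha, hb]

theorem opTensor_comp (X X' : Op E) (Y Y' : Op F) :
    opTensor X Y ∘L opTensor X' Y' = opTensor (X ∘L X') (Y ∘L Y') :=
  hilTensor_op_ext fun f g => by simp [opTensor_tmul]

theorem opTensor_smul_left (c : ℂ) (X : Op E) (Y : Op F) :
    opTensor (c • X) Y = c • opTensor X Y :=
  hilTensor_op_ext fun f g => by
    rw [opTensor_tmul, _root_.smul_apply, _root_.smul_apply,
      opTensor_tmul, ← TensorProduct.smul_tmul', UniformSpace.Completion.coe_smul]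

theorem opTensor_smul_right (c : ℂ) (X : Op E) (Y : Op F) :
    opTensor X (c • Y) = c • opTensor X Y :=
  hilTensor_op_ext fun f g => by
    rw [opTensor_tmul, _root_.smul_apply, _root_.smul_apply,
      opTensor_tmul, TensorProduct.tmul_smul, UniformSpace.Completion.coe_smul]

theorem opTensor_one : opTensor (1 : Op E) (1 : Op F) = 1 :=
  hilTensor_op_ext fun f g => by simp [opTensor_tmul]

theorem norm_opTensor_le (X : Op E) (Y : Op F) : ‖opTensor X Y‖ ≤ ‖X‖ * ‖Y‖ := by
  refine ContinuousLinearMap.opNorm_le_bound _ (by positivity) fun z => ?_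
  refine UniformSpace.Completion.induction_on z (isClosed_le (by fun_prop) (by fun_prop))
    fun a => ?_
  rw [opTensor, ContinuousLinearMap.completion_apply_coe, UniformSpace.Completion.norm_coe,
    UniformSpace.Completion.norm_coe, mul_assoc]
  refine (norm_rTensor_le X _).trans ?_
  gcongr
  exact norm_lTensor_le Y a

theorem inner_hilTensor_tmul (f f' : E) (g g' : F) :
    ⟪((f ⊗ₜ[ℂ] g : E ⊗[ℂ] F) : HilTensor E F), ((f' ⊗ₜ[ℂ] g' : E ⊗[ℂ] F) : HilTensor E F)⟫_ℂ
      = ⟪f, f'⟫_ℂ * ⟪g, g'⟫_ℂ := by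
  rw [UniformSpace.Completion.inner_coe, TensorProduct.inner_tmul]

end Tensor

/-- The Weyl operator `W(x_A) ⊗ W(x_B)` of a bipartite system. -/
noncomputable def bipWeyl {N M : ℕ} (x : Mode N ⊕ Mode M → ℝ) : Op (HilTensor (Hil N) (Hil M)) :=
  opTensor (weyl (x ∘ Sum.inl)) (weyl (x ∘ Sum.inr))

theorem weyl_comp {N : ℕ} (x y : Mode N → ℝ) : weyl x ∘L weyl y
    = Complex.exp (-(Complex.I / 2) * ((x ⬝ᵥ Omega N *ᵥ y : ℝ) : ℂ)) • weyl (x + y) :=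
  ContinuousLinearMap.ext (weyl_weyl x y)

theorem norm_weyl_le {N : ℕ} (x : Mode N → ℝ) : ‖weyl x‖ ≤ 1 :=
  ContinuousLinearMap.opNorm_le_bound _ zero_le_one fun f => by rw [norm_weyl, one_mul]

theorem dotProduct_bipOmega {N M : ℕ} (x y : Mode N ⊕ Mode M → ℝ) :
    x ⬝ᵥ bipOmega N M *ᵥ y = (x ∘ Sum.inl) ⬝ᵥ Omega N *ᵥ (y ∘ Sum.inl)
      + (x ∘ Sum.inr) ⬝ᵥ Omega M *ᵥ (y ∘ Sum.inr) := by
  rw [bipOmega, fromBlocks_mulVec]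
  simp [dotProduct, Fintype.sum_sum_type]

theorem bipWeyl_bipWeyl {N M : ℕ} (x y : Mode N ⊕ Mode M → ℝ) (ψ : HilTensor (Hil N) (Hil M)) :
    bipWeyl x (bipWeyl y ψ)
      = Complex.exp (-(Complex.I / 2) * ((x ⬝ᵥ bipOmega N M *ᵥ y : ℝ) : ℂ))
        • bipWeyl (x + y) ψ := by
  rw [← ContinuousLinearMap.comp_apply, bipWeyl, bipWeyl, opTensor_comp, weyl_comp, weyl_comp,
    opTensor_smul_left, opTensor_smul_right, smul_smul, ← Complex.exp_add, dotProduct_bipOmega,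
    Complex.ofReal_add, mul_add]
  rfl

theorem bipWeyl_zero {N M : ℕ} (ψ : HilTensor (Hil N) (Hil M)) : bipWeyl 0 ψ = ψ := by
  have h : ∀ K, (weyl (0 : Mode K → ℝ)) = 1 := fun K => ContinuousLinearMap.ext weyl_zero
  have h1 : (0 : Mode N ⊕ Mode M → ℝ) ∘ Sum.inl = 0 := rfl
  have h2 : (0 : Mode N ⊕ Mode M → ℝ) ∘ Sum.inr = 0 := rfl
  rw [bipWeyl, h1, h2, h, h, opTensor_one, one_apply_eq_self]

theorem dotProduct_bipOmega_self {N M : ℕ} (x : Mode N ⊕ Mode M → ℝ) :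
    x ⬝ᵥ bipOmega N M *ᵥ x = 0 := by
  rw [dotProduct_bipOmega, dotProduct_Omega, dotProduct_Omega, dotProduct_comm (pos _),
    dotProduct_comm (pos _), sub_self, sub_self, add_zero]

theorem norm_bipWeyl {N M : ℕ} (x : Mode N ⊕ Mode M → ℝ) (ψ : HilTensor (Hil N) (Hil M)) :
    ‖bipWeyl x ψ‖ = ‖ψ‖ := by
  have h : ∀ (y : Mode N ⊕ Mode M → ℝ) (φ : HilTensor (Hil N) (Hil M)), ‖bipWeyl y φ‖ ≤ ‖φ‖ := by
    intro y φ
    refine ((bipWeyl y).le_opNorm φ).trans (mul_le_of_le_one_left (norm_nonneg _) ?_)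
    refine (norm_opTensor_le _ _).trans ?_
    exact mul_le_one₀ (norm_weyl_le _) (norm_nonneg _) (norm_weyl_le _)
  refine le_antisymm (h x ψ) ?_
  have h2 := h (-x) (bipWeyl x ψ)
  rwa [bipWeyl_bipWeyl, neg_add_cancel, bipWeyl_zero, neg_dotProduct, dotProduct_bipOmega_self,
    neg_zero, Complex.ofReal_zero, mul_zero, Complex.exp_zero, one_smul] at h2

theorem inner_bipWeyl_bipWeyl {N M : ℕ} (x y : Mode N ⊕ Mode M → ℝ)
    (φ ψ : HilTensor (Hil N) (Hil M)) :
    ⟪bipWeyl x φ, bipWeyl y ψ⟫_ℂ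
      = Complex.exp ((Complex.I / 2) * ((x ⬝ᵥ bipOmega N M *ᵥ y : ℝ) : ℂ))
        * ⟪φ, bipWeyl (y - x) ψ⟫_ℂ := by
  rw [← (LinearMap.norm_map_iff_inner_map_map (bipWeyl (-x))).mp (norm_bipWeyl (-x)),
    bipWeyl_bipWeyl, bipWeyl_bipWeyl, neg_add_cancel, bipWeyl_zero, neg_add_eq_sub,
    neg_dotProduct, dotProduct_bipOmega_self, neg_dotProduct, inner_smul_left, inner_smul_right]
  simp [neg_mul, mul_neg]

/-! ### The uncertainty relation -/

/-- Positivity of a state on operators `S* S`, with `S` a linear combination of Weyl operators. -/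
theorem bipChar_posDef {N M : ℕ} (ρ : QState (HilTensor (Hil N) (Hil M))) {ι : Type*} [Fintype ι]
    (x : ι → Mode N ⊕ Mode M → ℝ) (c : ι → ℂ) :
    0 ≤ ∑ j, ∑ k, star (c j) * c k
      * (Complex.exp ((Complex.I / 2) * ((x j ⬝ᵥ bipOmega N M *ᵥ x k : ℝ) : ℂ))
        * bipChar ρ (x k - x j)) := by
  obtain ⟨ψ, -, hψ⟩ := ρ.normal
  have h1 : HasSum (fun n => ((‖∑ j, c j • bipWeyl (x j) (ψ n)‖ ^ 2 : ℝ) : ℂ))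
      (∑ j, ∑ k, star (c j) * c k
      * (Complex.exp ((Complex.I / 2) * ((x j ⬝ᵥ bipOmega N M *ᵥ x k : ℝ) : ℂ))
        * bipChar ρ (x k - x j))) := by
    have h2 := hasSum_sum (s := Finset.univ) fun j _ => hasSum_sum (s := Finset.univ) fun k _ =>
      ((hψ (bipWeyl (x k - x j))).mul_left (Complex.exp ((Complex.I / 2) *
        ((x j ⬝ᵥ bipOmega N M *ᵥ x k : ℝ) : ℂ)))).mul_left (star (c j) * c k)
    have hf : (fun n => ((‖∑ j, c j • bipWeyl (x j) (ψ n)‖ ^ 2 : ℝ) : ℂ)) = fun n =>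
        ∑ j, ∑ k, star (c j) * c k
          * (Complex.exp ((Complex.I / 2) * ((x j ⬝ᵥ bipOmega N M *ᵥ x k : ℝ) : ℂ))
            * ⟪ψ n, bipWeyl (x k - x j) (ψ n)⟫_ℂ) := by
      funext n
      have h3 := inner_self_eq_norm_sq_to_K (𝕜 := ℂ) (∑ j, c j • bipWeyl (x j) (ψ n))
      rw [Complex.ofReal_pow]
      refine h3.symm.trans ?_
      rw [sum_inner]
      refine Finset.sum_congr rfl fun j _ => ?_
      rw [inner_sum]
      refine Finset.sum_congr rfl fun k _ => ?_
      rw [inner_smul_left, inner_smul_right, inner_bipWeyl_bipWeyl, ← mul_assoc]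
      rfl
    rw [hf]
    exact h2
  refine h1.nonneg fun n => ?_
  exact Complex.zero_le_real.mpr (sq_nonneg _)

/-- If the entrywise `exp(s H) - 1` is positive semidefinite for every `s > 0`, then so is its
derivative `H` at `s = 0`. -/
theorem posSemidef_of_exp_kernel {n : Type*} [Fintype n] {H : Matrix n n ℂ} (hH : H.IsHermitian)
    (h : ∀ s : ℝ, 0 < s → ∀ w : n → ℂ,
      0 ≤ ∑ j, ∑ k, star (w j) * w k * (Complex.exp (s * H j k) - 1)) : H.PosSemidef := by
  refine PosSemidef.of_dotProduct_mulVec_nonneg hH fun w => ?_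
  have hlim : Filter.Tendsto (fun s : ℝ => (((s⁻¹ : ℝ) : ℂ)) *
      ∑ j, ∑ k, star (w j) * w k * (Complex.exp (s * H j k) - 1)) (nhdsWithin 0 (Set.Ioi 0))
      (nhds (star w ⬝ᵥ H *ᵥ w)) := by
    have he : star w ⬝ᵥ H *ᵥ w = ∑ j, ∑ k, star (w j) * w k * H j k := by
      simp only [dotProduct, mulVec, Finset.mul_sum, Pi.star_apply]
      exact Finset.sum_congr rfl fun j _ => Finset.sum_congr rfl fun k _ => by ring
    rw [he]
    simp_rw [Finset.mul_sum]
    refine tendsto_finsetSum _ fun j _ => tendsto_finsetSum _ fun k _ => ?_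
    have hd : HasDerivAt (fun s : ℝ => Complex.exp (s * H j k)) (H j k) 0 := by
      have h1 : HasDerivAt (fun s : ℝ => (s : ℂ) * H j k) (1 * H j k) 0 :=
        (Complex.ofRealCLM.hasDerivAt (x := (0 : ℝ))).mul_const _
      simpa using h1.cexp
    have h2 := (hasDerivAt_iff_tendsto_slope.mp hd).mono_left
      (nhdsWithin_mono (0 : ℝ) (fun s (hs : 0 < s) => (hs.ne' : s ≠ 0)))
    have h3 := h2.const_mul (star (w j) * w k)
    refine h3.congr fun s => ?_
    simp [slope_def_module]
    ring
  refine ge_of_tendsto hlim ?_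
  filter_upwards [self_mem_nhdsWithin] with s hs
  refine mul_nonneg ?_ (h s hs w)
  exact_mod_cast (inv_pos.mpr hs).le

theorem isHermitian_complexComb {n : Type} {S T : Matrix n n ℝ} (hS : Sᵀ = S)
    (hT : Tᵀ = -T) : (complexComb S T).IsHermitian := by
  refine Matrix.ext fun i j => ?_
  have h1 : S j i = S i j := congrFun (congrFun hS i) j
  have h2 : T j i = -T i j := congrFun (congrFun hT i) j
  simp [complexComb, Matrix.conjTranspose_apply, h1, h2]

theorem Omega_transpose (N : ℕ) : (Omega N)ᵀ = -Omega N := by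
  refine Matrix.ext fun i j => ?_
  obtain ⟨i, a⟩ := i
  obtain ⟨j, b⟩ := j
  fin_cases a <;> fin_cases b <;> simp [Omega, Matrix.one_apply, eq_comm]

theorem bipOmega_transpose (N M : ℕ) : (bipOmega N M)ᵀ = -bipOmega N M := by
  rw [bipOmega, fromBlocks_transpose, Omega_transpose, Omega_transpose, fromBlocks_neg]
  simp

theorem Omega_mul_self (N : ℕ) : Omega N * Omega N = -1 := by
  rw [Omega, ← Matrix.mul_kronecker_mul, one_mul]
  have h : (!![0, 1; -1, 0] : Matrix (Fin 2) (Fin 2) ℝ) * !![0, 1; -1, 0] = -1 := by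
    ext i j; fin_cases i <;> fin_cases j <;> simp
  rw [h, ← neg_one_smul ℝ (1 : Matrix (Fin 2) (Fin 2) ℝ), Matrix.kronecker_smul,
    Matrix.one_kronecker_one, neg_one_smul]

theorem dotProduct_mulVec_symm {n : Type*} [Fintype n] {G : Matrix n n ℝ} (hG : Gᵀ = G)
    (x y : n → ℝ) : y ⬝ᵥ G *ᵥ x = x ⬝ᵥ G *ᵥ y := by
  rw [dotProduct_mulVec, dotProduct_comm, ← mulVec_transpose, hG]

/-- A Gaussian factor on differences splits into a rank one kernel and the exponential of a
bilinear form. -/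
theorem gaussFactor_sub {n : Type} [Fintype n] {G : Matrix n n ℝ} (hG : Gᵀ = G) (e x y : n → ℝ) :
    gaussFactor G e (y - x)
      = Complex.exp (-(1 / 4 : ℂ) * ((x ⬝ᵥ G *ᵥ x : ℝ) : ℂ) + Complex.I * ((e ⬝ᵥ x : ℝ) : ℂ))
        * Complex.exp (-(1 / 4 : ℂ) * ((y ⬝ᵥ G *ᵥ y : ℝ) : ℂ) - Complex.I * ((e ⬝ᵥ y : ℝ) : ℂ))
        * Complex.exp ((1 / 2 : ℂ) * ((x ⬝ᵥ G *ᵥ y : ℝ) : ℂ)) := by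
  rw [gaussFactor, ← Complex.exp_add, ← Complex.exp_add, mulVec_sub, dotProduct_sub,
    sub_dotProduct, sub_dotProduct, dotProduct_sub, dotProduct_mulVec_symm hG x y]
  congr 1
  push_cast
  ring

/-- The uncertainty relation: the covariance matrix of a Gaussian state satisfies
`Ωᵀ V Ω + i Ω ≥ 0`. -/
theorem uncertainty {N M : ℕ} {ρ : QState (HilTensor (Hil N) (Hil M))}
    {V : Matrix (Mode N ⊕ Mode M) (Mode N ⊕ Mode M) ℝ} {d : Mode N ⊕ Mode M → ℝ}
    (h : IsBipGaussian ρ V d) :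
    (complexComb ((bipOmega N M)ᵀ * V * bipOmega N M) (bipOmega N M)).PosSemidef := by
  obtain ⟨hV, hχ⟩ := h
  set G := (bipOmega N M)ᵀ * V * bipOmega N M with hGdef
  set e := bipOmega N M *ᵥ d
  have hG : Gᵀ = G := by
    rw [hGdef, transpose_mul, transpose_mul, transpose_transpose, hV.eq, Matrix.mul_assoc]
  refine posSemidef_of_exp_kernel (isHermitian_complexComb hG (bipOmega_transpose N M))
    fun s hs w => ?_
  -- the points `√(2s) e_k`, together with the origin to balance the total weight
  let x : Option (Mode N ⊕ Mode M) → Mode N ⊕ Mode M → ℝ :=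
    fun o => o.elim 0 (fun k => √(2 * s) • Pi.single k 1)
  let b : Option (Mode N ⊕ Mode M) → ℂ := fun o => o.elim (-∑ k, w k) w
  let f : Option (Mode N ⊕ Mode M) → ℂ := fun o =>
    (1 / 4 : ℂ) * ((x o ⬝ᵥ G *ᵥ x o : ℝ) : ℂ) + Complex.I * ((e ⬝ᵥ x o : ℝ) : ℂ)
  have key := bipChar_posDef ρ x (fun o => b o * Complex.exp (f o))
  have hterm : ∀ j k, star (b j * Complex.exp (f j)) * (b k * Complex.exp (f k))
      * (Complex.exp ((Complex.I / 2) * ((x j ⬝ᵥ bipOmega N M *ᵥ x k : ℝ) : ℂ))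
        * bipChar ρ (x k - x j))
      = star (b j) * b k * Complex.exp ((1 / 2 : ℂ) * ((x j ⬝ᵥ G *ᵥ x k : ℝ) : ℂ)
        + (Complex.I / 2) * ((x j ⬝ᵥ bipOmega N M *ᵥ x k : ℝ) : ℂ)) := by
    intro j k
    have hs : star (Complex.exp (f j)) = Complex.exp ((1 / 4 : ℂ) * ((x j ⬝ᵥ G *ᵥ x j : ℝ) : ℂ)
        - Complex.I * ((e ⬝ᵥ x j : ℝ) : ℂ)) := by
      rw [Complex.star_def, ← Complex.exp_conj]
      congr 1
      simp only [f, map_add, map_mul, Complex.conj_ofReal, Complex.conj_I, map_div₀, map_one,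
        map_ofNat]
      ring
    rw [hχ, gaussFactor_sub hG, star_mul', hs]
    calc _ = star (b j) * b k * (Complex.exp ((1 / 4 : ℂ) * ((x j ⬝ᵥ G *ᵥ x j : ℝ) : ℂ)
        - Complex.I * ((e ⬝ᵥ x j : ℝ) : ℂ)) * Complex.exp (f k) *
          Complex.exp ((Complex.I / 2) * ((x j ⬝ᵥ bipOmega N M *ᵥ x k : ℝ) : ℂ)) *
          (Complex.exp (-(1 / 4 : ℂ) * ((x j ⬝ᵥ G *ᵥ x j : ℝ) : ℂ)
            + Complex.I * ((e ⬝ᵥ x j : ℝ) : ℂ))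
          * Complex.exp (-(1 / 4 : ℂ) * ((x k ⬝ᵥ G *ᵥ x k : ℝ) : ℂ)
            - Complex.I * ((e ⬝ᵥ x k : ℝ) : ℂ))
          * Complex.exp ((1 / 2 : ℂ) * ((x j ⬝ᵥ G *ᵥ x k : ℝ) : ℂ)))) := by ring
      _ = _ := by
        simp only [← Complex.exp_add, f]
        congr 2
        ring
  simp_rw [hterm, Fintype.sum_option] at key
  have hx0 : x none = 0 := rfl
  have hb0 : b none = -∑ k, w k := rfl
  have hbk : ∀ k, b (some k) = w k := fun k => rfl
  have hxx : ∀ (S : Matrix (Mode N ⊕ Mode M) (Mode N ⊕ Mode M) ℝ) j k,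
      x (some j) ⬝ᵥ S *ᵥ x (some k) = 2 * s * S j k := by
    intro S j k
    have h2 : √(2 * s) * √(2 * s) = 2 * s := Real.mul_self_sqrt (by linarith)
    simp only [x, Option.elim, mulVec_smul, dotProduct_smul, smul_dotProduct, smul_eq_mul,
      mulVec_single_one, single_one_dotProduct, Matrix.col_apply]
    rw [← mul_assoc, h2]
  have hexp : ∀ j k, Complex.exp ((1 / 2 : ℂ) * ((2 * s * G j k : ℝ) : ℂ)
        + (Complex.I / 2) * ((2 * s * bipOmega N M j k : ℝ) : ℂ))
      = Complex.exp (s * complexComb G (bipOmega N M) j k) := by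
    intro j k
    congr 1
    simp only [complexComb, Matrix.add_apply, Matrix.map_apply, Matrix.smul_apply, smul_eq_mul]
    push_cast
    ring
  simp only [hx0, hb0, hbk, hxx, hexp, mulVec_zero, dotProduct_zero, zero_dotProduct,
    Complex.ofReal_zero, mul_zero, add_zero, Complex.exp_zero, mul_one] at key
  refine key.trans_eq ?_
  simp only [mul_sub, Finset.sum_sub_distrib, Finset.sum_add_distrib, mul_one, star_neg, star_sum,
    ← Finset.mul_sum, ← Finset.sum_mul]
  ring

/-! ### Complex matrix inequalities as real ones -/

theorem complexComb_isHermitian {n : Type} {S T : Matrix n n ℝ}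
    (h : (complexComb S T).IsHermitian) : Sᵀ = S ∧ Tᵀ = -T := by
  have h1 : ∀ i j, S j i = S i j ∧ T j i = -T i j := by
    intro i j
    have h2 := congrFun (congrFun h i) j
    have hr := congrArg Complex.re h2
    have hi := congrArg Complex.im h2
    simp [complexComb, Matrix.conjTranspose_apply] at hr hi
    exact ⟨hr, by linarith⟩
  exact ⟨Matrix.ext fun i j => (h1 i j).1, Matrix.ext fun i j => (h1 i j).2⟩

/-- The quadratic form of `S + iT` at `u + iv`, in real terms. -/
theorem star_dotProduct_complexComb {n : Type} [Fintype n] {S T : Matrix n n ℝ} (hS : Sᵀ = S)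
    (hT : Tᵀ = -T) (u v : n → ℝ) :
    star (fun i => (u i : ℂ) + Complex.I * v i) ⬝ᵥ complexComb S T *ᵥ
        (fun i => (u i : ℂ) + Complex.I * v i)
      = ((u ⬝ᵥ S *ᵥ u + v ⬝ᵥ S *ᵥ v - 2 * (u ⬝ᵥ T *ᵥ v) : ℝ) : ℂ) := by
  have e1 : ∀ (R : Matrix n n ℝ) (a b : n → ℝ),
      ((a ⬝ᵥ R *ᵥ b : ℝ) : ℂ) = ∑ i, ∑ j, (a i : ℂ) * R i j * b j := by
    intro R a b
    simp only [dotProduct, mulVec, Finset.mul_sum, Complex.ofReal_sum, Complex.ofReal_mul,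
      mul_assoc]
  have hT' : ∀ a b : n → ℝ, b ⬝ᵥ T *ᵥ a = -(a ⬝ᵥ T *ᵥ b) := by
    intro a b
    rw [dotProduct_mulVec, dotProduct_comm, ← mulVec_transpose, hT, neg_mulVec, dotProduct_neg]
  have hTs : ∀ a : n → ℝ, a ⬝ᵥ T *ᵥ a = 0 := fun a => by linarith [hT' a a]
  have e2 : star (fun i => (u i : ℂ) + Complex.I * v i) ⬝ᵥ complexComb S T *ᵥ
        (fun i => (u i : ℂ) + Complex.I * v i)
      = ((u ⬝ᵥ S *ᵥ u : ℝ) : ℂ) + ((v ⬝ᵥ S *ᵥ v : ℝ) : ℂ)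
        + Complex.I * (((u ⬝ᵥ S *ᵥ v : ℝ) : ℂ) - ((v ⬝ᵥ S *ᵥ u : ℝ) : ℂ))
        + Complex.I * (((u ⬝ᵥ T *ᵥ u : ℝ) : ℂ) + ((v ⬝ᵥ T *ᵥ v : ℝ) : ℂ))
        + (((v ⬝ᵥ T *ᵥ u : ℝ) : ℂ) - ((u ⬝ᵥ T *ᵥ v : ℝ) : ℂ)) := by
    simp only [e1]
    simp only [dotProduct, mulVec, complexComb, Finset.mul_sum, ← Finset.sum_add_distrib,
      ← Finset.sum_sub_distrib]
    refine Finset.sum_congr rfl fun i _ => Finset.sum_congr rfl fun j _ => ?_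
    simp only [Pi.star_apply, Matrix.add_apply, Matrix.map_apply, Matrix.smul_apply, smul_eq_mul,
      Complex.star_def, map_add, map_mul, Complex.conj_ofReal, Complex.conj_I]
    linear_combination (-(v i : ℂ) * S i j * v j - Complex.I * v i * T i j * v j
      - (v i : ℂ) * T i j * u j + (u i : ℂ) * T i j * v j) * Complex.I_sq
  rw [e2, hTs, hTs, hT' u v, dotProduct_mulVec_symm hS u v]
  push_cast
  ring

theorem posSemidef_complexComb_iff {n : Type} [Fintype n] {S T : Matrix n n ℝ} :
    (complexComb S T).PosSemidef ↔ Sᵀ = S ∧ Tᵀ = -T ∧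
      ∀ u v : n → ℝ, 0 ≤ u ⬝ᵥ S *ᵥ u + v ⬝ᵥ S *ᵥ v - 2 * (u ⬝ᵥ T *ᵥ v) := by
  constructor
  · intro h
    obtain ⟨hS, hT⟩ := complexComb_isHermitian h.1
    refine ⟨hS, hT, fun u v => ?_⟩
    have h1 := h.dotProduct_mulVec_nonneg (fun i => (u i : ℂ) + Complex.I * v i)
    rw [star_dotProduct_complexComb hS hT] at h1
    exact Complex.zero_le_real.mp h1
  · rintro ⟨hS, hT, h⟩
    refine PosSemidef.of_dotProduct_mulVec_nonneg (isHermitian_complexComb hS hT) fun w => ?_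
    have hw : w = fun i => ((w i).re : ℂ) + Complex.I * ((w i).im : ℂ) := by
      funext i
      rw [mul_comm, Complex.re_add_im]
    rw [hw, star_dotProduct_complexComb hS hT]
    exact Complex.zero_le_real.mpr (h _ _)

theorem transpose_congr_Omega {N : ℕ} {m : Type*} (A : Matrix (Mode N) m ℝ) :
    (Aᵀ * Omega N * A)ᵀ = -(Aᵀ * Omega N * A) := by
  rw [transpose_mul, transpose_mul, transpose_transpose, Omega_transpose, Matrix.neg_mul,
    Matrix.mul_neg, Matrix.mul_assoc]

theorem dotProduct_congr {m n : Type*} [Fintype m] [Fintype n] (S : Matrix n n ℝ)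
    (A : Matrix n m ℝ) (u v : m → ℝ) :
    u ⬝ᵥ (Aᵀ * S * A) *ᵥ v = (A *ᵥ u) ⬝ᵥ S *ᵥ (A *ᵥ v) := by
  rw [← mulVec_mulVec, ← mulVec_mulVec, dotProduct_mulVec, vecMul_transpose]

/-- The matrix inequality `B - i Aᵀ Ω A ≥ 0`, in real terms. -/
theorem posSemidef_noise_iff {N : ℕ} {m : Type} [Fintype m] {A : Matrix (Mode N) m ℝ}
    {B : Matrix m m ℝ} :
    (complexComb B (-(Aᵀ * Omega N * A))).PosSemidef ↔ Bᵀ = B ∧ ∀ u v : m → ℝ,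
      0 ≤ u ⬝ᵥ B *ᵥ u + v ⬝ᵥ B *ᵥ v + 2 * ((A *ᵥ u) ⬝ᵥ Omega N *ᵥ (A *ᵥ v)) := by
  have h0 : ∀ u v : m → ℝ, u ⬝ᵥ B *ᵥ u + v ⬝ᵥ B *ᵥ v - 2 * (u ⬝ᵥ (-(Aᵀ * Omega N * A)) *ᵥ v)
      = u ⬝ᵥ B *ᵥ u + v ⬝ᵥ B *ᵥ v + 2 * ((A *ᵥ u) ⬝ᵥ Omega N *ᵥ (A *ᵥ v)) := by
    intro u v
    rw [neg_mulVec, dotProduct_neg, dotProduct_congr]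
    ring
  rw [posSemidef_complexComb_iff]
  simp only [h0]
  refine ⟨fun h => ⟨h.1, h.2.2⟩, fun h => ⟨h.1, ?_, h.2⟩⟩
  rw [transpose_neg, transpose_congr_Omega]

/-! ### Channels acting on one half of a Gaussian state -/

theorem gaussFactor_norm {n : Type} [Fintype n] (B : Matrix n n ℝ) (c x : n → ℝ) :
    ‖gaussFactor B c x‖ = Real.exp (-(1 / 4) * (x ⬝ᵥ B *ᵥ x)) := by
  rw [gaussFactor, Complex.norm_exp]
  simp

theorem gaussFactor_ne_zero {n : Type} [Fintype n] (B : Matrix n n ℝ) (c x : n → ℝ) :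
    gaussFactor B c x ≠ 0 := Complex.exp_ne_zero _

theorem aliceChar_eq {N N' M : ℕ} {Λ : QChannel N N'} {A : Matrix (Mode N) (Mode N') ℝ}
    {B : Matrix (Mode N') (Mode N') ℝ} {c : Mode N' → ℝ}
    (hΛ : ∀ x : Mode N' → ℝ, Λ.toCP (weyl x) = gaussFactor B c x • weyl (A *ᵥ x))
    (ρ : QState (HilTensor (Hil N) (Hil M))) (x : Mode N' ⊕ Mode M → ℝ) :
    Λ.aliceChar ρ x = gaussFactor B c (x ∘ Sum.inl)
      * bipChar ρ (Sum.elim (A *ᵥ (x ∘ Sum.inl)) (x ∘ Sum.inr)) := by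
  rw [QChannel.aliceChar, QChannel.aliceExpect, hΛ, opTensor_smul_left, map_smul, smul_eq_mul,
    bipChar, Sum.elim_comp_inl, Sum.elim_comp_inr]

/-- The symplectic form transports `V` to the matrix `Ωᵀ V Ω` of the characteristic function and
back. -/
theorem bipOmega_conj {N M : ℕ} (G : Matrix (Mode N ⊕ Mode M) (Mode N ⊕ Mode M) ℝ) :
    (bipOmega N M)ᵀ * (bipOmega N M * G * (bipOmega N M)ᵀ) * bipOmega N M = G := by
  have h : (bipOmega N M)ᵀ * bipOmega N M = 1 := by
    rw [bipOmega_transpose, bipOmega, Matrix.neg_mul, fromBlocks_multiply]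
    simp [Omega_mul_self, fromBlocks_neg]
  calc _ = ((bipOmega N M)ᵀ * bipOmega N M) * G * ((bipOmega N M)ᵀ * bipOmega N M) := by
        simp only [Matrix.mul_assoc]
    _ = G := by rw [h, Matrix.one_mul, Matrix.mul_one]

theorem bipOmega_transpose_mulVec {N M : ℕ} (x : Mode N ⊕ Mode M → ℝ) :
    (bipOmega N M)ᵀ *ᵥ x
      = Sum.elim ((Omega N)ᵀ *ᵥ (x ∘ Sum.inl)) ((Omega M)ᵀ *ᵥ (x ∘ Sum.inr)) := by
  rw [bipOmega, fromBlocks_transpose, fromBlocks_mulVec]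
  simp

theorem bipOmega_mulVec {N M : ℕ} (x : Mode N ⊕ Mode M → ℝ) :
    bipOmega N M *ᵥ x = Sum.elim (Omega N *ᵥ (x ∘ Sum.inl)) (Omega M *ᵥ (x ∘ Sum.inr)) := by
  rw [bipOmega, fromBlocks_mulVec]
  simp

theorem dotProduct_bobOmega {N M : ℕ} (x y : Mode N ⊕ Mode M → ℝ) :
    x ⬝ᵥ (fromBlocks 0 0 0 (Omega M) : Matrix (Mode N ⊕ Mode M) (Mode N ⊕ Mode M) ℝ) *ᵥ y
      = (x ∘ Sum.inr) ⬝ᵥ Omega M *ᵥ (y ∘ Sum.inr) := by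
  rw [fromBlocks_mulVec]
  simp [dotProduct, Fintype.sum_sum_type]

theorem Omega_invariant {N : ℕ} (x y : Mode N → ℝ) :
    ((Omega N)ᵀ *ᵥ x) ⬝ᵥ Omega N *ᵥ ((Omega N)ᵀ *ᵥ y) = x ⬝ᵥ Omega N *ᵥ y := by
  rw [← dotProduct_congr, transpose_transpose, Omega_transpose, Omega_mul_self]
  simp

/-- If `B - i Aᵀ Ω A ≥ 0` then the channel breaks the steerability of every Gaussian state. -/
theorem isGaussianSteerabilityBreaking_of_noise {N N' : ℕ} {Λ : QChannel N N'}
    {A : Matrix (Mode N) (Mode N') ℝ} {B : Matrix (Mode N') (Mode N') ℝ} {c : Mode N' → ℝ}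
    (hΛ : ∀ x : Mode N' → ℝ, Λ.toCP (weyl x) = gaussFactor B c x • weyl (A *ᵥ x))
    (h : (complexComb B (-(Aᵀ * Omega N * A))).PosSemidef) :
    Λ.IsGaussianSteerabilityBreaking := by
  intro M ρ V d hρ
  obtain ⟨hB, hAB⟩ := posSemidef_noise_iff.mp h
  obtain ⟨hG, -, hunc⟩ := posSemidef_complexComb_iff.mp (uncertainty hρ)
  set G := (bipOmega N M)ᵀ * V * bipOmega N M
  set e := bipOmega N M *ᵥ d
  let A₁ : Matrix (Mode N ⊕ Mode M) (Mode N' ⊕ Mode M) ℝ := fromBlocks A 0 0 1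
  have hA₁ : ∀ x, A₁ *ᵥ x = Sum.elim (A *ᵥ (x ∘ Sum.inl)) (x ∘ Sum.inr) := by
    intro x
    rw [fromBlocks_mulVec]
    simp
  let G' : Matrix (Mode N' ⊕ Mode M) (Mode N' ⊕ Mode M) ℝ :=
    fromBlocks B 0 0 0 + A₁ᵀ * G * A₁
  have hG' : G'ᵀ = G' := by
    simp only [G', transpose_add, fromBlocks_transpose, transpose_mul, transpose_transpose,
      transpose_zero, hB, hG, Matrix.mul_assoc]
  have hGq : ∀ x y, x ⬝ᵥ G' *ᵥ y = (x ∘ Sum.inl) ⬝ᵥ B *ᵥ (y ∘ Sum.inl)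
      + (A₁ *ᵥ x) ⬝ᵥ G *ᵥ (A₁ *ᵥ y) := by
    intro x y
    rw [add_mulVec, dotProduct_add, dotProduct_congr, fromBlocks_mulVec]
    simp [dotProduct, Fintype.sum_sum_type]
  -- `G'` and `e'` are the parameters of the output characteristic function
  let e' : Mode N' ⊕ Mode M → ℝ := Sum.elim c 0 + A₁ᵀ *ᵥ e
  refine ⟨bipOmega N' M * G' * (bipOmega N' M)ᵀ, (bipOmega N' M)ᵀ *ᵥ e', ⟨?_, fun x => ?_⟩, ?_⟩
  · rw [Matrix.IsSymm, transpose_mul, transpose_mul, transpose_transpose, hG', Matrix.mul_assoc]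
  · have h1 : bipOmega N' M *ᵥ ((bipOmega N' M)ᵀ *ᵥ e') = e' := by
      have h2 : bipOmega N' M * (bipOmega N' M)ᵀ = 1 := by
        rw [bipOmega_transpose, bipOmega, Matrix.mul_neg, fromBlocks_multiply]
        simp [Omega_mul_self, fromBlocks_neg]
      rw [mulVec_mulVec, h2, one_mulVec]
    have h3 : e' ⬝ᵥ x = c ⬝ᵥ (x ∘ Sum.inl) + e ⬝ᵥ (A₁ *ᵥ x) := by
      simp only [e', add_dotProduct]
      rw [mulVec_transpose, ← dotProduct_mulVec]
      simp [dotProduct, Fintype.sum_sum_type]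
    rw [bipOmega_conj, h1, aliceChar_eq hΛ, ← hA₁, hρ.2, gaussFactor, gaussFactor, gaussFactor,
      ← Complex.exp_add, hGq, h3]
    congr 1
    push_cast
    ring
  · have hsymm : (bipOmega N' M * G' * (bipOmega N' M)ᵀ)ᵀ
        = bipOmega N' M * G' * (bipOmega N' M)ᵀ := by
      rw [transpose_mul, transpose_mul, transpose_transpose, hG', Matrix.mul_assoc]
    refine posSemidef_complexComb_iff.mpr ⟨hsymm, ?_, fun u v => ?_⟩
    · rw [fromBlocks_transpose, Omega_transpose, fromBlocks_neg]
      simp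
    · have hcong : ∀ x y, x ⬝ᵥ (bipOmega N' M * G' * (bipOmega N' M)ᵀ) *ᵥ y
          = ((bipOmega N' M)ᵀ *ᵥ x) ⬝ᵥ G' *ᵥ ((bipOmega N' M)ᵀ *ᵥ y) := by
        intro x y
        rw [← dotProduct_congr, transpose_transpose]
      set u' := (bipOmega N' M)ᵀ *ᵥ u with hu'
      set v' := (bipOmega N' M)ᵀ *ᵥ v with hv'
      have hBob : (u ∘ Sum.inr) ⬝ᵥ Omega M *ᵥ (v ∘ Sum.inr)
          = (u' ∘ Sum.inr) ⬝ᵥ Omega M *ᵥ (v' ∘ Sum.inr) := by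
        rw [hu', hv', bipOmega_transpose_mulVec, bipOmega_transpose_mulVec, Sum.elim_comp_inr,
          Sum.elim_comp_inr, Omega_invariant]
      -- add the noise condition on Alice's side to the pullback of the uncertainty relation
      have k1 := hAB (u' ∘ Sum.inl) (v' ∘ Sum.inl)
      have k2 := hunc (A₁ *ᵥ u') (A₁ *ᵥ v')
      rw [dotProduct_bipOmega, hA₁ u', hA₁ v', Sum.elim_comp_inl, Sum.elim_comp_inl,
        Sum.elim_comp_inr, Sum.elim_comp_inr, ← hA₁, ← hA₁] at k2
      rw [dotProduct_bobOmega, hcong, hcong, ← hu', ← hv', hGq, hGq, hBob]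
      linarith

theorem pos_sigmaZ {N : ℕ} (x : Mode N → ℝ) : pos (sigmaZ N *ᵥ x) = pos x := by
  funext j
  simp [sigmaZ, mulVec, dotProduct, Fintype.sum_prod_type, Matrix.one_apply, pos]

theorem mom_sigmaZ {N : ℕ} (x : Mode N → ℝ) : mom (sigmaZ N *ᵥ x) = -mom x := by
  funext j
  simp [sigmaZ, mulVec, dotProduct, Fintype.sum_prod_type, Matrix.one_apply, mom]

theorem pos_Omega {N : ℕ} (x : Mode N → ℝ) : pos (Omega N *ᵥ x) = mom x := by
  funext j
  simp [Omega, mulVec, dotProduct, Fintype.sum_prod_type, Matrix.one_apply, pos, mom]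

theorem mom_Omega {N : ℕ} (x : Mode N → ℝ) : mom (Omega N *ᵥ x) = -pos x := by
  funext j
  simp [Omega, mulVec, dotProduct, Fintype.sum_prod_type, Matrix.one_apply, pos, mom]

theorem dotProduct_eq_pos_mom {N : ℕ} (x y : Mode N → ℝ) :
    x ⬝ᵥ y = pos x ⬝ᵥ pos y + mom x ⬝ᵥ mom y := by
  simp [dotProduct, Fintype.sum_prod_type, pos, mom, Finset.sum_add_distrib]

/-- Breaking the steerability of regularised EPR states with `r → ∞` forces `B - i Aᵀ Ω A ≥ 0`. -/
theorem noise_of_breaksSteerability_epr {N N' : ℕ} {Λ : QChannel N N'}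
    {A : Matrix (Mode N) (Mode N') ℝ} {B : Matrix (Mode N') (Mode N') ℝ} {c : Mode N' → ℝ}
    (hΛ : ∀ x : Mode N' → ℝ, Λ.toCP (weyl x) = gaussFactor B c x • weyl (A *ᵥ x))
    (hB : Bᵀ = B)
    (h : ∀ r : ℝ, 0 < r → ∃ ρ : QState (HilTensor (Hil N) (Hil N)),
      IsEPR r ρ ∧ Λ.BreaksSteerability ρ) :
    (complexComb B (-(Aᵀ * Omega N * A))).PosSemidef := by
  refine posSemidef_noise_iff.mpr ⟨hB, fun u v => ?_⟩
  have hbound : ∀ r : ℝ, 0 < r → 0 ≤ u ⬝ᵥ B *ᵥ u + v ⬝ᵥ B *ᵥ v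
      + 2 * ((A *ᵥ u) ⬝ᵥ Omega N *ᵥ (A *ᵥ v))
      + Real.exp (-r) * (2 * ((A *ᵥ u) ⬝ᵥ (A *ᵥ u) + (A *ᵥ v) ⬝ᵥ (A *ᵥ v))) := by
    intro r hr
    obtain ⟨ρ, hρ, V, d, ⟨hV, hχ⟩, hns⟩ := h r hr
    obtain ⟨-, -, hns⟩ := posSemidef_complexComb_iff.mp hns
    -- the matrix of the output characteristic function is determined by the channel
    have hq : ∀ x, (bipOmega N' N *ᵥ x) ⬝ᵥ V *ᵥ (bipOmega N' N *ᵥ x)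
        = (x ∘ Sum.inl) ⬝ᵥ B *ᵥ (x ∘ Sum.inl)
          + (bipOmega N N *ᵥ Sum.elim (A *ᵥ (x ∘ Sum.inl)) (x ∘ Sum.inr)) ⬝ᵥ eprCov N r *ᵥ
            (bipOmega N N *ᵥ Sum.elim (A *ᵥ (x ∘ Sum.inl)) (x ∘ Sum.inr)) := by
      intro x
      have h1 := congrArg norm (hχ x)
      rw [aliceChar_eq hΛ, hρ.2, norm_mul, gaussFactor_norm, gaussFactor_norm, gaussFactor_norm,
        ← Real.exp_add, dotProduct_congr, dotProduct_congr] at h1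
      linarith [Real.exp_injective h1]
    -- the EPR correlations: the quadratic form is squeezed to `e^{-r}` on the vectors `(a, Z a)`
    have hepr : ∀ a : Mode N → ℝ, (bipOmega N N *ᵥ Sum.elim a (sigmaZ N *ᵥ a)) ⬝ᵥ eprCov N r *ᵥ
        (bipOmega N N *ᵥ Sum.elim a (sigmaZ N *ᵥ a)) = 2 * Real.exp (-r) * (a ⬝ᵥ a) := by
      intro a
      rw [bipOmega_mulVec, Sum.elim_comp_inl, Sum.elim_comp_inr, eprCov, fromBlocks_mulVec,
        Sum.elim_comp_inl, Sum.elim_comp_inr, sumElim_dotProduct_sumElim]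
      simp only [smul_mulVec, one_mulVec, dotProduct_add, dotProduct_smul, smul_eq_mul]
      rw [dotProduct_eq_pos_mom a]
      simp only [dotProduct_eq_pos_mom (Omega N *ᵥ _)]
      simp only [pos_sigmaZ, mom_sigmaZ, pos_Omega, mom_Omega, neg_dotProduct, dotProduct_neg,
        neg_neg]
      rw [← Real.cosh_sub_sinh]
      ring
    have hmain : ∀ w : Mode N' → ℝ,
        (bipOmega N' N *ᵥ Sum.elim w (sigmaZ N *ᵥ (A *ᵥ w))) ⬝ᵥ V *ᵥ
          (bipOmega N' N *ᵥ Sum.elim w (sigmaZ N *ᵥ (A *ᵥ w)))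
        = w ⬝ᵥ B *ᵥ w + 2 * Real.exp (-r) * ((A *ᵥ w) ⬝ᵥ (A *ᵥ w)) := by
      intro w
      rw [hq, Sum.elim_comp_inl, Sum.elim_comp_inr, hepr]
    have k := hns (bipOmega N' N *ᵥ Sum.elim u (sigmaZ N *ᵥ (A *ᵥ u)))
      (bipOmega N' N *ᵥ Sum.elim v (sigmaZ N *ᵥ (A *ᵥ v)))
    rw [hmain, hmain, dotProduct_bobOmega, bipOmega_mulVec, bipOmega_mulVec] at k
    simp only [Sum.elim_comp_inr, dotProduct_Omega, pos_sigmaZ, mom_sigmaZ, pos_Omega, mom_Omega,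
      neg_dotProduct, dotProduct_neg, neg_neg] at k ⊢
    rw [dotProduct_comm (mom (A *ᵥ u)) (pos (A *ᵥ v))] at k ⊢
    linarith
  have hlim : Filter.Tendsto (fun r : ℝ => u ⬝ᵥ B *ᵥ u + v ⬝ᵥ B *ᵥ v
      + 2 * ((A *ᵥ u) ⬝ᵥ Omega N *ᵥ (A *ᵥ v))
      + Real.exp (-r) * (2 * ((A *ᵥ u) ⬝ᵥ (A *ᵥ u) + (A *ᵥ v) ⬝ᵥ (A *ᵥ v)))) Filter.atTop
      (nhds (u ⬝ᵥ B *ᵥ u + v ⬝ᵥ B *ᵥ v + 2 * ((A *ᵥ u) ⬝ᵥ Omega N *ᵥ (A *ᵥ v)) + 0 *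
        (2 * ((A *ᵥ u) ⬝ᵥ (A *ᵥ u) + (A *ᵥ v) ⬝ᵥ (A *ᵥ v))))) :=
    tendsto_const_nhds.add (Real.tendsto_exp_neg_atTop_nhds_zero.mul_const _)
  rw [zero_mul, add_zero] at hlim
  refine ge_of_tendsto hlim ?_
  filter_upwards [Filter.eventually_gt_atTop 0] with r hr using hbound r hr

/-! ### Existence of the regularised EPR states -/

theorem inner_integral_integral {X Y H : Type*} [MeasurableSpace X] [MeasurableSpace Y]
    {μ : Measure X} {ν : Measure Y} [NormedAddCommGroup H] [InnerProductSpace ℂ H]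
    [CompleteSpace H] {f : X → H} {g : Y → H} (hf : Integrable f μ) (hg : Integrable g ν) :
    ⟪∫ u, f u ∂μ, ∫ v, g v ∂ν⟫_ℂ = ∫ u, ∫ v, ⟪f u, g v⟫_ℂ ∂ν ∂μ := by
  rw [← inner_conj_symm, ← integral_inner hf, ← integral_conj]
  refine integral_congr_ae (Filter.Eventually.of_forall fun u => ?_)
  simp only
  rw [inner_conj_symm, integral_inner hg]

/-- The phase space point with position `q` and momentum `0`. -/
def posVec {N : ℕ} (q : Conf N) : Mode N → ℝ := fun k => if k.2 = 0 then q k.1 else 0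

theorem pos_posVec {N : ℕ} (q : Conf N) : pos (posVec q) = q := by funext j; simp [pos, posVec]

theorem mom_posVec {N : ℕ} (q : Conf N) : mom (posVec q) = 0 := by funext j; simp [mom, posVec]

theorem inner_shifted_gaussVec (N : ℕ) {a : ℝ} (ha : 0 < a) (u v : Conf N) (x : Mode N → ℝ) :
    ⟪weyl (posVec u) (gaussVec N ha), weyl x (weyl (posVec v) (gaussVec N ha))⟫_ℂ
      = (Real.pi / a : ℂ) ^ (N / 2 : ℂ) *
        Complex.exp (∑ i, ((Complex.I / 2) * mom x i * (u i + v i)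
          - (a / 4 : ℂ) * (pos x i + v i - u i) ^ 2 - (1 / (4 * a) : ℂ) * (mom x i) ^ 2)) := by
  rw [weyl_weyl, inner_smul_right, inner_weyl_weyl, inner_gaussVec_weyl, ← mul_assoc,
    ← Complex.exp_add, mul_left_comm, ← Complex.exp_add, dotProduct_Omega, dotProduct_Omega]
  have h1 : pos (x + posVec v - posVec u) = pos x + v - u := by
    rw [← pos_posVec v, ← pos_posVec u, pos_posVec v, pos_posVec u]
    funext j
    simp [pos, posVec]
  have h2 : mom (x + posVec v - posVec u) = mom x := by
    funext j
    simp [mom, posVec]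
  have h3 : mom (x + posVec v) = mom x := by
    funext j
    simp [mom, posVec]
  rw [h1, h2, h3, mom_posVec, mom_posVec, pos_posVec, pos_posVec]
  congr 2
  simp only [dotProduct, Pi.zero_apply, mul_zero, zero_mul, Finset.sum_const_zero, zero_sub,
    sub_zero, Complex.ofReal_neg, Complex.ofReal_sum, Complex.ofReal_mul, Finset.mul_sum,
    Pi.add_apply, Pi.sub_apply, Complex.ofReal_add, Complex.ofReal_sub, neg_mul, mul_neg, neg_neg,
    ← Finset.sum_add_distrib, ← Finset.sum_sub_distrib, ← Finset.sum_neg_distrib]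
  refine Finset.sum_congr rfl fun i _ => ?_
  ring

/-- The product of two equally displaced Gaussian vectors. -/
noncomputable def twinVec (N : ℕ) {a : ℝ} (ha : 0 < a) (u : Conf N) : HilTensor (Hil N) (Hil N) :=
  ((weyl (posVec u) (gaussVec N ha) ⊗ₜ[ℂ] weyl (posVec u) (gaussVec N ha) :
    Hil N ⊗[ℂ] Hil N) : HilTensor (Hil N) (Hil N))

theorem inner_twinVec (N : ℕ) {a : ℝ} (ha : 0 < a) (u v : Conf N) (x : Mode N ⊕ Mode N → ℝ) :
    ⟪twinVec N ha u, bipWeyl x (twinVec N ha v)⟫_ℂ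
      = ((Real.pi / a : ℂ) ^ (N / 2 : ℂ)) ^ 2 * Complex.exp (∑ i,
        ((Complex.I / 2) * (mom (x ∘ Sum.inl) i + mom (x ∘ Sum.inr) i) * (u i + v i)
          - (a / 4 : ℂ) * ((pos (x ∘ Sum.inl) i + v i - u i) ^ 2
            + (pos (x ∘ Sum.inr) i + v i - u i) ^ 2)
          - (1 / (4 * a) : ℂ) * ((mom (x ∘ Sum.inl) i) ^ 2 + (mom (x ∘ Sum.inr) i) ^ 2))) := by
  rw [twinVec, twinVec, bipWeyl, opTensor_tmul, inner_hilTensor_tmul, inner_shifted_gaussVec,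
    inner_shifted_gaussVec, mul_mul_mul_comm, ← Complex.exp_add, ← Finset.sum_add_distrib, sq]
  congr 2
  refine Finset.sum_congr rfl fun i _ => ?_
  ring

theorem continuous_twinVec (N : ℕ) {a : ℝ} (ha : 0 < a) : Continuous (twinVec N ha) := by
  refine continuous_of_continuous_inner _ ?_
  have h : ∀ p : Conf N × Conf N, ⟪twinVec N ha p.1, twinVec N ha p.2⟫_ℂ
      = ⟪twinVec N ha p.1, bipWeyl 0 (twinVec N ha p.2)⟫_ℂ := fun p => by rw [bipWeyl_zero]
  simp_rw [h, inner_twinVec]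
  fun_prop

/-- The Gaussian weight `exp(-β |u|² / 2)`, times the product vector displaced by `u`. -/
noncomputable def weightedTwinVec (N : ℕ) {a : ℝ} (ha : 0 < a) (β : ℝ) (u : Conf N) :
    HilTensor (Hil N) (Hil N) := gaussFun N β u • twinVec N ha u

theorem integrable_weightedTwinVec (N : ℕ) {a : ℝ} (ha : 0 < a) {β : ℝ} (hβ : 0 < β) :
    Integrable (weightedTwinVec N ha β) := by
  have hw : Continuous (gaussFun N β) := by unfold gaussFun; fun_prop
  have h1 := (GaussianFourier.integrable_cexp_neg_mul_sum_add (ι := Fin N) (b := ((β / 2 : ℝ) : ℂ))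
    (by rw [Complex.ofReal_re]; positivity) 0).norm
  refine (h1.mul_const (‖gaussVec N ha‖ * ‖gaussVec N ha‖)).mono'
    (hw.smul (continuous_twinVec N ha)).aestronglyMeasurable
    (Filter.Eventually.of_forall fun u => le_of_eq ?_)
  rw [weightedTwinVec, norm_smul, twinVec, UniformSpace.Completion.norm_coe,
    TensorProduct.norm_tmul, norm_weyl, gaussFun]
  simp

/-- The Gaussian integral over the displacement of the second vector and then of the first one,
written for one mode: completing squares turns the exponent into that of the EPR state, with
`e = exp r`. -/
theorem epr_exponent {e : ℂ} (he : e ≠ 0) (h2 : e ^ 2 + 1 ≠ 0)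
    (q p q' p' : ℂ) :
    ((Complex.I / 2) * (p + p') + (e / 2) * (q + q')
        + e * ((Complex.I / 2) * (p + p') - (e / 2) * (q + q'))
          / (2 * (e * (e ^ 2 + 1) / (2 * (e ^ 2 - 1))))) ^ 2
        / (4 * (2 * e ^ 3 / ((e ^ 2 - 1) * (e ^ 2 + 1))))
      + ((Complex.I / 2) * (p + p') - (e / 2) * (q + q')) ^ 2
        / (4 * (e * (e ^ 2 + 1) / (2 * (e ^ 2 - 1))))
      - (e / 4) * (q ^ 2 + q' ^ 2) - (1 / (4 * e)) * (p ^ 2 + p' ^ 2)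
    = -(1 / 4) * ((e + e⁻¹) / 2 * (q ^ 2 + p ^ 2 + q' ^ 2 + p' ^ 2)
      - (e - e⁻¹) * (q * q' - p * p')) := by
  field_simp
  ring_nf
  simp only [Complex.I_sq]
  ring

/-- With squeezing `a = e^r` of the packets and weight `exp(-|u|² / (2 sinh r))` of the displacements,
the superposition of twin packets has the characteristic function of `ρ_r`, up to normalisation. -/
theorem integral_integral_twinVec (N : ℕ) {r : ℝ} (hr : 0 < r) (ha : 0 < Real.exp r) :
    ∃ κ : ℂ, κ ≠ 0 ∧ ∀ x : Mode N ⊕ Mode N → ℝ,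
      ∫ u, ∫ v, ⟪weightedTwinVec N ha (Real.sinh r)⁻¹ u,
        bipWeyl x (weightedTwinVec N ha (Real.sinh r)⁻¹ v)⟫_ℂ
      = κ * gaussFactor ((bipOmega N N)ᵀ * eprCov N r * bipOmega N N) 0 x := by
  set e : ℝ := Real.exp r with hedef
  have he1 : 1 < e := Real.one_lt_exp_iff.mpr hr
  have hsq : 0 < e ^ 2 - 1 := by nlinarith
  have hsinh : (Real.sinh r)⁻¹ = 2 * e / (e ^ 2 - 1) := by
    rw [Real.sinh_eq, Real.exp_neg, ← hedef]
    field_simp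
  set β : ℝ := 2 * e / (e ^ 2 - 1)
  rw [hsinh]
  have hne : (e : ℂ) ≠ 0 := by exact_mod_cast ha.ne'
  have hne1 : (e : ℂ) ^ 2 - 1 ≠ 0 := by exact_mod_cast hsq.ne'
  have hne2 : (e : ℂ) ^ 2 + 1 ≠ 0 := by
    have : (0 : ℝ) < e ^ 2 + 1 := by positivity
    exact_mod_cast this.ne'
  -- the coefficients of the two Gaussian integrals
  set b₁ : ℝ := e * (e ^ 2 + 1) / (2 * (e ^ 2 - 1)) with hb₁
  set b₂ : ℝ := 2 * e ^ 3 / ((e ^ 2 - 1) * (e ^ 2 + 1)) with hb₂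
  have hb₁pos : 0 < b₁ := by positivity
  have hb₂pos : 0 < b₂ := by positivity
  have hβ₁ : (β : ℂ) / 2 + e / 2 = b₁ := by
    simp only [β, b₁]
    push_cast
    field_simp
    ring
  refine ⟨(((Real.pi / e : ℂ) ^ (N / 2 : ℂ)) ^ 2 * (Real.pi / b₁ : ℂ) ^ (N / 2 : ℂ))
    * (Real.pi / b₂ : ℂ) ^ (N / 2 : ℂ), ?_, fun x => ?_⟩
  · have hc : ∀ b : ℝ, 0 < b → (Real.pi / b : ℂ) ^ (N / 2 : ℂ) ≠ 0 := by
      intro b hb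
      rw [Ne, Complex.cpow_eq_zero_iff]
      have : (b : ℂ) ≠ 0 := by exact_mod_cast hb.ne'
      have hπ : (Real.pi : ℂ) ≠ 0 := by exact_mod_cast Real.pi_ne_zero
      exact fun h => div_ne_zero hπ this h.1
    exact mul_ne_zero (mul_ne_zero (pow_ne_zero 2 (hc e ha)) (hc b₁ hb₁pos)) (hc b₂ hb₂pos)
  set q : Fin N → ℝ := pos (x ∘ Sum.inl)
  set q' : Fin N → ℝ := pos (x ∘ Sum.inr)
  set p : Fin N → ℝ := mom (x ∘ Sum.inl)
  set p' : Fin N → ℝ := mom (x ∘ Sum.inr)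
  set γ : Fin N → ℂ := fun i => (Complex.I / 2) * (p i + p' i) - (e / 2) * (q i + q' i) with hγ
  have hinner : ∀ u v : Conf N, ⟪weightedTwinVec N ha β u, bipWeyl x (weightedTwinVec N ha β v)⟫_ℂ
      = ((Real.pi / e : ℂ) ^ (N / 2 : ℂ)) ^ 2 * Complex.exp (∑ i,
          (-(β / 2 + e / 2) * (u i : ℂ) ^ 2 + ((Complex.I / 2) * (p i + p' i)
            + (e / 2) * (q i + q' i)) * u i - (e / 4) * (q i ^ 2 + q' i ^ 2)
            - (1 / (4 * e)) * (p i ^ 2 + p' i ^ 2)))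
        * Complex.exp (-(b₁ : ℂ) * ∑ i, (v i : ℂ) ^ 2 + ∑ i, (γ i + e * u i) * v i) := by
    intro u v
    rw [weightedTwinVec, weightedTwinVec, map_smul, inner_smul_left, inner_smul_right,
      inner_twinVec, gaussFun, gaussFun, ← Complex.exp_conj, ← mul_assoc, mul_left_comm,
      ← Complex.exp_add, ← Complex.exp_add, mul_assoc, ← Complex.exp_add, ← hβ₁]
    congr 2
    simp only [map_mul, map_neg, map_sum, map_pow, map_div₀, Complex.conj_ofReal, map_ofNat,
      Finset.mul_sum, ← Finset.sum_add_distrib]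
    refine Finset.sum_congr rfl fun i _ => ?_
    simp only [hγ]
    ring
  simp_rw [hinner, integral_const_mul]
  have hv : ∀ u : Conf N,
      ∫ v : Conf N, Complex.exp (-(b₁ : ℂ) * ∑ i, (v i : ℂ) ^ 2 + ∑ i, (γ i + e * u i) * v i)
      = (Real.pi / b₁ : ℂ) ^ (N / 2 : ℂ)
        * Complex.exp ((∑ i, (γ i + e * u i) ^ 2) / (4 * b₁)) := by
    intro u
    have h := GaussianFourier.integral_cexp_neg_mul_sum_add (ι := Fin N) (b := (b₁ : ℂ))
      (by simpa using hb₁pos) (fun i => γ i + e * u i)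
    rwa [Fintype.card_fin] at h
  have hb₂' : (b₁ : ℂ) - e ^ 2 / (4 * b₁) = b₂ := by
    simp only [b₁, b₂]
    push_cast
    field_simp
    ring
  have hb₁ne : (b₁ : ℂ) ≠ 0 := by exact_mod_cast hb₁pos.ne'
  -- the remaining integrand, with squares completed
  have hu : ∀ u : Conf N, ((Real.pi / e : ℂ) ^ (N / 2 : ℂ)) ^ 2 * Complex.exp (∑ i,
          (-(β / 2 + e / 2) * (u i : ℂ) ^ 2 + ((Complex.I / 2) * (p i + p' i)
            + (e / 2) * (q i + q' i)) * u i - (e / 4) * (q i ^ 2 + q' i ^ 2)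
            - (1 / (4 * e)) * (p i ^ 2 + p' i ^ 2)))
        * ∫ v : Conf N, Complex.exp (-(b₁ : ℂ) * ∑ i, (v i : ℂ) ^ 2 + ∑ i, (γ i + e * u i) * v i)
      = (((Real.pi / e : ℂ) ^ (N / 2 : ℂ)) ^ 2 * (Real.pi / b₁ : ℂ) ^ (N / 2 : ℂ)
          * Complex.exp (∑ i, (γ i ^ 2 / (4 * b₁) - (e / 4) * (q i ^ 2 + q' i ^ 2)
            - (1 / (4 * e)) * (p i ^ 2 + p' i ^ 2))))
        * Complex.exp (-(b₂ : ℂ) * ∑ i, (u i : ℂ) ^ 2 + ∑ i, ((Complex.I / 2) * (p i + p' i)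
            + (e / 2) * (q i + q' i) + e * γ i / (2 * b₁)) * u i) := by
    intro u
    rw [hv, mul_mul_mul_comm, ← Complex.exp_add, mul_assoc _ (Complex.exp _), ← Complex.exp_add,
      ← hb₂', ← hβ₁]
    congr 2
    rw [hβ₁]
    simp only [Finset.mul_sum, Finset.sum_div, ← Finset.sum_add_distrib]
    refine Finset.sum_congr rfl fun i _ => ?_
    field_simp
    ring
  simp_rw [hu, integral_const_mul]
  have h := GaussianFourier.integral_cexp_neg_mul_sum_add (ι := Fin N) (b := (b₂ : ℂ))
    (by simpa using hb₂pos) (fun i => (Complex.I / 2) * (p i + p' i)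
            + (e / 2) * (q i + q' i) + e * γ i / (2 * b₁))
  rw [Fintype.card_fin] at h
  rw [h, mul_mul_mul_comm, ← Complex.exp_add]
  congr 1
  have hcosh : (Real.cosh r : ℂ) = ((e : ℂ) + (e : ℂ)⁻¹) / 2 := by
    rw [Real.cosh_eq, Real.exp_neg, ← hedef]
    push_cast
    rfl
  have hsinh2 : (Real.sinh r : ℂ) = ((e : ℂ) - (e : ℂ)⁻¹) / 2 := by
    rw [Real.sinh_eq, Real.exp_neg, ← hedef]
    push_cast
    rfl
  rw [gaussFactor, dotProduct_congr]
  congr 1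
  have hq : (bipOmega N N *ᵥ x) ⬝ᵥ eprCov N r *ᵥ (bipOmega N N *ᵥ x)
      = ∑ i, (Real.cosh r * (q i ^ 2 + p i ^ 2 + q' i ^ 2 + p' i ^ 2)
        - 2 * Real.sinh r * (q i * q' i - p i * p' i)) := by
    rw [bipOmega_mulVec, eprCov, fromBlocks_mulVec, Sum.elim_comp_inl, Sum.elim_comp_inr,
      sumElim_dotProduct_sumElim]
    simp only [smul_mulVec, one_mulVec, dotProduct_add, dotProduct_smul, smul_eq_mul]
    simp only [dotProduct_eq_pos_mom, pos_sigmaZ, mom_sigmaZ, pos_Omega, mom_Omega]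
    simp only [dotProduct, Finset.mul_sum, ← Finset.sum_add_distrib, Pi.neg_apply]
    refine Finset.sum_congr rfl fun i _ => ?_
    simp only [q, p, q', p']
    ring
  rw [hq, zero_dotProduct, Complex.ofReal_zero, mul_zero, sub_zero, Complex.ofReal_sum,
    Finset.mul_sum, Finset.sum_div, ← Finset.sum_add_distrib]
  refine Finset.sum_congr rfl fun i _ => ?_
  have hid := epr_exponent hne hne2 (q i) (p i) (q' i) (p' i)
  have hb₁c : (b₁ : ℂ) = (e : ℂ) * ((e : ℂ) ^ 2 + 1) / (2 * ((e : ℂ) ^ 2 - 1)) := by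
    rw [hb₁]; push_cast; rfl
  have hb₂c : (b₂ : ℂ) = 2 * (e : ℂ) ^ 3 / (((e : ℂ) ^ 2 - 1) * ((e : ℂ) ^ 2 + 1)) := by
    rw [hb₂]; push_cast; rfl
  rw [← hb₁c, ← hb₂c] at hid
  simp only [Complex.ofReal_mul, Complex.ofReal_sub, Complex.ofReal_add, Complex.ofReal_pow,
    Complex.ofReal_ofNat]
  rw [hcosh, hsinh2]
  simp only [hγ]
  linear_combination hid

theorem exists_isEPR (N : ℕ) {r : ℝ} (hr : 0 < r) :
    ∃ ρ : QState (HilTensor (Hil N) (Hil N)), IsEPR r ρ := by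
  obtain ⟨κ, hκ0, hκ⟩ := integral_integral_twinVec N hr (Real.exp_pos r)
  have hint := integrable_weightedTwinVec N (Real.exp_pos r)
    (inv_pos.mpr (Real.sinh_pos_iff.mpr hr))
  set ξ := weightedTwinVec N (Real.exp_pos r) (Real.sinh r)⁻¹
  set Ψ := ∫ u, ξ u
  have hW : ∀ x, ⟪Ψ, bipWeyl x Ψ⟫_ℂ
      = κ * gaussFactor ((bipOmega N N)ᵀ * eprCov N r * bipOmega N N) 0 x := by
    intro x
    rw [← hκ x, ← ContinuousLinearMap.integral_comp_comm _ hint,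
      inner_integral_integral hint ((bipWeyl x).integrable_comp hint)]
  have hg0 : gaussFactor ((bipOmega N N)ᵀ * eprCov N r * bipOmega N N) 0 0 = 1 := by
    simp [gaussFactor]
  have hκΨ : κ = (‖Ψ‖ : ℂ) ^ 2 := by
    have h := hW 0
    rw [bipWeyl_zero, hg0, mul_one] at h
    rw [← h]
    exact inner_self_eq_norm_sq_to_K _
  have hΨ : ‖Ψ‖ ≠ 0 := by
    intro h
    rw [h, Complex.ofReal_zero, zero_pow two_ne_zero] at hκΨ
    exact hκ0 hκΨ
  have hΨ' : (‖Ψ‖ : ℂ) ≠ 0 := by exact_mod_cast hΨ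
  refine ⟨vectorState (((‖Ψ‖⁻¹ : ℝ) : ℂ) • Ψ) (by
    rw [norm_smul, Complex.norm_real, norm_inv, norm_norm, inv_mul_cancel₀ hΨ]), ?_, fun x => ?_⟩
  · rw [Matrix.IsSymm, eprCov, fromBlocks_transpose]
    have hZ : (sigmaZ N)ᵀ = sigmaZ N := by
      refine Matrix.ext fun i j => ?_
      obtain ⟨i, a⟩ := i
      obtain ⟨j, b⟩ := j
      fin_cases a <;> fin_cases b <;> simp [sigmaZ, Matrix.one_apply, eq_comm]
    simp [hZ]
  · have h1 : bipChar (vectorState (((‖Ψ‖⁻¹ : ℝ) : ℂ) • Ψ) (by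
        rw [norm_smul, Complex.norm_real, norm_inv, norm_norm, inv_mul_cancel₀ hΨ])) x
        = ⟪((‖Ψ‖⁻¹ : ℝ) : ℂ) • Ψ, bipWeyl x (((‖Ψ‖⁻¹ : ℝ) : ℂ) • Ψ)⟫_ℂ := rfl
    rw [h1, map_smul, inner_smul_left, inner_smul_right, hW, hκΨ, Complex.conj_ofReal, mulVec_zero]
    push_cast
    field_simp

/-! ### Bochner's theorem for Gram kernels -/

section Bochner

open Real FourierTransform Module
open scoped RealInnerProductSpace

section Gram

variable {V H : Type*} [NormedAddCommGroup V] [NormedAddCommGroup H] [InnerProductSpace ℂ H]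
  {ξ : V → H} {f : V → ℂ}

theorem norm_of_gram (hf : ∀ p q, ⟪ξ q, ξ p⟫_ℂ = f (p - q)) (h0 : f 0 = 1) (p : V) :
    ‖ξ p‖ = 1 := by
  have h1 := inner_self_eq_norm_sq_to_K (𝕜 := ℂ) (ξ p)
  rw [hf, sub_self, h0] at h1
  have h2 : ‖ξ p‖ ^ 2 = 1 := Complex.ofReal_injective (by
    rw [Complex.ofReal_pow, Complex.ofReal_one]; exact h1.symm)
  nlinarith [norm_nonneg (ξ p)]

theorem norm_le_of_gram (hf : ∀ p q, ⟪ξ q, ξ p⟫_ℂ = f (p - q)) (h0 : f 0 = 1) (p : V) :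
    ‖f p‖ ≤ 1 := by
  have h := norm_inner_le_norm (𝕜 := ℂ) (ξ 0) (ξ p)
  rwa [hf, sub_zero, norm_of_gram hf h0, norm_of_gram hf h0, one_mul] at h

theorem continuous_of_gram (hξ : Continuous ξ) (hf : ∀ p q, ⟪ξ q, ξ p⟫_ℂ = f (p - q)) :
    Continuous f := by
  have h : f = fun p => ⟪ξ 0, ξ p⟫_ℂ := by funext p; rw [hf, sub_zero]
  rw [h]
  exact continuous_const.inner hξ

end Gram

variable {V : Type*} [NormedAddCommGroup V] [InnerProductSpace ℝ V] [FiniteDimensional ℝ V]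
  [MeasurableSpace V] [BorelSpace V]

/-- A pointwise limit of characteristic functions of finite measures which is continuous at the
origin is a characteristic function: the normalised measures are tight, and any limit point in the
weak topology does the job. -/
theorem exists_charFun_eq_of_tendsto {ν : ℕ → Measure V} [∀ n, IsFiniteMeasure (ν n)] {f : V → ℂ}
    (hf : ContinuousAt f 0) (h0 : f 0 = 1)
    (h : ∀ t, Filter.Tendsto (fun n => charFun (ν n) t) Filter.atTop (nhds (f t))) :
    ∃ μ : Measure V, IsProbabilityMeasure μ ∧ ∀ t, charFun μ t = f t := by
  have hm : Filter.Tendsto (fun n => (ν n).real Set.univ) Filter.atTop (nhds 1) := by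
    have h1 := (Complex.continuous_re.tendsto _).comp (h 0)
    simpa [Function.comp_def, charFun_zero, h0] using h1
  obtain ⟨n₀, hn₀⟩ := Filter.eventually_atTop.mp (hm.eventually_const_lt (zero_lt_one' ℝ))
  have hpos : ∀ n, 0 < (ν (n + n₀)).real Set.univ := fun n => hn₀ _ (Nat.le_add_left _ _)
  have hne : ∀ n, NeZero (ν (n + n₀)) := fun n => ⟨fun hz => by
    have := hpos n
    simp [hz] at this⟩
  let μ : ℕ → ProbabilityMeasure V := fun n =>
    ⟨((ν (n + n₀)) Set.univ)⁻¹ • ν (n + n₀), isProbabilityMeasureSMul⟩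
  have hμ : ∀ t, Filter.Tendsto (fun n => charFun (μ n : Measure V) t) Filter.atTop
      (nhds (f t)) := by
    intro t
    have h1 : Filter.Tendsto (fun n => ((((ν (n + n₀)).real Set.univ)⁻¹ : ℝ) : ℂ)
        * charFun (ν (n + n₀)) t) Filter.atTop (nhds (((1⁻¹ : ℝ) : ℂ) * f t)) := by
      refine Filter.Tendsto.mul ?_ ((Filter.tendsto_add_atTop_iff_nat n₀).mpr (h t))
      exact (Complex.continuous_ofReal.tendsto _).comp
        (((Filter.tendsto_add_atTop_iff_nat n₀).mpr hm).inv₀ one_ne_zero)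
    rw [inv_one, Complex.ofReal_one, one_mul] at h1
    refine h1.congr fun n => ?_
    simp only [μ, ProbabilityMeasure.coe_mk, charFun_apply]
    rw [integral_smul_measure, Complex.real_smul, ENNReal.toReal_inv]
    rfl
  have htight : IsTightMeasureSet (Set.range fun n => (μ n : Measure V)) :=
    isTightMeasureSet_of_tendsto_charFun hf hμ
  have hcompact : IsCompact (closure (Set.range μ)) := by
    refine isCompact_closure_of_isTightMeasureSet ?_
    convert htight using 1
    ext m
    simp
  obtain ⟨μ', -, hμ'⟩ := hcompact.ultrafilter_le_nhds ((Filter.hyperfilter ℕ).map μ)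
    (Filter.le_principal_iff.mpr (Filter.mem_map.mpr
      (Filter.univ_mem' fun n => subset_closure (Set.mem_range_self n))))
  have hlim : Filter.Tendsto μ (Filter.hyperfilter ℕ) (nhds μ') := hμ'
  refine ⟨μ', inferInstance, fun t => ?_⟩
  rw [ProbabilityMeasure.tendsto_iff_forall_integral_rclike_tendsto ℂ] at hlim
  have h2 := hlim (BoundedContinuousFunction.innerProbChar t)
  simp_rw [← charFun_eq_integral_innerProbChar] at h2
  exact tendsto_nhds_unique h2 ((hμ t).mono_left Nat.hyperfilter_le_atTop)

variable {H : Type*} [NormedAddCommGroup H] [InnerProductSpace ℂ H]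
  {ξ : V → H} {f : V → ℂ}

theorem integrable_gaussian {a : ℝ} (ha : 0 < a) :
    Integrable fun p : V => Real.exp (-a * ‖p‖ ^ 2) := by
  have h := (GaussianFourier.integrable_cexp_neg_mul_sq_norm_add (V := V) (b := (a : ℂ))
    (by simpa using ha) 0 0).norm
  refine h.congr (Filter.Eventually.of_forall fun p => ?_)
  simp only [Complex.norm_exp]
  congr 1
  simp [← Complex.ofReal_pow]

theorem integrable_gaussian_mul (hξ : Continuous ξ) (hf : ∀ p q, ⟪ξ q, ξ p⟫_ℂ = f (p - q))
    (h0 : f 0 = 1) {a : ℝ} (ha : 0 < a) :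
    Integrable fun p : V => (Real.exp (-a * ‖p‖ ^ 2) : ℂ) * f p := by
  refine (integrable_gaussian ha).mono' (Continuous.aestronglyMeasurable ?_)
    (Filter.Eventually.of_forall fun p => ?_)
  · have := continuous_of_gram hξ hf
    fun_prop
  · rw [norm_mul, Complex.norm_real, Real.norm_eq_abs, Real.abs_exp]
    exact mul_le_of_le_one_right (Real.exp_pos _).le (norm_le_of_gram hf h0 p)

/-- The Fourier transform of a Gram kernel, damped by a Gaussian, is nonnegative: up to a positive
constant it is the squared norm of the Gaussian superposition of the vectors
`e^{-2πi⟨p,v⟩} ξ_p`. -/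
theorem fourier_gaussian_gram_nonneg [CompleteSpace H] (hξ : Continuous ξ)
    (hf : ∀ p q, ⟪ξ q, ξ p⟫_ℂ = f (p - q)) (h0 : f 0 = 1) {a : ℝ} (ha : 0 < a) (v : V) :
    0 ≤ 𝓕 (fun p : V => (Real.exp (-a * ‖p‖ ^ 2) : ℂ) * f p) v := by
  let χ : V → ℂ := fun p => Complex.exp (((-2 * π * ⟪p, v⟫ : ℝ) : ℂ) * Complex.I)
  let w : V → ℝ := fun p => Real.exp (-(2 * a) * ‖p‖ ^ 2)
  have hχ : Continuous χ := by fun_prop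
  have hw : Continuous w := by fun_prop
  have hfc := continuous_of_gram hξ hf
  have hχn : ∀ p, ‖χ p‖ = 1 := fun p => Complex.norm_exp_ofReal_mul_I _
  have hint : Integrable fun p => (χ p * w p) • ξ p := by
    refine (integrable_gaussian (V := V) (by positivity : 0 < 2 * a)).mono'
      (Continuous.aestronglyMeasurable (by fun_prop)) (Filter.Eventually.of_forall fun p => ?_)
    rw [norm_smul, norm_mul, hχn, norm_of_gram hf h0, one_mul, mul_one, Complex.norm_real,
      Real.norm_eq_abs, Real.abs_exp]
  have hχadd : ∀ u q, (starRingEnd ℂ) (χ q) * χ (u + q) = χ u := by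
    intro u q
    simp only [χ]
    rw [← Complex.exp_conj, ← Complex.exp_add]
    congr 1
    simp only [map_mul, Complex.conj_ofReal, Complex.conj_I, inner_add_left]
    push_cast
    ring
  have hww : ∀ u q, w q * w (u + q)
      = Real.exp (-a * ‖u‖ ^ 2) * Real.exp (-(4 * a) * ‖q + (2⁻¹ : ℝ) • u‖ ^ 2) := by
    intro u q
    simp only [w]
    rw [← Real.exp_add, ← Real.exp_add, norm_add_sq_real, norm_add_sq_real, norm_smul,
      inner_smul_right, real_inner_comm q u, mul_pow, norm_inv, Real.norm_ofNat]
    congr 1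
    ring
  let K : ℝ := ∫ q : V, Real.exp (-(4 * a) * ‖q‖ ^ 2)
  have hK : 0 < K := by
    simp only [K]
    rw [GaussianFourier.integral_rexp_neg_mul_sq_norm (by positivity)]
    positivity
  have hshift : ∀ u : V, ∫ q : V, Real.exp (-(4 * a) * ‖q + (2⁻¹ : ℝ) • u‖ ^ 2) = K := fun u =>
    integral_add_right_eq_self (fun q : V => Real.exp (-(4 * a) * ‖q‖ ^ 2)) ((2⁻¹ : ℝ) • u)
  have hprod : Integrable (fun z : V × V => χ z.2 * ((w z.1 * w (z.2 + z.1) : ℝ) : ℂ) * f z.2)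
      (volume.prod volume) := by
    have hb := (integrable_gaussian (V := V) ha).mul_prod
      (integrable_gaussian (V := V) (by positivity : 0 < a / 2))
    refine hb.mono' (Continuous.aestronglyMeasurable (by fun_prop))
      (Filter.Eventually.of_forall fun z => ?_)
    obtain ⟨q, u⟩ := z
    rw [norm_mul, norm_mul, hχn, one_mul, Complex.norm_real, Real.norm_eq_abs]
    refine (mul_le_of_le_one_right (abs_nonneg _) (norm_le_of_gram hf h0 u)).trans ?_
    simp only [w]
    rw [← Real.exp_add, ← Real.exp_add, Real.abs_exp]
    refine Real.exp_le_exp.mpr ?_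
    have h1 : ‖u‖ ≤ ‖u + q‖ + ‖q‖ := by simpa using norm_sub_le (u + q) q
    have h2 : ‖u‖ ^ 2 ≤ (‖u + q‖ + ‖q‖) ^ 2 := pow_le_pow_left₀ (norm_nonneg _) h1 2
    have h3 : ‖u‖ ^ 2 ≤ 2 * ‖u + q‖ ^ 2 + 2 * ‖q‖ ^ 2 := by
      nlinarith [sq_nonneg (‖u + q‖ - ‖q‖)]
    nlinarith [mul_le_mul_of_nonneg_left h3 ha.le, sq_nonneg ‖u + q‖,
      mul_nonneg ha.le (sq_nonneg ‖u + q‖)]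
  have key : ((‖∫ p, (χ p * w p) • ξ p‖ ^ 2 : ℝ) : ℂ)
      = (K : ℂ) * 𝓕 (fun p : V => (Real.exp (-a * ‖p‖ ^ 2) : ℂ) * f p) v := by
    have h1 := inner_self_eq_norm_sq_to_K (𝕜 := ℂ) (∫ p, (χ p * w p) • ξ p)
    rw [Complex.ofReal_pow]
    refine h1.symm.trans ?_
    rw [inner_integral_integral hint hint]
    calc _ = ∫ q : V, ∫ u : V, χ u * ((w q * w (u + q) : ℝ) : ℂ) * f u := by
          refine integral_congr_ae (Filter.Eventually.of_forall fun q => ?_)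
          simp only
          rw [← integral_add_right_eq_self _ q]
          refine integral_congr_ae (Filter.Eventually.of_forall fun u => ?_)
          simp only
          rw [inner_smul_left, inner_smul_right, hf, add_sub_cancel_right, map_mul,
            Complex.conj_ofReal, ← hχadd u q]
          push_cast
          ring
      _ = ∫ u : V, ∫ q : V, χ u * ((w q * w (u + q) : ℝ) : ℂ) * f u := integral_integral_swap hprod
      _ = ∫ u : V, (K : ℂ) * (χ u * ((Real.exp (-a * ‖u‖ ^ 2) : ℂ) * f u)) := by
          refine integral_congr_ae (Filter.Eventually.of_forall fun u => ?_)
          simp only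
          simp_rw [hww]
          rw [integral_mul_const, integral_const_mul, integral_complex_ofReal, integral_const_mul,
            hshift]
          push_cast
          ring
      _ = _ := by
          rw [integral_const_mul, Real.fourier_eq']
          rfl
  have h2 : 𝓕 (fun p : V => (Real.exp (-a * ‖p‖ ^ 2) : ℂ) * f p) v
      = ((K⁻¹ * ‖∫ p, (χ p * w p) • ξ p‖ ^ 2 : ℝ) : ℂ) := by
    rw [Complex.ofReal_mul, key, Complex.ofReal_inv, inv_mul_cancel_left₀]
    exact_mod_cast hK.ne'
  rw [h2]
  exact Complex.zero_le_real.mpr (by positivity)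

/-- Bochner's theorem for a normalised Gram kernel damped by a Gaussian, up to the factor `2π` between
the conventions for the Fourier transform and the characteristic function. The measure is the limit
of those with densities `𝓕 g` times wide Gaussians; their characteristic functions are convolutions
of `g` with narrow Gaussians. -/
theorem exists_charFun_eq_gaussian_mul [CompleteSpace H] (hξ : Continuous ξ)
    (hf : ∀ p q, ⟪ξ q, ξ p⟫_ℂ = f (p - q)) (h0 : f 0 = 1) {a : ℝ} (ha : 0 < a) :
    ∃ μ : Measure V, IsProbabilityMeasure μ ∧ ∀ t, charFun μ t
      = (Real.exp (-a * ‖(2 * π)⁻¹ • t‖ ^ 2) : ℂ) * f ((2 * π)⁻¹ • t) := by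
  have hfc := continuous_of_gram hξ hf
  set g : V → ℂ := fun p => (Real.exp (-a * ‖p‖ ^ 2) : ℂ) * f p
  have hg : Integrable g := integrable_gaussian_mul hξ hf h0 ha
  have hgc : Continuous g := by fun_prop
  have hpos : ∀ v, 0 ≤ 𝓕 g v := fourier_gaussian_gram_nonneg hξ hf h0 ha
  have hre : ∀ v, 𝓕 g v = (((𝓕 g v).re : ℝ) : ℂ) := fun v =>
    Complex.ext rfl (Complex.nonneg_iff.mp (hpos v)).2.symm
  have hFc : Continuous (𝓕 g) :=
    VectorFourier.fourierIntegral_continuous Real.continuous_fourierChar continuous_inner hg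
  let D : ℕ → V → ℝ := fun n v => Real.exp (-(n + 1 : ℝ)⁻¹ * ‖v‖ ^ 2) * (𝓕 g v).re
  have hD : ∀ n v, 0 ≤ D n v := fun n v =>
    mul_nonneg (Real.exp_pos _).le (Complex.nonneg_iff.mp (hpos v)).1
  have hDc : ∀ n, Continuous (D n) := fun n => by
    have := Complex.continuous_re.comp hFc
    simp only [D]
    fun_prop
  have hDint : ∀ n, Integrable (D n) := fun n => by
    refine ((integrable_gaussian (V := V) (by positivity : 0 < (n + 1 : ℝ)⁻¹)).mul_const
      (∫ p, ‖g p‖)).mono' (hDc n).aestronglyMeasurable (Filter.Eventually.of_forall fun v => ?_)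
    rw [norm_mul, Real.norm_eq_abs, Real.abs_exp]
    refine mul_le_mul_of_nonneg_left ?_ (Real.exp_pos _).le
    refine (Complex.abs_re_le_norm _).trans ?_
    rw [Real.fourier_eq']
    refine (norm_integral_le_integral_norm _).trans (le_of_eq ?_)
    refine integral_congr_ae (Filter.Eventually.of_forall fun p => ?_)
    simp only
    rw [norm_smul, Complex.norm_exp_ofReal_mul_I, one_mul]
  let ν : ℕ → Measure V := fun n => volume.withDensity fun v => ENNReal.ofReal (D n v)
  have hfin : ∀ n, IsFiniteMeasure (ν n) := fun n =>
    isFiniteMeasure_withDensity_ofReal (hDint n).2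
  refine exists_charFun_eq_of_tendsto (ν := ν) (Continuous.continuousAt (by fun_prop))
    (by simp [h0]) fun t => ?_
  have h1 := (Real.tendsto_integral_gaussian_smul' hg (v := (2 * π)⁻¹ • t)
    hgc.continuousAt).comp (tendsto_natCast_atTop_atTop.comp (Filter.tendsto_add_atTop_nat 1))
  refine h1.congr fun n => ?_
  have hn : (0 : ℝ) < (n + 1 : ℕ) := by positivity
  simp only [Function.comp_apply]
  have hJ : Integrable (fun w : V => Complex.exp (-((((n + 1 : ℕ) : ℝ) : ℂ))⁻¹ * ‖w‖ ^ 2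
      + 2 * π * Complex.I * ⟪(2 * π)⁻¹ • t, w⟫)) :=
    GaussianFourier.integrable_cexp_neg_mul_sq_norm_add (by
      rw [← Complex.ofReal_inv, Complex.ofReal_re]; positivity) _ _
  have h2 := VectorFourier.integral_fourierIntegral_smul_eq_flip (L := innerₗ V)
      Real.continuous_fourierChar continuous_inner hJ hg
  have h3 : charFun (ν n) t = ∫ w : V, Complex.exp (-((((n + 1 : ℕ) : ℝ) : ℂ))⁻¹ * ‖w‖ ^ 2
      + 2 * π * Complex.I * ⟪(2 * π)⁻¹ • t, w⟫) • 𝓕 g w := by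
    rw [charFun_apply, integral_withDensity_eq_integral_toReal_smul₀
      (hDc n).measurable.ennreal_ofReal.aemeasurable
      (Filter.Eventually.of_forall fun v => ENNReal.ofReal_lt_top)]
    refine integral_congr_ae (Filter.Eventually.of_forall fun v => ?_)
    simp only
    rw [ENNReal.toReal_ofReal (hD n v), hre v, Complex.real_smul, Complex.exp_add, inner_smul_left,
      real_inner_comm]
    simp only [D]
    rw [Complex.ofReal_mul, Complex.ofReal_exp, smul_eq_mul, mul_right_comm]
    congr 3
    · push_cast
      ring
    · rw [conj_trivial]
      push_cast
      field_simp
  rw [h3]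
  refine Eq.trans ?_ (Eq.trans h2 ?_)
  · refine integral_congr_ae (Filter.Eventually.of_forall fun w => ?_)
    have h4 := fourier_gaussian_innerProductSpace' (b := ((((n + 1 : ℕ) : ℝ)⁻¹ : ℝ) : ℂ))
      (by rw [Complex.ofReal_re]; positivity) ((2 * π)⁻¹ • t) w
    rw [Complex.ofReal_inv, div_inv_eq_mul, div_inv_eq_mul] at h4
    simp only
    rw [mul_right_comm (-(π : ℂ) ^ 2)] at h4
    exact congrArg (fun z => z • g w) h4.symm
  · rw [flip_innerₗ]
    rfl

/-- **Bochner's theorem** for kernels in Gram form: if `f (p - q) = ⟪ξ q, ξ p⟫` for a continuous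
family of vectors, then `f` is the characteristic function of a finite measure. -/
theorem exists_charFun_eq_of_gram [CompleteSpace H] (hξ : Continuous ξ)
    (hf : ∀ p q, ⟪ξ q, ξ p⟫_ℂ = f (p - q)) :
    ∃ μ : Measure V, IsFiniteMeasure μ ∧ ∀ t, charFun μ t = f t := by
  have hfc := continuous_of_gram hξ hf
  by_cases hz : ξ 0 = 0
  · refine ⟨0, inferInstance, fun t => ?_⟩
    rw [charFun_zero_measure, ← sub_zero t, ← hf, hz, inner_zero_left]
  have hn : ‖ξ 0‖ ≠ 0 := norm_ne_zero_iff.mpr hz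
  have hf0 : f 0 = (‖ξ 0‖ : ℂ) ^ 2 := by
    have h := hf 0 0
    rw [sub_zero] at h
    rw [← h]
    exact inner_self_eq_norm_sq_to_K (𝕜 := ℂ) (ξ 0)
  set m : ℝ := ‖ξ 0‖
  have hmc : (m : ℂ) ≠ 0 := by exact_mod_cast hn
  -- normalise, and rescale the argument by `2π`
  let f' : V → ℂ := fun p => ((m⁻¹ ^ 2 : ℝ) : ℂ) * f ((2 * π) • p)
  have hf' : ∀ p q, ⟪((m⁻¹ : ℝ) : ℂ) • ξ ((2 * π) • q), ((m⁻¹ : ℝ) : ℂ) • ξ ((2 * π) • p)⟫_ℂ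
      = f' (p - q) := by
    intro p q
    rw [inner_smul_left, inner_smul_right, hf, Complex.conj_ofReal, ← smul_sub]
    simp only [f']
    push_cast
    ring
  have hξ' : Continuous fun p => ((m⁻¹ : ℝ) : ℂ) • ξ ((2 * π) • p) := by fun_prop
  have h0 : f' 0 = 1 := by
    simp only [f', smul_zero, hf0]
    push_cast
    field_simp
  have hback : ∀ t : V, f' ((2 * π)⁻¹ • t) = ((m⁻¹ ^ 2 : ℝ) : ℂ) * f t := by
    intro t
    simp only [f']
    rw [smul_inv_smul₀ (by positivity)]
  choose μ hμ hμf using fun n : ℕ => exists_charFun_eq_gaussian_mul hξ' hf' h0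
    (by positivity : 0 < (n + 1 : ℝ)⁻¹)
  obtain ⟨μ', hμ', hμ'f⟩ := exists_charFun_eq_of_tendsto (ν := μ)
    (f := fun t => ((m⁻¹ ^ 2 : ℝ) : ℂ) * f t) (Continuous.continuousAt (by fun_prop))
    (by simpa using (hback 0).symm.trans (by rw [smul_zero, h0])) (fun t => by
      simp_rw [hμf, hback]
      have h1 : Filter.Tendsto (fun n : ℕ =>
          Real.exp (-(n + 1 : ℝ)⁻¹ * ‖(2 * π)⁻¹ • t‖ ^ 2)) Filter.atTop
          (nhds (Real.exp (-0 * ‖(2 * π)⁻¹ • t‖ ^ 2))) := by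
        refine (Real.continuous_exp.tendsto _).comp (Filter.Tendsto.mul_const _ ?_)
        refine Filter.Tendsto.neg ?_
        simpa using tendsto_one_div_add_atTop_nhds_zero_nat (𝕜 := ℝ)
      rw [neg_zero, zero_mul, Real.exp_zero] at h1
      have h2 := ((Complex.continuous_ofReal.tendsto _).comp h1).mul_const
        (((m⁻¹ ^ 2 : ℝ) : ℂ) * f t)
      simpa using h2)
  refine ⟨ENNReal.ofReal (m ^ 2) • μ', Measure.smul_finite _ ENNReal.ofReal_ne_top, fun t => ?_⟩
  have h3 := hμ'f t
  rw [charFun_apply] at h3 ⊢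
  rw [integral_smul_measure, h3, ENNReal.toReal_ofReal (by positivity), Complex.real_smul]
  push_cast
  field_simp

end Bochner

/-! ### Measures on `ℝ^M` and their Fourier transforms -/

/-- The character `x ↦ e^{i pᵀ x}`. -/
noncomputable def expChar {M : ℕ} (p x : Fin M → ℝ) : ℂ :=
  Complex.exp (Complex.I * ((p ⬝ᵥ x : ℝ) : ℂ))

theorem norm_expChar {M : ℕ} (p x : Fin M → ℝ) : ‖expChar p x‖ = 1 := by
  rw [expChar, mul_comm, Complex.norm_exp_ofReal_mul_I]

theorem continuous_expChar {M : ℕ} (p : Fin M → ℝ) : Continuous (expChar p) := by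
  unfold expChar dotProduct
  fun_prop

theorem integrable_expChar {M : ℕ} (p : Fin M → ℝ) (μ : Measure (Fin M → ℝ)) [IsFiniteMeasure μ] :
    Integrable (expChar p) μ :=
  (integrable_const (1 : ℝ)).mono' (continuous_expChar p).aestronglyMeasurable
    (Filter.Eventually.of_forall fun x => (norm_expChar p x).le)

theorem measure_ext_of_expChar {M : ℕ} {μ ν : Measure (Fin M → ℝ)} [IsFiniteMeasure μ]
    [IsFiniteMeasure ν] (h : ∀ p, ∫ x, expChar p x ∂μ = ∫ x, expChar p x ∂ν) : μ = ν := by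
  refine Measure.ext_of_charFunDual (funext fun L => ?_)
  have hL : ∀ x, Complex.exp ((L x : ℂ) * Complex.I) = expChar (fun j => L (Pi.single j 1)) x := by
    intro x
    rw [expChar, mul_comm]
    congr 3
    conv_lhs => rw [pi_eq_sum_univ' x]
    simp only [map_sum, map_smul, smul_eq_mul, dotProduct]
    exact Finset.sum_congr rfl fun j _ => mul_comm _ _
  rw [charFunDual_apply, charFunDual_apply]
  simp_rw [hL]
  exact h _

theorem exists_measure_of_gram {M : ℕ} {H : Type*} [NormedAddCommGroup H] [InnerProductSpace ℂ H]
    [CompleteSpace H] {ξ : (Fin M → ℝ) → H} {f : (Fin M → ℝ) → ℂ} (hξ : Continuous ξ)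
    (hf : ∀ p q, ⟪ξ q, ξ p⟫_ℂ = f (p - q)) :
    ∃ μ : Measure (Fin M → ℝ), IsFiniteMeasure μ ∧ ∀ p, ∫ x, expChar p x ∂μ = f p := by
  obtain ⟨μ, hμ, hμf⟩ := exists_charFun_eq_of_gram (V := EuclideanSpace ℝ (Fin M))
    (ξ := fun p => ξ p.ofLp) (f := fun p => f p.ofLp) (by fun_prop) (fun p q => hf _ _)
  refine ⟨μ.map (fun x => x.ofLp), inferInstance, fun p => ?_⟩
  rw [integral_map (by fun_prop) (continuous_expChar p).aestronglyMeasurable,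
    ← WithLp.ofLp_toLp 2 p, ← hμf, charFun_apply]
  refine integral_congr_ae (Filter.Eventually.of_forall fun x => ?_)
  simp only [expChar]
  rw [mul_comm, EuclideanSpace.inner_eq_star_dotProduct]
  simp

/-- Every real linear relation between the quadratic forms `⟪ψ_i, T ψ_i⟫` is inherited by measures
whose Fourier transforms are such quadratic forms: the combinations with the positive parts and with
the negative parts of the coefficients are finite measures with equal Fourier transforms. -/
theorem sum_measureReal_eq_zero {M : ℕ} {H : Type*} [NormedAddCommGroup H] [InnerProductSpace ℂ H]
    {F : (Fin M → ℝ) → Op H} {μ : H → Measure (Fin M → ℝ)} [∀ ψ, IsFiniteMeasure (μ ψ)]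
    (hμ : ∀ ψ p, ∫ x, expChar p x ∂(μ ψ) = ⟪ψ, F p ψ⟫_ℂ) {ι : Type*} [Fintype ι]
    (a : ι → ℝ) (ψ : ι → H) (h : ∀ T : Op H, ∑ i, (a i : ℂ) * ⟪ψ i, T (ψ i)⟫_ℂ = 0)
    (X : Set (Fin M → ℝ)) : ∑ i, a i * (μ (ψ i)).real X = 0 := by
  let ν : (ι → ℝ) → Measure (Fin M → ℝ) := fun b => ∑ i, ENNReal.ofReal (b i) • μ (ψ i)
  have hsm : ∀ (b : ι → ℝ) i, IsFiniteMeasure (ENNReal.ofReal (b i) • μ (ψ i)) := fun b i =>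
    Measure.smul_finite _ ENNReal.ofReal_ne_top
  have hν : ∀ b, IsFiniteMeasure (ν b) := fun b => inferInstance
  have hνint : ∀ b : ι → ℝ, (∀ i, 0 ≤ b i) → ∀ p,
      ∫ x, expChar p x ∂(ν b) = ∑ i, (b i : ℂ) * ⟪ψ i, F p (ψ i)⟫_ℂ := by
    intro b hb p
    rw [integral_finsetSum_measure fun i _ => integrable_expChar p _]
    refine Finset.sum_congr rfl fun i _ => ?_
    rw [integral_smul_measure, hμ, ENNReal.toReal_ofReal (hb i), Complex.real_smul]
  have hνreal : ∀ b : ι → ℝ, (∀ i, 0 ≤ b i) → (ν b).real X = ∑ i, b i * (μ (ψ i)).real X := by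
    intro b hb
    simp only [ν, measureReal_def, Measure.coe_finsetSum, Finset.sum_apply, Measure.smul_apply,
      smul_eq_mul]
    rw [ENNReal.toReal_sum fun i _ => ENNReal.mul_ne_top ENNReal.ofReal_ne_top (measure_ne_top _ _)]
    refine Finset.sum_congr rfl fun i _ => ?_
    rw [ENNReal.toReal_mul, ENNReal.toReal_ofReal (hb i)]
  have heq : ν (fun i => (a i)⁺) = ν (fun i => (a i)⁻) := by
    refine measure_ext_of_expChar fun p => ?_
    rw [hνint _ fun i => posPart_nonneg _, hνint _ fun i => negPart_nonneg _, ← sub_eq_zero,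
      ← Finset.sum_sub_distrib, ← h (F p)]
    refine Finset.sum_congr rfl fun i _ => ?_
    rw [← sub_mul, ← Complex.ofReal_sub, posPart_sub_negPart]
  have h1 : (ν fun i => (a i)⁺).real X = (ν fun i => (a i)⁻).real X := by rw [heq]
  rw [hνreal _ fun i => posPart_nonneg _, hνreal _ fun i => negPart_nonneg _, ← sub_eq_zero,
    ← Finset.sum_sub_distrib] at h1
  rw [← h1]
  refine Finset.sum_congr rfl fun i _ => ?_
  rw [← sub_mul, posPart_sub_negPart]

/-- Complex linear relations are inherited too, because the adjoint relation holds as well. -/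
theorem sum_measureReal_eq_zero' {M : ℕ} {H : Type*} [NormedAddCommGroup H] [InnerProductSpace ℂ H]
    [CompleteSpace H]
    {F : (Fin M → ℝ) → Op H} {μ : H → Measure (Fin M → ℝ)} [∀ ψ, IsFiniteMeasure (μ ψ)]
    (hμ : ∀ ψ p, ∫ x, expChar p x ∂(μ ψ) = ⟪ψ, F p ψ⟫_ℂ) {ι : Type*} [Fintype ι]
    (a : ι → ℂ) (ψ : ι → H) (h : ∀ T : Op H, ∑ i, a i * ⟪ψ i, T (ψ i)⟫_ℂ = 0)
    (X : Set (Fin M → ℝ)) : ∑ i, a i * ((μ (ψ i)).real X : ℂ) = 0 := by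
  have hconj : ∀ T : Op H, ∑ i, (starRingEnd ℂ) (a i) * ⟪ψ i, T (ψ i)⟫_ℂ = 0 := by
    intro T
    have h1 := congrArg (starRingEnd ℂ) (h (ContinuousLinearMap.adjoint T))
    simpa [map_sum, ContinuousLinearMap.adjoint_inner_right] using h1
  have hre := sum_measureReal_eq_zero hμ (fun i => (a i).re) ψ (fun T => by
    have h1 := congrArg₂ (fun x y : ℂ => (x + y) / 2) (h T) (hconj T)
    simp only [← Finset.sum_add_distrib, Finset.sum_div, add_zero, zero_div] at h1
    rw [← h1]
    refine Finset.sum_congr rfl fun i _ => ?_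
    rw [Complex.re_eq_add_conj]
    ring) X
  have him := sum_measureReal_eq_zero hμ (fun i => (a i).im) ψ (fun T => by
    have h1 := congrArg₂ (fun x y : ℂ => (x - y) / (2 * Complex.I)) (h T) (hconj T)
    simp only [← Finset.sum_sub_distrib, Finset.sum_div, sub_zero, zero_div] at h1
    rw [← h1]
    refine Finset.sum_congr rfl fun i _ => ?_
    rw [Complex.im_eq_sub_conj]
    ring) X
  apply Complex.ext
  · simpa [Complex.re_sum] using hre
  · simpa [Complex.im_sum] using him

/-! ### From measures to observables -/

/-- An observable from its outcome measures: a family of finite measures, one for each vector,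
whose Fourier transforms are the diagonal matrix elements of operators `F p` with `F 0 = 1`. The
effects are obtained by polarization; sesquilinearity holds because the relations between the
quadratic forms are visible on the Fourier side. -/
theorem exists_observable_of_measure {N M : ℕ} {F : (Fin M → ℝ) → Op (Hil N)}
    {μ : Hil N → Measure (Fin M → ℝ)} [∀ ψ, IsFiniteMeasure (μ ψ)]
    (hμ : ∀ ψ p, ∫ x, expChar p x ∂(μ ψ) = ⟪ψ, F p ψ⟫_ℂ) (hF0 : F 0 = 1) :
    ∃ E : QObservable N M, ∀ ψ, E.outcome ψ = μ ψ := by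
  classical
  have huniv : ∀ ψ, ((μ ψ).real Set.univ : ℂ) = ⟪ψ, ψ⟫_ℂ := by
    intro ψ
    have h := hμ ψ 0
    rw [hF0] at h
    simpa [expChar] using h
  have hle : ∀ ψ X, (μ ψ).real X ≤ ‖ψ‖ ^ 2 := by
    intro ψ X
    have h1 : (μ ψ).real Set.univ = ‖ψ‖ ^ 2 := Complex.ofReal_injective (by
      rw [huniv, Complex.ofReal_pow]
      exact inner_self_eq_norm_sq_to_K (𝕜 := ℂ) ψ)
    rw [← h1]
    exact measureReal_mono (Set.subset_univ X)
  -- the sesquilinear form of the effect of `X`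
  let s : Set (Fin M → ℝ) → Hil N → Hil N → ℂ := fun X φ ψ =>
    (1 / 4 : ℂ) * (((μ (φ + ψ)).real X : ℂ) - ((μ (φ - ψ)).real X : ℂ)
      - Complex.I * ((μ (φ + Complex.I • ψ)).real X : ℂ)
      + Complex.I * ((μ (φ - Complex.I • ψ)).real X : ℂ))
  have hIsq : Complex.I * Complex.I = -1 := Complex.I_mul_I
  have hadd : ∀ X φ ψ ψ', s X φ (ψ + ψ') = s X φ ψ + s X φ ψ' := by
    intro X φ ψ ψ'
    have h := sum_measureReal_eq_zero' hμ
      (![1, -1, -Complex.I, Complex.I, -1, 1, Complex.I, -Complex.I, -1, 1, Complex.I, -Complex.I])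
      (![φ + (ψ + ψ'), φ - (ψ + ψ'), φ + Complex.I • (ψ + ψ'), φ - Complex.I • (ψ + ψ'),
        φ + ψ, φ - ψ, φ + Complex.I • ψ, φ - Complex.I • ψ,
        φ + ψ', φ - ψ', φ + Complex.I • ψ', φ - Complex.I • ψ']) (fun T => by
        simp only [Fin.sum_univ_succ, Fin.sum_univ_zero, Matrix.cons_val_zero,
          Matrix.cons_val_succ, map_add, map_sub, map_smul, inner_add_left, inner_add_right,
          inner_sub_left, inner_sub_right, inner_smul_left, inner_smul_right, Complex.conj_I]
        ring_nf) X
    simp only [Fin.sum_univ_succ, Fin.sum_univ_zero, Matrix.cons_val_zero,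
          Matrix.cons_val_succ] at h
    simp only [s]
    linear_combination (1 / 4 : ℂ) * h
  have hsmul : ∀ X (c : ℂ) φ ψ, s X φ (c • ψ) = c * s X φ ψ := by
    intro X c φ ψ
    have h := sum_measureReal_eq_zero' hμ
      (![1, -1, -Complex.I, Complex.I, -c, c, c * Complex.I, -(c * Complex.I)])
      (![φ + c • ψ, φ - c • ψ, φ + Complex.I • (c • ψ), φ - Complex.I • (c • ψ),
        φ + ψ, φ - ψ, φ + Complex.I • ψ, φ - Complex.I • ψ]) (fun T => by
        simp only [Fin.sum_univ_succ, Fin.sum_univ_zero, Matrix.cons_val_zero,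
          Matrix.cons_val_succ, map_add, map_sub, map_smul, inner_add_left, inner_add_right,
          inner_sub_left, inner_sub_right, inner_smul_left, inner_smul_right, Complex.conj_I]
        ring_nf
        simp only [Complex.I_sq]
        ring) X
    simp only [Fin.sum_univ_succ, Fin.sum_univ_zero, Matrix.cons_val_zero,
          Matrix.cons_val_succ] at h
    simp only [s]
    linear_combination (1 / 4 : ℂ) * h
  have hsymm : ∀ X φ ψ, s X φ ψ = (starRingEnd ℂ) (s X ψ φ) := by
    intro X φ ψ
    have h := sum_measureReal_eq_zero' hμ
      (![1, -1, -Complex.I, Complex.I, -1, 1, -Complex.I, Complex.I])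
      (![φ + ψ, φ - ψ, φ + Complex.I • ψ, φ - Complex.I • ψ,
        ψ + φ, ψ - φ, ψ + Complex.I • φ, ψ - Complex.I • φ]) (fun T => by
        simp only [Fin.sum_univ_succ, Fin.sum_univ_zero, Matrix.cons_val_zero,
          Matrix.cons_val_succ, map_add, map_sub, map_smul, inner_add_left, inner_add_right,
          inner_sub_left, inner_sub_right, inner_smul_left, inner_smul_right, Complex.conj_I]
        ring_nf) X
    simp only [Fin.sum_univ_succ, Fin.sum_univ_zero, Matrix.cons_val_zero,
          Matrix.cons_val_succ] at h
    simp only [s, map_mul, map_add, map_sub, Complex.conj_ofReal, Complex.conj_I, map_div₀, map_one,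
      map_ofNat]
    linear_combination (1 / 4 : ℂ) * h
  have hdiag : ∀ X ψ, s X ψ ψ = ((μ ψ).real X : ℂ) := by
    intro X ψ
    have h := sum_measureReal_eq_zero' hμ
      (![1, -1, -Complex.I, Complex.I, -4])
      (![ψ + ψ, ψ - ψ, ψ + Complex.I • ψ, ψ - Complex.I • ψ, ψ]) (fun T => by
        simp only [Fin.sum_univ_succ, Fin.sum_univ_zero, Matrix.cons_val_zero,
          Matrix.cons_val_succ, map_add, map_sub, map_smul, inner_add_left, inner_add_right,
          inner_sub_left, inner_sub_right, inner_smul_left, inner_smul_right, Complex.conj_I]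
        ring_nf) X
    simp only [Fin.sum_univ_succ, Fin.sum_univ_zero, Matrix.cons_val_zero,
          Matrix.cons_val_succ] at h
    simp only [s]
    linear_combination (1 / 4 : ℂ) * h
  have hbound₁ : ∀ X φ ψ, ‖φ‖ ≤ 1 → ‖ψ‖ ≤ 1 → ‖s X φ ψ‖ ≤ 4 := by
    intro X φ ψ hφ hψ
    have h1 : ∀ χ : Hil N, ‖χ‖ ≤ 1 + 1 → ‖((μ χ).real X : ℂ)‖ ≤ 4 := by
      intro χ hχ
      rw [Complex.norm_real, Real.norm_of_nonneg measureReal_nonneg]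
      exact (hle χ X).trans (by nlinarith [norm_nonneg χ])
    have hIψ : ‖Complex.I • ψ‖ ≤ 1 := by rwa [norm_smul, Complex.norm_I, one_mul]
    have e1 := h1 _ ((norm_add_le φ ψ).trans (add_le_add hφ hψ))
    have e2 := h1 _ ((norm_sub_le φ ψ).trans (add_le_add hφ hψ))
    have e3 := h1 _ ((norm_add_le φ _).trans (add_le_add hφ hIψ))
    have e4 := h1 _ ((norm_sub_le φ _).trans (add_le_add hφ hIψ))
    simp only [s]
    rw [norm_mul]
    have h4 : ‖(1 / 4 : ℂ)‖ = 1 / 4 := by simp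
    rw [h4]
    refine (mul_le_mul_of_nonneg_left (norm_add_le _ _) (by norm_num)).trans ?_
    rw [norm_mul, Complex.norm_I, one_mul]
    have h5 := norm_sub_le (((μ (φ + ψ)).real X : ℂ) - ((μ (φ - ψ)).real X : ℂ))
      (Complex.I * ((μ (φ + Complex.I • ψ)).real X : ℂ))
    rw [norm_mul, Complex.norm_I, one_mul] at h5
    have h6 := norm_sub_le ((μ (φ + ψ)).real X : ℂ) ((μ (φ - ψ)).real X : ℂ)
    linarith
  have hbound : ∀ X φ ψ, ‖s X φ ψ‖ ≤ 4 * ‖φ‖ * ‖ψ‖ := by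
    intro X φ ψ
    have hn : ∀ χ : Hil N, ∃ χ' : Hil N, ‖χ'‖ ≤ 1 ∧ χ = (‖χ‖ : ℂ) • χ' := by
      intro χ
      by_cases hχ : χ = 0
      · exact ⟨0, by simp, by simp [hχ]⟩
      · have h0 : (‖χ‖ : ℂ) ≠ 0 := by exact_mod_cast norm_ne_zero_iff.mpr hχ
        refine ⟨(‖χ‖ : ℂ)⁻¹ • χ, ?_, by rw [smul_inv_smul₀ h0]⟩
        rw [norm_smul, norm_inv, Complex.norm_real, norm_norm,
          inv_mul_cancel₀ (norm_ne_zero_iff.mpr hχ)]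
    obtain ⟨φ', hφ', hφe⟩ := hn φ
    obtain ⟨ψ', hψ', hψe⟩ := hn ψ
    have h1 : s X φ ψ = (‖φ‖ : ℂ) * (‖ψ‖ : ℂ) * s X φ' ψ' := by
      conv_lhs => rw [hφe, hψe]
      rw [hsmul X, hsymm X, hsmul X, map_mul, ← hsymm X, Complex.conj_ofReal]
      ring
    rw [h1, norm_mul, norm_mul, Complex.norm_real, Complex.norm_real, norm_norm, norm_norm]
    have h2 := hbound₁ X φ' ψ' hφ' hψ'
    have h3 := mul_le_mul_of_nonneg_left h2 (mul_nonneg (norm_nonneg φ) (norm_nonneg ψ))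
    linarith
  have hop : ∀ X, ∃ T : Op (Hil N), ∀ ψ, ⟪T ψ, ψ⟫_ℂ = ((μ ψ).real X : ℂ) := by
    intro X
    let L : Hil N →ₗ⋆[ℂ] Hil N →ₗ[ℂ] ℂ := LinearMap.mk₂'ₛₗ (starRingEnd ℂ) (RingHom.id ℂ) (s X)
      (fun φ φ' ψ => by rw [hsymm X, hadd X, map_add, ← hsymm X, ← hsymm X])
      (fun c φ ψ => by rw [hsymm X, hsmul X, map_mul, ← hsymm X, smul_eq_mul])
      (fun φ ψ ψ' => hadd X φ ψ ψ')
      (fun c φ ψ => by rw [hsmul X, RingHom.id_apply, smul_eq_mul])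
    let L' := LinearMap.mkContinuous₂ L 4 (fun φ ψ => hbound X φ ψ)
    refine ⟨InnerProductSpace.continuousLinearMapOfBilin L', fun ψ => ?_⟩
    rw [InnerProductSpace.continuousLinearMapOfBilin_apply]
    exact hdiag X ψ
  choose T hT using hop
  have hT' : ∀ X ψ, ⟪ψ, T X ψ⟫_ℂ = ((μ ψ).real X : ℂ) := by
    intro X ψ
    rw [← inner_conj_symm, hT X, Complex.conj_ofReal]
  let E : QObservable N M :=
    { effect := T
      nonneg := fun X _ => by
        rw [ContinuousLinearMap.isPositive_iff_complex]
        intro ψ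
        rw [hT X]
        exact ⟨by simp, by simp [measureReal_nonneg]⟩
      univ := by
        have h : (T Set.univ).toLinearMap = (1 : Op (Hil N)).toLinearMap := by
          rw [← ext_inner_map]
          intro ψ
          exact (hT _ ψ).trans (huniv ψ)
        exact ContinuousLinearMap.coe_injective h
      sigmaAdditive := by
        intro X hX hd ψ
        rw [hT' _]
        simp_rw [hT']
        rw [Complex.hasSum_ofReal, measureReal_def, measure_iUnion hd hX]
        rw [ENNReal.tsum_toReal_eq fun i => measure_ne_top _ _]
        refine ENNReal.hasSum_toReal ?_
        rw [← measure_iUnion hd hX]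
        exact measure_ne_top _ _ }
  refine ⟨E, fun ψ => Measure.ext fun X hX => ?_⟩
  have h1 : ⟪ψ, E.effect X ψ⟫_ℂ = ((μ ψ).real X : ℂ) := hT' X ψ
  rw [E.outcome_apply ψ hX, h1, Complex.ofReal_re, measureReal_def,
    ENNReal.ofReal_toReal (measure_ne_top _ _)]

/-! ### Existence of Gaussian observables -/

/-- The vacuum: the normalised Gaussian vector with `a = 1`. -/
theorem exists_vacuum (M : ℕ) :
    ∃ φ : Hil M, ∀ x, ⟪φ, weyl x φ⟫_ℂ = Complex.exp (-(1 / 4 : ℂ) * ((x ⬝ᵥ x : ℝ) : ℂ)) := by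
  set g := gaussVec M one_pos
  set κ := ⟪g, weyl 0 g⟫_ℂ
  have hg : ∀ x, ⟪g, weyl x g⟫_ℂ = κ * Complex.exp (-(1 / 4 : ℂ) * ((x ⬝ᵥ x : ℝ) : ℂ)) := by
    intro x
    have h0 : κ = (Real.pi / (1 : ℝ) : ℂ) ^ (M / 2 : ℂ) := by
      have h := inner_gaussVec_weyl M one_pos (0 : Mode M → ℝ)
      simpa [pos, mom] using h
    rw [h0, inner_gaussVec_weyl, dotProduct_eq_pos_mom]
    congr 2
    simp only [dotProduct, Complex.ofReal_add, Complex.ofReal_sum, Complex.ofReal_one,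
      ← sq, Complex.ofReal_pow]
    ring
  have hκ : κ = (‖g‖ : ℂ) ^ 2 := by
    simp only [κ, weyl_zero]
    exact inner_self_eq_norm_sq_to_K (𝕜 := ℂ) g
  have hκ0 : (‖g‖ : ℂ) ≠ 0 := by
    intro h
    have h0 := inner_gaussVec_weyl M one_pos (0 : Mode M → ℝ)
    have h1 : κ = 0 := by rw [hκ, h]; simp
    have h2 : ((Real.pi / (1 : ℝ) : ℂ)) ≠ 0 := by simp [Real.pi_ne_zero]
    have h3 : (Real.pi / (1 : ℝ) : ℂ) ^ (M / 2 : ℂ) ≠ 0 := by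
      rw [Ne, Complex.cpow_eq_zero_iff]
      exact fun h => h2 h.1
    exact mul_ne_zero h3 (Complex.exp_ne_zero _) (h0.symm.trans h1)
  refine ⟨(‖g‖ : ℂ)⁻¹ • g, fun x => ?_⟩
  rw [map_smul, inner_smul_left, inner_smul_right, hg, hκ, map_inv₀, Complex.conj_ofReal]
  field_simp

/-- A positive semidefinite `S + i T` of size `M` is the Gram matrix of `M` complex vectors in
`ℂ^M`; in real terms these form a `2M × M` matrix `C`, with `S` the Euclidean and `T` the symplectic
Gram matrix of its columns. -/
theorem exists_gram_complexComb {M : ℕ} {S T : Matrix (Fin M) (Fin M) ℝ}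
    (h : (complexComb S T).PosSemidef) :
    ∃ C : Matrix (Mode M) (Fin M) ℝ, Cᵀ * C = S ∧ Cᵀ * Omega M * C = T := by
  obtain ⟨R, hR⟩ : ∃ R : Matrix (Fin M) (Fin M) ℂ, complexComb S T = Rᴴ * R := by
    open scoped MatrixOrder Matrix.Norms.L2Operator in
    exact CStarAlgebra.nonneg_iff_eq_star_mul_self.mp h.nonneg
  have hkl : ∀ k l, (S k l : ℂ) + Complex.I * (T k l : ℂ)
      = ∑ i, (starRingEnd ℂ) (R i k) * R i l := by
    intro k l
    have := congrFun (congrFun hR k) l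
    simpa [complexComb, Matrix.mul_apply] using this
  refine ⟨Matrix.of fun i k => if i.2 = 0 then (R i.1 k).re else (R i.1 k).im, ?_, ?_⟩
  · ext k l
    have h1 := congrArg Complex.re (hkl k l)
    simp only [Complex.add_re, Complex.ofReal_re, Complex.mul_re, Complex.I_re, zero_mul,
      Complex.I_im, Complex.ofReal_im, mul_zero, sub_zero, add_zero, Complex.re_sum,
      Complex.conj_re, Complex.conj_im] at h1
    rw [h1, Matrix.mul_apply, Fintype.sum_prod_type]
    simp [Fin.sum_univ_two]
  · ext k l
    have h1 := congrArg Complex.im (hkl k l)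
    simp only [Complex.add_im, Complex.ofReal_re, Complex.mul_im, Complex.I_re, zero_mul,
      Complex.I_im, Complex.ofReal_im, one_mul, zero_add, Complex.im_sum,
      Complex.conj_re, Complex.conj_im] at h1
    have h2 : ∀ C : Matrix (Mode M) (Fin M) ℝ, (Cᵀ * Omega M * C) k l
        = (fun i => C i k) ⬝ᵥ Omega M *ᵥ (fun i => C i l) := by
      intro C
      rw [Matrix.mul_assoc, Matrix.mul_apply]
      rfl
    rw [h1, h2, dotProduct_Omega, dotProduct, dotProduct, ← Finset.sum_sub_distrib]
    refine Finset.sum_congr rfl fun i _ => ?_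
    simp [pos, mom]
    ring

/-- Naimark dilation: the operators `W(A p) ⊗ W(C p)`, with `C` chosen so that the symplectic phases
cancel, commute, and their matrix elements in product vectors with the vacuum are the prescribed
Fourier transform. -/
theorem exists_gaussianObservable {N M : ℕ} {A : Matrix (Mode N) (Fin M) ℝ}
    {B : Matrix (Fin M) (Fin M) ℝ} (h : (complexComb B (-(Aᵀ * Omega N * A))).PosSemidef)
    (c : Fin M → ℝ) :
    ∃ E : QObservable N M, ∀ p ψ,
      ∫ x, expChar p x ∂(E.outcome ψ) = ⟪ψ, (gaussFactor B c p • weyl (A *ᵥ p)) ψ⟫_ℂ := by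
  obtain ⟨C, hCB, hCT⟩ := exists_gram_complexComb h
  obtain ⟨φ, hφ⟩ := exists_vacuum M
  have hphase : ∀ p q : Fin M → ℝ, (Sum.elim (A *ᵥ p) (C *ᵥ p))
      ⬝ᵥ bipOmega N M *ᵥ (Sum.elim (A *ᵥ q) (C *ᵥ q)) = 0 := by
    intro p q
    rw [dotProduct_bipOmega, Sum.elim_comp_inl, Sum.elim_comp_inr, Sum.elim_comp_inl,
      Sum.elim_comp_inr, ← dotProduct_congr, ← dotProduct_congr, hCT, neg_mulVec, dotProduct_neg,
      add_neg_cancel]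
  have hB : ∀ p : Fin M → ℝ, (C *ᵥ p) ⬝ᵥ (C *ᵥ p) = p ⬝ᵥ B *ᵥ p := by
    intro p
    have h1 := dotProduct_congr (1 : Matrix (Mode M) (Mode M) ℝ) C p p
    rw [Matrix.mul_one, hCB, one_mulVec] at h1
    exact h1.symm
  let ξ : Hil N → (Fin M → ℝ) → HilTensor (Hil N) (Hil M) := fun ψ p =>
    Complex.exp (-(Complex.I * ((c ⬝ᵥ p : ℝ) : ℂ))) •
      bipWeyl (Sum.elim (A *ᵥ p) (C *ᵥ p)) ((ψ ⊗ₜ[ℂ] φ : Hil N ⊗[ℂ] Hil M) : HilTensor _ _)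
  have hξ : ∀ ψ p q, ⟪ξ ψ q, ξ ψ p⟫_ℂ
      = ⟪ψ, (gaussFactor B c (p - q) • weyl (A *ᵥ (p - q))) ψ⟫_ℂ := by
    intro ψ p q
    have hsub : Sum.elim (A *ᵥ p) (C *ᵥ p) - Sum.elim (A *ᵥ q) (C *ᵥ q)
        = Sum.elim (A *ᵥ (p - q)) (C *ᵥ (p - q)) := by
      funext k
      cases k <;> simp [mulVec_sub]
    rw [inner_smul_left, inner_smul_right, inner_bipWeyl_bipWeyl, hphase, hsub, bipWeyl,
      opTensor_tmul, inner_hilTensor_tmul, Sum.elim_comp_inl, Sum.elim_comp_inr, hφ, hB,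
      _root_.smul_apply, inner_smul_right, gaussFactor, dotProduct_sub,
      ← Complex.exp_conj]
    simp only [Complex.ofReal_zero, mul_zero, Complex.exp_zero, one_mul, map_neg, map_mul,
      Complex.conj_I, Complex.conj_ofReal]
    have : Complex.exp (-(1 / 4 : ℂ) * (((p - q) ⬝ᵥ B *ᵥ (p - q) : ℝ) : ℂ)
          - Complex.I * ((c ⬝ᵥ p - c ⬝ᵥ q : ℝ) : ℂ))
        = Complex.exp (-(-Complex.I * ((c ⬝ᵥ q : ℝ) : ℂ)))
          * Complex.exp (-(Complex.I * ((c ⬝ᵥ p : ℝ) : ℂ)))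
          * Complex.exp (-(1 / 4 : ℂ) * (((p - q) ⬝ᵥ B *ᵥ (p - q) : ℝ) : ℂ)) := by
      rw [← Complex.exp_add, ← Complex.exp_add]
      push_cast
      ring_nf
    rw [this]
    ring
  have hcont : ∀ ψ, Continuous (ξ ψ) := by
    intro ψ
    refine continuous_of_continuous_inner _ ?_
    simp_rw [hξ ψ, _root_.smul_apply, inner_smul_right]
    refine Continuous.mul ?_ ?_
    · unfold gaussFactor
      simp only [dotProduct, mulVec]
      fun_prop
    · exact (continuous_inner_weyl ψ ψ).comp
        (continuous_const.matrix_mulVec (continuous_snd.sub continuous_fst))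
  choose μ hμ hμF using fun ψ => exists_measure_of_gram (hcont ψ)
    (f := fun p => ⟪ψ, (gaussFactor B c p • weyl (A *ᵥ p)) ψ⟫_ℂ) (hξ ψ)
  have hF0 : gaussFactor B c 0 • weyl (A *ᵥ 0) = (1 : Op (Hil N)) := by
    refine ContinuousLinearMap.ext fun ψ => ?_
    rw [mulVec_zero, _root_.smul_apply, weyl_zero]
    simp [gaussFactor]
  obtain ⟨E, hE⟩ := exists_observable_of_measure (F := fun p => gaussFactor B c p • weyl (A *ᵥ p))
    hμF hF0
  exact ⟨E, fun p ψ => by rw [hE, hμF]⟩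

/-! ### Fourier transforms of transformed and postprocessed observables -/

instance isFiniteMeasure_outcome {N M : ℕ} (E : QObservable N M) (ψ : Hil N) :
    IsFiniteMeasure (E.outcome ψ) :=
  ⟨by rw [E.outcome_apply ψ MeasurableSet.univ]; exact ENNReal.ofReal_lt_top⟩

/-- By normality the outcome measure of `Λ(E)` in a vector is a countable sum of outcome measures of
`E`, so the Fourier transform commutes with `Λ`. -/
theorem integral_expChar_mapObservable {N N' M : ℕ} (Λ : QChannel N N') {E : QObservable N' M}
    {p : Fin M → ℝ} {T : Op (Hil N')}
    (hE : ∀ φ, ∫ x, expChar p x ∂(E.outcome φ) = ⟪φ, T φ⟫_ℂ) (ψ : Hil N) :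
    ∫ x, expChar p x ∂((Λ.mapObservable E).outcome ψ) = ⟪ψ, Λ.toCP T ψ⟫_ℂ := by
  obtain ⟨φ, hφ⟩ := Λ.exists_hasSum ψ
  have hsum : (Λ.mapObservable E).outcome ψ = Measure.sum fun n => E.outcome (φ n) := by
    refine Measure.ext fun X hX => ?_
    have h := Complex.hasSum_re (hφ (E.effect X))
    rw [Measure.sum_apply _ hX, QObservable.outcome_apply _ _ hX]
    simp_rw [E.outcome_apply _ hX]
    rw [← ENNReal.ofReal_tsum_of_nonneg (fun n => E.re_nonneg (φ n) hX) h.summable, h.tsum_eq]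
    rfl
  have hint := integrable_expChar p ((Λ.mapObservable E).outcome ψ)
  rw [hsum] at hint ⊢
  have h := hasSum_integral_measure hint
  simp_rw [hE] at h
  exact h.unique (hφ T)

/-- Gaussian kernels exist: shift a centred Gaussian measure with covariance matrix `b / 2` by
`aᵀ x - d`. -/
theorem exists_gaussianKernel {M M' : ℕ} (a : Matrix (Fin M) (Fin M') ℝ)
    {b : Matrix (Fin M') (Fin M') ℝ} (hb : b.PosSemidef) (d : Fin M' → ℝ) :
    ∃ f : Kernel (Fin M → ℝ) (Fin M' → ℝ), IsMarkovKernel f ∧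
      ∀ x p, ∫ y, expChar p y ∂(f x) = expChar (a *ᵥ p) x * gaussFactor b d p := by
  let ν := multivariateGaussian (WithLp.toLp 2 (-d)) ((1 / 2 : ℝ) • b)
  have hshift : Measurable fun z : (Fin M → ℝ) × EuclideanSpace ℝ (Fin M') =>
      z.1 ᵥ* a + z.2.ofLp := by
    refine Continuous.measurable ?_
    fun_prop
  refine ⟨(Kernel.id ×ₖ Kernel.const _ ν).map fun z => z.1 ᵥ* a + z.2.ofLp,
    Kernel.IsMarkovKernel.map _ hshift, fun x p => ?_⟩
  have hshift' : Measurable fun y : EuclideanSpace ℝ (Fin M') => x ᵥ* a + y.ofLp :=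
    hshift.comp measurable_prodMk_left
  rw [Kernel.map_apply _ hshift, Kernel.prod_apply, Kernel.id_apply, Kernel.const_apply,
    Measure.dirac_prod, Measure.map_map hshift measurable_prodMk_left,
    integral_map (hshift.comp measurable_prodMk_left).aemeasurable
      (continuous_expChar p).aestronglyMeasurable]
  have h1 : ∀ y : EuclideanSpace ℝ (Fin M'), expChar p (x ᵥ* a + y.ofLp)
      = expChar (a *ᵥ p) x * Complex.exp (((inner ℝ y (WithLp.toLp 2 p) : ℝ) : ℂ) * Complex.I) := by
    intro y
    rw [expChar, expChar, ← Complex.exp_add, dotProduct_add,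
      EuclideanSpace.inner_eq_star_dotProduct, dotProduct_comm p, ← dotProduct_mulVec, dotProduct_comm x]
    push_cast
    simp only [star_trivial]
    ring_nf
  simp only [Function.comp_apply, h1]
  rw [integral_const_mul]
  congr 1
  have hS : ((1 / 2 : ℝ) • b).PosSemidef := hb.smul (by norm_num)
  rw [← charFun_apply, charFun_multivariateGaussian hS, gaussFactor,
    EuclideanSpace.inner_eq_star_dotProduct]
  congr 1
  simp only [smul_mulVec, dotProduct_smul, smul_eq_mul, star_trivial, neg_dotProduct]
  push_cast
  ring

theorem isPostprocessing_iff {N M M' : ℕ} {f : Kernel (Fin M → ℝ) (Fin M' → ℝ)}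
    {G : QObservable N M} {E : QObservable N M'} :
    IsPostprocessing f G E ↔ ∀ ψ, E.outcome ψ = (G.outcome ψ).bind f := by
  have hb : ∀ ψ X, MeasurableSet X →
      (G.outcome ψ).bind f X = ∫⁻ x, f x X ∂(G.outcome ψ) := fun ψ X hX =>
    Measure.bind_apply hX f.aemeasurable
  refine ⟨fun h ψ => Measure.ext fun X hX => ?_, fun h X hX ψ => ?_⟩
  · rw [h X hX ψ, hb ψ X hX]
  · rw [h ψ, hb ψ X hX]

theorem integral_expChar_bind {M M' : ℕ} {f : Kernel (Fin M → ℝ) (Fin M' → ℝ)} [IsMarkovKernel f]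
    {p : Fin M' → ℝ} {q : Fin M → ℝ} {g : ℂ}
    (hf : ∀ x, ∫ y, expChar p y ∂(f x) = expChar q x * g)
    (μ : Measure (Fin M → ℝ)) [IsFiniteMeasure μ] :
    ∫ y, expChar p y ∂(μ.bind f) = (∫ x, expChar q x ∂μ) * g := by
  have h := Kernel.integral_comp (η := f) (κ := Kernel.const Unit μ) (a := ())
    (integrable_expChar p _)
  rw [Measure.comp_eq_comp_const_apply, h, Kernel.const_apply]
  simp_rw [hf]
  exact integral_mul_const _ _

/-! ### Noise condition and Gaussian incompatibility breaking -/

/-- The scalar multiples of Weyl operators are determined by their diagonal matrix elements: in the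
coherent states `W(z) φ`, with `φ` the vacuum, the elements of `W(x)` have phase `exp(i zᵀ Ω x)`. -/
theorem eq_of_smul_weyl_eq {N : ℕ} {x y : Mode N → ℝ} {α β : ℂ} (hα : α ≠ 0)
    (h : ∀ ψ, α * ⟪ψ, weyl x ψ⟫_ℂ = β * ⟪ψ, weyl y ψ⟫_ℂ) : x = y ∧ α = β := by
  obtain ⟨φ, hφ⟩ := exists_vacuum N
  have hanti : ∀ u v : Mode N → ℝ, u ⬝ᵥ Omega N *ᵥ v = -(v ⬝ᵥ Omega N *ᵥ u) := by
    intro u v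
    rw [dotProduct_Omega, dotProduct_Omega, dotProduct_comm (pos u), dotProduct_comm (mom u)]
    ring
  have hcoh : ∀ z u : Mode N → ℝ, ⟪weyl z φ, weyl u (weyl z φ)⟫_ℂ
      = Complex.exp (Complex.I * ((z ⬝ᵥ Omega N *ᵥ u : ℝ) : ℂ)) * ⟪φ, weyl u φ⟫_ℂ := by
    intro z u
    rw [weyl_weyl, inner_smul_right, inner_weyl_weyl, add_sub_cancel_right, ← mul_assoc,
      ← Complex.exp_add, mulVec_add, dotProduct_add, hanti u z]
    have hz : z ⬝ᵥ Omega N *ᵥ z = 0 := by linarith [hanti z z]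
    rw [hz]
    push_cast
    ring_nf
  have hne : ∀ u, ⟪φ, weyl u φ⟫_ℂ ≠ 0 := fun u => by
    rw [hφ]
    exact Complex.exp_ne_zero _
  have h0 := h φ
  have hxy : x = y := by
    by_contra hxy
    have hw : 0 < (x - y) ⬝ᵥ (x - y) := by
      have h1 : (x - y) ⬝ᵥ star (x - y) ≠ 0 :=
        dotProduct_star_self_eq_zero.not.mpr (sub_ne_zero.mpr hxy)
      rw [star_trivial] at h1
      exact lt_of_le_of_ne (Finset.sum_nonneg fun i _ => mul_self_nonneg _) h1.symm
    set w := x - y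
    -- the coherent state for which the two phases differ by `π`
    set z := (Real.pi / (w ⬝ᵥ w)) • (Omega N *ᵥ w)
    have hzw : z ⬝ᵥ Omega N *ᵥ x = z ⬝ᵥ Omega N *ᵥ y + Real.pi := by
      have h1 : z ⬝ᵥ Omega N *ᵥ w = Real.pi := by
        rw [smul_dotProduct, dotProduct_Omega, pos_Omega, mom_Omega, neg_dotProduct, sub_neg_eq_add,
          add_comm, ← dotProduct_eq_pos_mom, smul_eq_mul, div_mul_cancel₀ _ hw.ne']
      rw [mulVec_sub, dotProduct_sub] at h1
      linarith
    have h1 := h (weyl z φ)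
    rw [hcoh, hcoh, hzw, Complex.ofReal_add, mul_add, Complex.exp_add,
      mul_comm Complex.I (Real.pi : ℂ), Complex.exp_pi_mul_I] at h1
    have h2 : Complex.exp (Complex.I * ((z ⬝ᵥ Omega N *ᵥ y : ℝ) : ℂ))
        * (α * ⟪φ, weyl x φ⟫_ℂ) = 0 := by
      linear_combination (-1 / 2 : ℂ) * h1 +
        (1 / 2 : ℂ) * Complex.exp (Complex.I * ((z ⬝ᵥ Omega N *ᵥ y : ℝ) : ℂ)) * h0
    exact mul_ne_zero (Complex.exp_ne_zero _) (mul_ne_zero hα (hne x)) h2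
  subst hxy
  exact ⟨rfl, mul_right_cancel₀ (hne x) h0⟩

/-- If `B - i Aᵀ Ω A ≥ 0` there is a Gaussian observable with parameters `(A, B, c)`, and the image
of every Gaussian observable under the channel is a postprocessing of it. -/
theorem isGaussianIncompatibilityBreaking_of_noise {N N' : ℕ} {Λ : QChannel N N'}
    {A : Matrix (Mode N) (Mode N') ℝ} {B : Matrix (Mode N') (Mode N') ℝ} {c : Mode N' → ℝ}
    (hΛ : ∀ x, Λ.toCP (weyl x) = gaussFactor B c x • weyl (A *ᵥ x))
    (h : (complexComb B (-(Aᵀ * Omega N * A))).PosSemidef) :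
    Λ.IsGaussianIncompatibilityBreaking := by
  let e := Fintype.equivFin (Mode N')
  let A' := A.submatrix id e.symm
  let B' := B.submatrix e.symm e.symm
  have hA' : ∀ q, A' *ᵥ q = A *ᵥ (q ∘ e) := fun q => by
    rw [submatrix_mulVec_equiv, Equiv.symm_symm, Function.comp_id]
  have hB' : ∀ q, q ⬝ᵥ B' *ᵥ q = (q ∘ e) ⬝ᵥ B *ᵥ (q ∘ e) := fun q => by
    rw [submatrix_mulVec_equiv, Equiv.symm_symm, dotProduct_comp_equiv_symm]
  have h' : (complexComb B' (-(A'ᵀ * Omega N * A'))).PosSemidef := by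
    have h1 := h.submatrix e.symm
    have h2 : (complexComb B (-(Aᵀ * Omega N * A))).submatrix e.symm e.symm
        = complexComb B' (-(A'ᵀ * Omega N * A')) := by
      ext i j
      simp [complexComb, A', B', Matrix.mul_apply]
    rwa [h2] at h1
  obtain ⟨G, hG⟩ := exists_gaussianObservable h' (c ∘ e.symm)
  refine ⟨_, G, ⟨A', B', c ∘ e.symm, h', hG⟩, ?_⟩
  rintro _ ⟨E, ⟨K, L, m, hKL, hE⟩, rfl⟩
  obtain ⟨M, E⟩ := E
  rw [posSemidef_noise_iff] at hKL
  have hL : L.PosSemidef := by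
    refine PosSemidef.of_dotProduct_mulVec_nonneg ?_ fun u => ?_
    · rw [IsHermitian, conjTranspose_eq_transpose_of_trivial]
      exact hKL.1
    · simpa using hKL.2 u 0
  obtain ⟨f, hf, hfF⟩ := exists_gaussianKernel (K.submatrix e.symm id) hL m
  refine ⟨f, ⟨hf, _, L, m, hL, hfF⟩, isPostprocessing_iff.mpr fun ψ => ?_⟩
  refine measure_ext_of_expChar fun p => ?_
  have hK : (K.submatrix e.symm id *ᵥ p) ∘ e = K *ᵥ p := by
    funext k
    simp [mulVec, dotProduct]
  have hG' : gaussFactor B' (c ∘ e.symm) (K.submatrix e.symm id *ᵥ p)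
      = gaussFactor B c (K *ᵥ p) := by
    rw [gaussFactor, hB', hK, comp_equiv_symm_dotProduct, hK, gaussFactor]
  rw [integral_expChar_bind (fun x => hfF x p), hG, hG', hA', hK,
    integral_expChar_mapObservable Λ (hE p), map_smul, hΛ]
  simp only [_root_.smul_apply, inner_smul_right]
  ring

/-- Testing compatibility on the quadratures `-uᵀ Ω R` alone: if `G` has parameters `(K, L, m)`, the
postprocessing producing the image of the quadrature yields a vector `a` with `K a = A u` and
`aᵀ L a ≤ uᵀ B u`, so positivity of `L - i Kᵀ Ω K` implies that of `B - i Aᵀ Ω A`. -/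
theorem noise_of_isGaussianIncompatibilityBreaking {N N' : ℕ} {Λ : QChannel N N'}
    {A : Matrix (Mode N) (Mode N') ℝ} {B : Matrix (Mode N') (Mode N') ℝ} {c : Mode N' → ℝ}
    (hΛ : ∀ x, Λ.toCP (weyl x) = gaussFactor B c x • weyl (A *ᵥ x)) (hB : Bᵀ = B)
    (h : Λ.IsGaussianIncompatibilityBreaking) :
    (complexComb B (-(Aᵀ * Omega N * A))).PosSemidef := by
  obtain ⟨M₀, G, ⟨K, L, m, hKL, hG⟩, hE⟩ := h
  -- the quadrature belonging to `u` is the Gaussian observable with parameters `(u, 0, 0)`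
  have key : ∀ u : Mode N' → ℝ, ∃ a : Fin M₀ → ℝ, K *ᵥ a = A *ᵥ u ∧
      a ⬝ᵥ L *ᵥ a ≤ u ⬝ᵥ B *ᵥ u := by
    intro u
    let U : Matrix (Mode N') (Fin 1) ℝ := Matrix.of fun k _ => u k
    have hU : ∀ s, U *ᵥ s = s 0 • u := by
      intro s
      funext k
      simp [U, mulVec, dotProduct, mul_comm]
    have hU0 : (complexComb 0 (-(Uᵀ * Omega N' * U))).PosSemidef := by
      refine posSemidef_noise_iff.mpr ⟨transpose_zero, fun s t => ?_⟩
      have h0 : u ⬝ᵥ Omega N' *ᵥ u = 0 := by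
        rw [dotProduct_Omega, dotProduct_comm, sub_self]
      rw [hU, hU, mulVec_smul, smul_dotProduct, dotProduct_smul, h0]
      simp
    obtain ⟨E, hEF⟩ := exists_gaussianObservable hU0 0
    obtain ⟨f, ⟨hf, a, b, d, hb, hfF⟩, hpost⟩ :=
      hE _ ⟨⟨1, E⟩, ⟨U, 0, 0, hU0, fun p ψ => hEF p ψ⟩, rfl⟩
    rw [isPostprocessing_iff] at hpost
    let p : Fin 1 → ℝ := 1
    have hp : gaussFactor (0 : Matrix (Fin 1) (Fin 1) ℝ) 0 p • weyl (U *ᵥ p) = weyl u := by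
      rw [hU]
      simp [gaussFactor, p]
    have heq : ∀ ψ, gaussFactor B c u * ⟪ψ, weyl (A *ᵥ u) ψ⟫_ℂ
        = (gaussFactor L m (a *ᵥ p) * gaussFactor b d p) * ⟪ψ, weyl (K *ᵥ (a *ᵥ p)) ψ⟫_ℂ := by
      intro ψ
      have h1 := congrArg (fun μ => ∫ x, expChar p x ∂μ) (hpost ψ)
      have h2 := integral_expChar_bind (fun x => hfF x p) (G.outcome ψ)
      have h3 := integral_expChar_mapObservable Λ (hEF p) ψ
      have h4 : ∫ x, expChar (a *ᵥ p) x ∂(G.outcome ψ) = _ := hG (a *ᵥ p) ψ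
      rw [hp, hΛ, _root_.smul_apply, inner_smul_right] at h3
      rw [h4, _root_.smul_apply, inner_smul_right] at h2
      refine h3.symm.trans (h1.trans (h2.trans ?_))
      ring
    obtain ⟨h1, h2⟩ := eq_of_smul_weyl_eq (gaussFactor_ne_zero B c u) heq
    refine ⟨a *ᵥ p, h1.symm, ?_⟩
    have h3 := congrArg norm h2
    rw [norm_mul, gaussFactor_norm, gaussFactor_norm, gaussFactor_norm, ← Real.exp_add,
      Real.exp_eq_exp] at h3
    have h4 : 0 ≤ p ⬝ᵥ b *ᵥ p := by simpa using hb.dotProduct_mulVec_nonneg p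
    linarith
  refine posSemidef_noise_iff.mpr ⟨hB, fun u v => ?_⟩
  obtain ⟨a, ha, haL⟩ := key u
  obtain ⟨a', ha', haL'⟩ := key v
  have h1 := (posSemidef_noise_iff.mp hKL).2 a a'
  rw [ha, ha'] at h1
  linarith

end GaussianCV

theorem mainTheorem2 {N N' : ℕ} (Λ : GaussianCV.QChannel N N') (hΛ : Λ.IsGaussian) :
    List.TFAE
      [Λ.IsGaussianIncompatibilityBreaking,
        Λ.IsGaussianSteerabilityBreaking,
        ∀ r : ℝ, 0 < r → ∀ ρ : GaussianCV.QState
            (GaussianCV.HilTensor (GaussianCV.Hil N) (GaussianCV.Hil N)),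
          GaussianCV.IsEPR r ρ → Λ.BreaksSteerability ρ] := by
  obtain ⟨A, B, c, hAB, hW⟩ := hΛ
  have hB := (GaussianCV.complexComb_isHermitian hAB.isHermitian).1
  tfae_have 1 → 2 := fun h => GaussianCV.isGaussianSteerabilityBreaking_of_noise hW
    (GaussianCV.noise_of_isGaussianIncompatibilityBreaking hW hB h)
  tfae_have 2 → 3 := fun h r _ ρ hρ => h N ρ _ _ hρ
  tfae_have 3 → 1 := fun h => GaussianCV.isGaussianIncompatibilityBreaking_of_noise hW
    (GaussianCV.noise_of_breaksSteerability_epr hW hB fun r hr => by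
      obtain ⟨ρ, hρ⟩ := GaussianCV.exists_isEPR N hr
      exact ⟨ρ, hρ, h r hr ρ hρ⟩)
  tfae_finish
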